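/- Consider a chain of $N\ge 2$ four-dimensional spins, each consisting of two qubits $a$ and $b$ ($X,Y,Z$ are the Pauli matrices, $Z|0\rangle=|0\rangle$, $Z|1\rangle=-|1\rangle$), with the permanently present Hamiltonian $$H_1=\tfrac12\sum_{n=1}^{N-1}(XX+YY)^a_{n,n+1}\otimes \mathrm{SWAP}^b_{n,n+1},$$ and let $H_{ST}=\tfrac12(Z_1+Z_N)+\tfrac12\sum_{i=1}^{N-1}(X_iX_{i+1}+Y_iY_{i+1})$ be the state-transfer Hamiltonian of a chain of $N$ qubits. Let $|n\rangle$ be the state of $N$ qubits with a single $|1\rangle$, on spin $n$, and let $\Pi_s=\mathrm{SWAP}_{N-1,N}\cdots \mathrm{SWAP}_{s,s+1}$, an operator on the $b$ qubits. A control protocol is a finite adaptive sequence of: waiting for a time $t\ge0$ under $H_1$, to which fields $fZ_1^a+gZ_N^a$ with real $f,g$ may be added; instantaneous unitaries on the controlled spins; measurements of whether the $a$ qubit of spin $N$ is in $|1\rangle$; each branch ends by announcing success or failure. Its time is the largest total waiting time over its branches. It implements $u^a\otimes\psi^b\mapsto v^a\otimes(W\psi)^b$ with failure probability less than $\varepsilon$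 if in each successful branch the (unnormalized) final state is $c\,v\otimes W\psi$ for every $\psi$, with a number $c$ depending only on the branch, and the sum of $|c|^2$ over the successful branches is larger than $1-\varepsilon$. "End control" means unitaries on spin $1$ and on spin $N$; "full control" means joint unitaries on spins $1,2$, and unitaries on spin $N$. Then: 1. $[H_1,\sum_n Z_n^a]=0$. If $\psi_{n+1}=\mathrm{SWAP}_{n,n+1}\psi_n$ for $1\le n<N$, then $H_1|n\rangle^a|\psi_n\rangle^b=|n-1\rangle^a|\psi_{n-1}\rangle^b+|n+1\rangle^a|\psi_{n+1}\rangle^b$ (terms with index $0$ or $N+1$ are absent). Under $|n\rangle\mapsto|n\rangle^a|\psi_n\rangle^b$ the action of $H_{ST}-\tfrac12(Z_1+Z_N)$ on the single-excitation subspace becomes that of $H_1$, and, for every real $h$, that of $H_{ST}+(h-\tfrac12)(Z_1+Z_N)$ becomes that of $H_1+h(Z_1^a+Z_N^a)$ (so $h=\tfrac12$ gives $H_{ST}$). 2. Start in $|s\rangle^a|\psi\rangle^b$, evolve under $H_1+h(Z_1^a+Z_N^a)$, measure the $a$ qubit of spin $N$ at the end of each of a list of waiting times, and stop at the first time it is found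 in $|1\rangle$. At each of these measurements, after the previous ones have failed, the unnormalized successful state is $z\,|N\rangle^a(\Pi_s\psi)^b$, where $z$ is the amplitude for the same event for the chain $H_{ST}+(h-\tfrac12)(Z_1+Z_N)$ started in $|s\rangle$. 3. $\Pi_s$ is the cyclic permutation of the $b$ qubits $s,\dots,N$ that moves qubit $s$ to spin $N$ and each qubit $j$ with $s<j\le N$ to spin $j-1$, and fixes the others; thus $\Pi_1$ cycles all qubits and $\Pi_2$ the qubits $2,\dots,N$. For any $i\ne j$ there are $m<N$ and $l<N-1$ such that $\Pi_2^l\Pi_1^m$ places qubit $i$ on spin $1$ and qubit $j$ on spin $2$. 4. There are constants $C,c>0$ such that for every $N\ge2$ there is a protocol with end control and time at most $CN$ implementing $|1\rangle^a\psi^b\mapsto|N\rangle^a(\Pi_1\psi)^b$ with success probability larger than $cN^{-1/3}$, and one with full control, within the same time and with success probability larger than the same bound, implementing $|2\rangle^a\psi^b\mapsto|N\rangle^a(\Pi_2\psi)^b$. 5. There is a constant $C>0$ such that for every $N\ge2$ and $0<\varepsilon\le\frac12$ the same two maps are implemented with failure probability less than $\varepsilon$ in a time at most $CN^{5/3}\log(1/\varepsilon)$,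 with end control and full control respectively. 6. There is a constant $C>0$ such that for every $N\ge2$ and $0<\varepsilon\le\frac12$, every one-qubit unitary on any $b$ qubit and every two-qubit unitary on any pair of distinct $b$ qubits (with the $a$ qubits in $|0\rangle^{\otimes N}$ before and after) is implemented with full control and failure probability less than $\varepsilon$ in a time at most $CN^{8/3}\log(1/\varepsilon)$. 7. Universality: for every $N\ge2$ and $\varepsilon>0$, every unitary $W$ on the $N$ $b$ qubits (with the $a$ qubits in $|0\rangle^{\otimes N}$ before and after) is implemented by some protocol with full control and failure probability less than $\varepsilon$. -/

import Mathlib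

open scoped Kronecker NNReal

noncomputable section

namespace UQI

/-! The chain has `N = n + 2` spins, indexed by `Fin (n + 2)`: spin `1` of the text is the index `0`,
spin `2` is the index `1`, and spin `N` is `Fin.last (n + 1)`.  The value `1 : Fin 2` of a qubit
is the excited state. -/

/-- Computational basis of a register of `N = n + 2` qubits. -/
abbrev Cfg (n : ℕ) := Fin (n + 2) → Fin 2

/-- Vectors of a register of `N` qubits. -/
abbrev Reg (n : ℕ) := Cfg n → ℂ

/-- Operators on a register of `N` qubits. -/
abbrev Op (n : ℕ) := Matrix (Cfg n) (Cfg n) ℂ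

/-- Operators on the chain of `N` four-dimensional spins, that is on the
`a` register (first factor) tensored with the `b` register (second factor). -/
abbrev Op2 (n : ℕ) := Matrix (Cfg n × Cfg n) (Cfg n × Cfg n) ℂ

/-- Pauli X. -/
def pauliX : Matrix (Fin 2) (Fin 2) ℂ := !![0, 1; 1, 0]

/-- Pauli Y. -/
def pauliY : Matrix (Fin 2) (Fin 2) ℂ := !![0, -Complex.I; Complex.I, 0]

/-- Pauli Z. -/
def pauliZ : Matrix (Fin 2) (Fin 2) ℂ := !![1, 0; 0, -1]

/-- The one-qubit operator `A` on qubit `k` (identity on all other qubits). -/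
def site {n : ℕ} (k : Fin (n + 2)) (A : Matrix (Fin 2) (Fin 2) ℂ) : Op n :=
  Matrix.of fun x y => if ∀ l, l ≠ k → x l = y l then A (x k) (y k) else 0

/-- The two-qubit operator `A` on the ordered pair of qubits `j, k`
(identity on all other qubits); used for `j ≠ k`. -/
def site₂ {n : ℕ} (j k : Fin (n + 2)) (A : Matrix (Fin 2 × Fin 2) (Fin 2 × Fin 2) ℂ) : Op n :=
  Matrix.of fun x y =>
    if ∀ l, l ≠ j → l ≠ k → x l = y l then A (x j, x k) (y j, y k) else 0

/-- The exchange of the qubits `j` and `k`. -/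
def swapOp {n : ℕ} (j k : Fin (n + 2)) : Op n :=
  Matrix.of fun x y => if x = y ∘ Equiv.swap j k then 1 else 0

/-- `X_j X_k + Y_j Y_k`. -/
def exchange {n : ℕ} (j k : Fin (n + 2)) : Op n :=
  site j pauliX * site k pauliX + site j pauliY * site k pauliY

/-- `Z_1 + Z_N`. -/
def boundaryZ (n : ℕ) : Op n := site 0 pauliZ + site (Fin.last (n + 1)) pauliZ

/-- The state-transfer Hamiltonian
`H_ST = ½ (Z_1 + Z_N) + ½ ∑ (X_i X_{i+1} + Y_i Y_{i+1})`. -/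
def hamST (n : ℕ) : Op n :=
  (1 / 2 : ℂ) • boundaryZ n + (1 / 2 : ℂ) • ∑ i : Fin (n + 1), exchange i.castSucc i.succ

/-- `H_1 = ½ ∑ (XX + YY)^a_{i,i+1} ⊗ SWAP^b_{i,i+1}`. -/
def ham₁ (n : ℕ) : Op2 n :=
  (1 / 2 : ℂ) • ∑ i : Fin (n + 1), exchange i.castSucc i.succ ⊗ₖ swapOp i.castSucc i.succ

/-- An operator on the `a` register, extended by the identity of the `b` register. -/
def onA {n : ℕ} (A : Op n) : Op2 n := A ⊗ₖ (1 : Op n)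

/-- Total `Z` of a register. -/
def totalZ (n : ℕ) : Op n := ∑ k, site k pauliZ

/-- Time evolution `exp (-i t H)`. -/
def evol {ι : Type} [Fintype ι] [DecidableEq ι] (H : Matrix ι ι ℂ) (t : ℝ) : Matrix ι ι ℂ :=
  NormedSpace.exp ((-(t : ℂ) * Complex.I) • H)

/-- `|n⟩`: one excitation, on spin `k`. -/
def ket {n : ℕ} (k : Fin (n + 2)) : Reg n := Pi.single (Pi.single k 1) 1

/-- The state of a register without excitations. -/
def vac (n : ℕ) : Reg n := Pi.single 0 1

/-- The product vector `u^a ⊗ v^b`. -/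
def tens {n : ℕ} (u v : Reg n) : Cfg n × Cfg n → ℂ := fun p => u p.1 * v p.2

/-- `∑ α_k |k⟩`, a vector of the single-excitation subspace of a chain of qubits. -/
def chainVec {n : ℕ} (α : Fin (n + 2) → ℂ) : Reg n := ∑ k, α k • ket k

/-- `∑ α_k |k⟩^a |ψ_k⟩^b`. -/
def dressedVec {n : ℕ} (ψ : Fin (n + 2) → Reg n) (α : Fin (n + 2) → ℂ) : Cfg n × Cfg n → ℂ :=
  ∑ k, α k • tens (ket k) (ψ k)

/-- The ordered product `SWAP_{N-1,N} ⋯ SWAP_{s,s+1}` (the rightmost factor acts first). -/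
def swapChain {n : ℕ} (s : Fin (n + 2)) : Op n :=
  ((((List.finRange (n + 1)).filter fun i => s ≤ i.castSucc).reverse).map
    fun i => swapOp i.castSucc i.succ).prod

/-- The operator that applies `V`, an operator on the spins in `S`
(both their `a` and `b` qubits), and the identity on all other spins. -/
def onSpins {n : ℕ} (S : Finset (Fin (n + 2)))
    (V : Matrix ((S → Fin 2) × (S → Fin 2)) ((S → Fin 2) × (S → Fin 2)) ℂ) : Op2 n :=
  Matrix.of fun p q =>
    if ∀ l, l ∉ S → p.1 l = q.1 l ∧ p.2 l = q.2 l then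
      V (fun l => p.1 l, fun l => p.2 l) (fun l => q.1 l, fun l => q.2 l)
    else 0

/-- The projector on `a`-qubit of spin `N` being excited. -/
def arrived (n : ℕ) : Op n := site (Fin.last (n + 1)) !![0, 0; 0, 1]

/-- The permanently present Hamiltonian `H_1`, with fields along `Z` of strengths `f` and `g`
on the `a` qubits of the controlled spins `1` and `N`. -/
def hamField (n : ℕ) (f g : ℝ) : Op2 n :=
  ham₁ n + (f : ℂ) • onA (site 0 pauliZ) + (g : ℂ) • onA (site (Fin.last (n + 1)) pauliZ)

/-- Adaptive control protocols.  `R` lists the sets of spins on which joint control is available.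
* `halt b` : end of the protocol; `b = true` announces success;
* `evolve t f g p` : wait for the time `t` under `H_1` with `Z` fields `f`, `g` on the
  `a` qubits of spins `1` and `N`;
* `control S _ V p` : an instantaneous unitary `V` on the controlled spins in `S`;
* `measure p q` : measure whether the `a` qubit of spin `N` is excited,
  continue with `p` if it is and with `q` if it is not. -/
inductive Protocol (n : ℕ) (R : Set (Finset (Fin (n + 2)))) : Type
  | halt (success : Bool) : Protocol n R
  | evolve (t : ℝ≥0) (f g : ℝ) (next : Protocol n R) : Protocol n R
  | control (S : Finset (Fin (n + 2))) (hS : S ∈ R)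
      (V : Matrix.unitaryGroup ((S → Fin 2) × (S → Fin 2)) ℂ) (next : Protocol n R) : Protocol n R
  | measure (excited other : Protocol n R) : Protocol n R

/-- The (longest possible) duration of a protocol. -/
def Protocol.duration {n : ℕ} {R : Set (Finset (Fin (n + 2)))} : Protocol n R → ℝ
  | .halt _ => 0
  | .evolve t _ _ p => t + p.duration
  | .control _ _ _ p => p.duration
  | .measure p q => max p.duration q.duration

/-- The list of the (unnormalized) operators applied to the state in the different branches of
the protocol that end with the announcement of success. -/
def Protocol.successOps {n : ℕ} {R : Set (Finset (Fin (n + 2)))} : Protocol n R → List (Op2 n)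
  | .halt true => [1]
  | .halt false => []
  | .evolve t f g p => p.successOps.map fun K => K * evol (hamField n f g) t
  | .control S _ V p => p.successOps.map fun K => K * onSpins S (V : Matrix _ _ ℂ)
  | .measure p q =>
      (p.successOps.map fun K => K * onA (arrived n)) ++
        (q.successOps.map fun K => K * onA (1 - arrived n))

/-- The protocol takes `u^a ⊗ ψ^b` to `v^a ⊗ (W ψ)^b`, for all `ψ`, whenever it announces success,
and it announces success with probability larger than `p`.  In every successful branch the output
is exact up to a scalar (the same for all `ψ`), whose squared modulus is the
probability of the branch when `u`, `v` are unit vectors and `W` is unitary. -/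
def Protocol.Heralds {n : ℕ} {R : Set (Finset (Fin (n + 2)))} (P : Protocol n R)
    (u v : Reg n) (W : Op n) (p : ℝ) : Prop :=
  ∃ c : List ℂ,
    List.Forall₂ (fun K z => ∀ ψ : Reg n,
      K.mulVec (tens u ψ) = z • tens v (W.mulVec ψ)) P.successOps c ∧
    p < (c.map fun z => ‖z‖ ^ 2).sum

/-- Control of spin `1` and of spin `N`. -/
def endControl (n : ℕ) : Set (Finset (Fin (n + 2))) := {{0}, {Fin.last (n + 1)}}

/-- Joint control of spins `1` and `2`, and control of spin `N`. -/
def fullControl (n : ℕ) : Set (Finset (Fin (n + 2))) := {{0, 1}, {Fin.last (n + 1)}}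

/-- Measure and repeat: wait for the next of the given times (with fields `h` on spins `1` and `N`),
measure the `a` qubit of spin `N`, announce success if it is excited and go on otherwise. -/
def measureRepeat (n : ℕ) (h : ℝ) : List ℝ≥0 → Protocol n (endControl n)
  | [] => .halt false
  | t :: ts => .evolve t h h (.measure (.halt true) (measureRepeat n h ts))

/-- Measure and repeat on a chain of qubits with Hamiltonian `H`, from the state `v`: the list of
the amplitudes with which the excitation is found in `|N⟩` at the successive measurements of
spin `N`, all the previous ones having failed. -/
def arrivalAmps {n : ℕ} (H : Op n) : List ℝ≥0 → Reg n → List ℂ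
  | [], _ => []
  | t :: ts, v =>
      (evol H t).mulVec v (Pi.single (Fin.last (n + 1)) 1) ::
        arrivalAmps H ts ((1 - arrived n).mulVec ((evol H t).mulVec v))

end UQI

end

/-! The exchange on a bond moves the excitation across it and swaps the two `b` qubits of that bond.
A swap is an involution, so a crossing back undoes it: the state of the `b` register depends only on
where the excitation is, not on its route. Hence, if ψ_{k+1} = SWAP ψ_k, the span of the vectors
|k⟩|ψ_k⟩ is invariant and `ham₁` acts on it as the adjacency matrix `hop` of a path
(`ham₁_mulVec_tens`). Fields, phases and the measurement act there diagonally.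
`exp_mul_of_intertwine` carries the intertwining over to time evolution, and every detection on the
last spin has applied the product of swaps. What remains is to steer a vector of ℂ^N;
`exists_protocol_steps` shows that the failure probability is the squared norm left after all
measurements.

The steering uses only fast phases on the two end sites. Averaging two phase settings switches off
the last bond and gives the first bond any complex coupling of modulus at most one; a slowly
accumulated phase acts as a field (`driveGen_mulVec`, made rigorous by `Generates.reach`). The
interior then has sine modes, and a trajectory is prescribed rather than solved for: the modes are
fed by a chosen resonant pulse, norm conservation fixes the amplitude of the first site, and the
controls are read off (`reach_driveState`). A pulse of width of order N puts amplitude 1/2 into the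
central mode, where the levels are about 1/N apart; the reflected process empties that mode into the
last site (`exists_transfer`). This moves about a quarter of the population in time O(N), which
gives a constant success probability.

For failure below ε the attempt is repeated, so a failed one must leave a multiple of the initial
vector. The pulse is averaged with delayed copies of itself that cancel every off-resonant mode
(`exists_selective_pulse`); the delays form a harmonic sum, so an attempt takes time O(N log N),
bounded by N^{4/3}, and O(log(1/ε)) attempts suffice (`nrm_run_replicate_le`).

A remote gate is conjugated to spins 1 and 2 by powers of the two cycles, which are undone by
completing their periods; this takes 2N − 1 transfers (`implements_site₂`). For universality,
controlled NOTs and phases give all parities, which span all diagonal phases (`phaseSpace_eq_top`).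
Diagonal operators and one-qubit gates bring any vector to a multiple of |0…0⟩
(`exists_mulVec_eq_single`), hence give all complex reflections, and a Householder induction gives
every unitary (`mem_gateProducts_of_fixed`). -/

noncomputable section
namespace UQI

/-! ### Operators on a register -/

section Register

variable {n : ℕ}

/-- The permutation of qubits that maps the basis state `x` to `x ∘ σ`. -/
def permOp (σ : Equiv.Perm (Fin (n + 2))) : Op n :=
  Matrix.of fun x y => if x = y ∘ σ then 1 else 0

lemma swapOp_eq_permOp (j k : Fin (n + 2)) : swapOp j k = permOp (Equiv.swap j k) := rfl

lemma mul_permOp_apply (M : Op n) (σ : Equiv.Perm (Fin (n + 2))) (x y : Cfg n) :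
    (M * permOp σ) x y = M x (y ∘ σ) := by
  simp [Matrix.mul_apply, permOp]

lemma permOp_mul_apply (M : Op n) (σ : Equiv.Perm (Fin (n + 2))) (x y : Cfg n) :
    (permOp σ * M) x y = M (x ∘ σ.symm) y := by
  have h : ∀ z : Cfg n, x = z ∘ σ ↔ z = x ∘ σ.symm := fun z =>
    ⟨fun h => by ext l; simp [h], fun h => by ext l; simp [h]⟩
  simp [Matrix.mul_apply, permOp, h]

/-- Permutations act on configurations by composition on the right, hence the reversed order. -/
lemma permOp_mul (σ τ : Equiv.Perm (Fin (n + 2))) :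
    (permOp σ * permOp τ : Op n) = permOp (τ * σ) := by
  ext x y
  rw [mul_permOp_apply]
  simp only [permOp, Matrix.of_apply, Function.comp_assoc, Equiv.Perm.coe_mul]
  congr

@[simp] lemma permOp_one : (permOp 1 : Op n) = 1 := by
  ext x y
  simp [permOp, Matrix.one_apply]

lemma permOp_pow (σ : Equiv.Perm (Fin (n + 2))) (m : ℕ) :
    (permOp σ : Op n) ^ m = permOp (σ ^ m) := by
  induction m with
  | zero => simp
  | succ m ih => rw [pow_succ, ih, permOp_mul, pow_succ']

lemma permOp_mulVec_single (σ : Equiv.Perm (Fin (n + 2))) (x : Cfg n) :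
    (permOp σ).mulVec (Pi.single x 1) = Pi.single (x ∘ σ) 1 := by
  ext y
  simp [permOp, Pi.single_apply]

lemma permOp_symm_mul_mul (M : Op n) (σ : Equiv.Perm (Fin (n + 2))) (x y : Cfg n) :
    (permOp σ.symm * M * permOp σ) x y = M (x ∘ σ) (y ∘ σ) := by
  rw [mul_permOp_apply, permOp_mul_apply, Equiv.symm_symm]

lemma swapOp_mul_self (j k : Fin (n + 2)) : (swapOp j k : Op n) * swapOp j k = 1 := by
  rw [swapOp_eq_permOp, permOp_mul]
  simp

/-- This is what turns a gate on the controlled pair into a gate on an arbitrary pair: σ will be a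
product of cycles. -/
lemma permOp_conj_site₂ (σ : Equiv.Perm (Fin (n + 2))) (j k : Fin (n + 2))
    (A : Matrix (Fin 2 × Fin 2) (Fin 2 × Fin 2) ℂ) :
    permOp σ.symm * site₂ j k A * permOp σ = site₂ (σ j) (σ k) A := by
  ext x y
  rw [permOp_symm_mul_mul]
  simp only [site₂, Matrix.of_apply, Function.comp_apply]
  congr 1
  apply propext
  constructor
  · intro h l hj hk
    have := h (σ.symm l) (fun h => hj (by simp [← h])) (fun h => hk (by simp [← h]))
    simpa using this
  · intro h l hj hk
    exact h (σ l) (fun h => hj (σ.injective h)) (fun h => hk (σ.injective h))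

lemma site_mul_site {j k : Fin (n + 2)} (hjk : j ≠ k) (A B : Matrix (Fin 2) (Fin 2) ℂ) :
    (site j A * site k B : Op n) = site₂ j k (A ⊗ₖ B) := by
  ext x y
  simp only [Matrix.mul_apply, site, site₂, Matrix.of_apply, Matrix.kroneckerMap_apply]
  -- An intermediate configuration that contributes agrees with x off j and with y off k, so it
  -- takes the value y j at j.
  rw [Finset.sum_eq_single (Function.update x j (y j))]
  · have h1 : ∀ l, l ≠ j → x l = Function.update x j (y j) l := fun l hl => by simp [hl]
    rw [if_pos h1]
    simp only [Function.update_self, Function.update_of_ne hjk.symm]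
    by_cases h : ∀ l, l ≠ j → l ≠ k → x l = y l
    · rw [if_pos h, if_pos]
      intro l hl
      by_cases hlj : l = j
      · subst hlj; simp
      · simp [hlj, h l hlj hl]
    · rw [if_neg h, if_neg, mul_zero]
      intro h'
      apply h
      intro l hlj hlk
      simpa [hlj] using h' l hlk
  · intro z _ hz
    by_cases h1 : ∀ l, l ≠ j → x l = z l
    · rw [if_neg (c := ∀ l, l ≠ k → z l = y l), mul_zero]
      intro h2
      apply hz
      ext l
      by_cases hlj : l = j
      · subst hlj; simp [h2 l hjk]
      · simp [hlj, h1 l hlj]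
    · rw [if_neg h1, zero_mul]
  · simp

lemma site₂_add (j k : Fin (n + 2)) (A B : Matrix (Fin 2 × Fin 2) (Fin 2 × Fin 2) ℂ) :
    (site₂ j k A + site₂ j k B : Op n) = site₂ j k (A + B) := by
  ext x y
  simp only [site₂, Matrix.add_apply, Matrix.of_apply]
  split_ifs <;> simp

/-- The entries of `X_j X_k + Y_j Y_k`. -/
lemma exchange_apply {j k : Fin (n + 2)} (hjk : j ≠ k) (x y : Cfg n) :
    exchange j k x y = if x = y ∘ Equiv.swap j k ∧ y j ≠ y k then 2 else 0 := by
  rw [exchange, site_mul_site hjk, site_mul_site hjk, site₂_add]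
  simp only [site₂, Matrix.of_apply, Matrix.add_apply, Matrix.kroneckerMap_apply]
  have h : x = y ∘ Equiv.swap j k ↔ (∀ l, l ≠ j → l ≠ k → x l = y l) ∧ x j = y k ∧ x k = y j := by
    constructor
    · rintro rfl
      refine ⟨fun l hj hk => ?_, by simp, by simp⟩
      simp [Equiv.swap_apply_of_ne_of_ne hj hk]
    · rintro ⟨h1, h2, h3⟩
      ext l
      by_cases hj : l = j
      · subst hj; simp [h2]
      · by_cases hk : l = k
        · subst hk; simp [h3]
        · simp [Equiv.swap_apply_of_ne_of_ne hj hk, h1 l hj hk]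
  simp only [h]
  by_cases h0 : ∀ l, l ≠ j → l ≠ k → x l = y l
  · rw [if_pos h0]
    simp only [and_iff_right h0]
    generalize x j = a, x k = b, y j = c, y k = d
    fin_cases a <;> fin_cases b <;> fin_cases c <;> fin_cases d <;>
      simp [pauliX, pauliY] <;> norm_num
  · rw [if_neg h0, if_neg]
    rintro ⟨⟨h1, -⟩, -⟩
    exact h0 h1

lemma site_pauliZ (k : Fin (n + 2)) :
    (site k pauliZ : Op n) = Matrix.diagonal fun x => if x k = 0 then 1 else -1 := by
  ext x y
  simp only [site, Matrix.of_apply, Matrix.diagonal_apply]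
  by_cases hxy : x = y
  · subst hxy
    simp only [implies_true, if_true]
    generalize x k = a
    fin_cases a <;> simp [pauliZ]
  · rw [if_neg hxy]
    split_ifs with h
    · have hk : x k ≠ y k := fun hk => hxy (by
        ext l
        by_cases hl : l = k
        · rw [hl, hk]
        · rw [h l hl])
      revert hk
      generalize x k = a, y k = b
      fin_cases a <;> fin_cases b <;> simp [pauliZ]
    · rfl

lemma totalZ_eq : totalZ n = Matrix.diagonal fun x => ∑ k, if x k = 0 then (1 : ℂ) else -1 := by
  ext x y
  simp only [totalZ, site_pauliZ, Matrix.sum_apply, Matrix.diagonal_apply]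
  split_ifs <;> simp

/-- An exchange only connects a configuration with a permuted one, and total Z is symmetric under
permutations of the qubits. -/
lemma commute_exchange_totalZ {j k : Fin (n + 2)} (hjk : j ≠ k) :
    Commute (exchange j k) (totalZ n) := by
  rw [totalZ_eq, Commute, SemiconjBy]
  ext x y
  rw [Matrix.mul_diagonal, Matrix.diagonal_mul, exchange_apply hjk]
  split_ifs with h
  · rw [mul_comm, h.1]
    congr 1
    exact (Equiv.sum_comp (Equiv.swap j k) fun k => if y k = 0 then (1 : ℂ) else -1).symm
  · simp

lemma castSucc_ne_succ (i : Fin (n + 1)) : i.castSucc ≠ i.succ :=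
  (Fin.castSucc_lt_succ).ne

theorem commute_ham₁_totalZ (n : ℕ) : Commute (ham₁ n) (onA (totalZ n)) := by
  unfold ham₁
  refine Commute.smul_left (Commute.sum_left _ _ _ fun i _ => ?_) _
  rw [Commute, SemiconjBy, onA, ← Matrix.mul_kronecker_mul, ← Matrix.mul_kronecker_mul,
    (commute_exchange_totalZ (castSucc_ne_succ i)).eq, mul_one, one_mul]

lemma kronecker_mulVec_tens (A B : Op n) (u v : Reg n) :
    (A ⊗ₖ B).mulVec (tens u v) = tens (A.mulVec u) (B.mulVec v) := by
  ext ⟨x, y⟩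
  simp only [Matrix.mulVec, dotProduct, tens, Matrix.kroneckerMap_apply, Fintype.sum_prod_type,
    Finset.sum_mul_sum]
  refine Finset.sum_congr rfl fun i _ => Finset.sum_congr rfl fun j _ => by ring

lemma onA_mulVec_tens (A : Op n) (u v : Reg n) :
    (onA A).mulVec (tens u v) = tens (A.mulVec u) v := by
  rw [onA, kronecker_mulVec_tens, Matrix.one_mulVec]

lemma tens_smul_left (c : ℂ) (u v : Reg n) : tens (c • u) v = c • tens u v := by
  ext p; simp [tens, mul_assoc]

lemma tens_zero_left (v : Reg n) : tens 0 v = 0 := by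
  ext p; simp [tens]

/-! ### The single-excitation subspace -/

lemma single_comp_swap (j k l : Fin (n + 2)) :
    (Pi.single l 1 : Cfg n) ∘ Equiv.swap j k = Pi.single (Equiv.swap j k l) 1 := by
  ext m
  simp only [Function.comp_apply, Pi.single_apply, Equiv.swap_apply_eq_iff]

lemma exchange_mulVec_ket {j k : Fin (n + 2)} (hjk : j ≠ k) (l : Fin (n + 2)) :
    (exchange j k).mulVec (ket l) =
      (if l = j then (2 : ℂ) else 0) • ket k + (if l = k then (2 : ℂ) else 0) • ket j := by
  ext x
  simp only [ket, Matrix.mulVec_single_one, Matrix.col_apply, exchange_apply hjk, single_comp_swap,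
    Pi.add_apply, Pi.smul_apply, smul_eq_mul]
  by_cases hj : l = j
  · subst hj
    simp [hjk, Pi.single_apply]
  · by_cases hk : l = k
    · subst hk
      simp [hj, Pi.single_apply, hjk]
    · simp [hj, hk, Pi.single_apply, Ne.symm hj, Ne.symm hk]

lemma site_pauliZ_mulVec_ket (j k : Fin (n + 2)) :
    (site j pauliZ).mulVec (ket k) = (if k = j then (-1 : ℂ) else 1) • ket k := by
  rw [site_pauliZ]
  ext x
  simp only [Matrix.mulVec_diagonal, ket, Pi.smul_apply, Pi.single_apply, smul_eq_mul]
  by_cases hx : x = Pi.single k 1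
  · subst hx
    by_cases h : k = j
    · subst h; simp
    · simp [h, Ne.symm h]
  · simp [hx]

lemma arrived_eq :
    arrived n = Matrix.diagonal fun x => if x (Fin.last (n + 1)) = 1 then 1 else 0 := by
  ext x y
  simp only [arrived, site, Matrix.of_apply, Matrix.diagonal_apply]
  by_cases hxy : x = y
  · subst hxy
    simp only [implies_true, if_true]
    generalize x _ = a
    fin_cases a <;> simp
  · rw [if_neg hxy]
    split_ifs with h
    · have hk : x (Fin.last (n + 1)) ≠ y (Fin.last (n + 1)) := fun hk => hxy (by
        ext l
        by_cases hl : l = Fin.last (n + 1)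
        · rw [hl, hk]
        · rw [h l hl])
      revert hk
      generalize x _ = a, y _ = b
      fin_cases a <;> fin_cases b <;> simp
    · rfl

lemma arrived_mulVec_ket (k : Fin (n + 2)) :
    (arrived n).mulVec (ket k) = (if k = Fin.last (n + 1) then (1 : ℂ) else 0) • ket k := by
  rw [arrived_eq]
  ext x
  simp only [Matrix.mulVec_diagonal, ket, Pi.smul_apply, Pi.single_apply, smul_eq_mul]
  by_cases hx : x = Pi.single k 1
  · subst hx
    by_cases h : k = Fin.last (n + 1)
    · subst h; simp
    · simp [h, Ne.symm h]
  · simp [hx]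

/-- The hopping matrix of a path of `n + 2` sites. -/
def hop (n : ℕ) : Matrix (Fin (n + 2)) (Fin (n + 2)) ℂ :=
  Matrix.of fun l k => if (l : ℕ) + 1 = k ∨ (l : ℕ) = k + 1 then 1 else 0

/-- Bond-by-bond form of the adjacency matrix, to be compared with the sum over bonds in `ham₁`. -/
lemma hop_eq_sum (l k : Fin (n + 2)) :
    hop n l k = ∑ i : Fin (n + 1), ((if k = i.castSucc ∧ l = i.succ then 1 else 0) +
      if k = i.succ ∧ l = i.castSucc then 1 else 0) := by
  rw [Finset.sum_add_distrib]
  have h1 : (∑ i : Fin (n + 1), if k = i.castSucc ∧ l = i.succ then (1 : ℂ) else 0) =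
      if (l : ℕ) = k + 1 then 1 else 0 := by
    split_ifs with h
    · rw [Finset.sum_eq_single ⟨k, by omega⟩]
      · rw [if_pos]
        constructor <;> ext <;> simp [h]
      · intro i _ hi
        rw [if_neg]
        rintro ⟨rfl, -⟩
        exact hi (by ext; simp)
      · simp
    · refine Finset.sum_eq_zero fun i _ => if_neg ?_
      rintro ⟨rfl, rfl⟩
      simp at h
  have h2 : (∑ i : Fin (n + 1), if k = i.succ ∧ l = i.castSucc then (1 : ℂ) else 0) =
      if (l : ℕ) + 1 = k then 1 else 0 := by
    split_ifs with h
    · rw [Finset.sum_eq_single ⟨l, by omega⟩]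
      · rw [if_pos]
        constructor <;> ext <;> simp [h]
      · intro i _ hi
        rw [if_neg]
        rintro ⟨-, rfl⟩
        exact hi (by ext; simp)
      · simp
    · refine Finset.sum_eq_zero fun i _ => if_neg ?_
      rintro ⟨rfl, rfl⟩
      simp at h
  rw [h1, h2]
  simp only [hop, Matrix.of_apply]
  by_cases ha : (l : ℕ) + 1 = k
  · have hb : ¬ (l : ℕ) = k + 1 := by omega
    simp [ha, hb]
  · simp [ha]

/-- `ψ` is transported along the chain by the exchanges of neighbouring qubits. -/
def Transported (ψ : Fin (n + 2) → Reg n) : Prop :=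
  ∀ i : Fin (n + 1), ψ i.succ = (swapOp i.castSucc i.succ).mulVec (ψ i.castSucc)

lemma Transported.symm {ψ : Fin (n + 2) → Reg n} (hψ : Transported ψ) (i : Fin (n + 1)) :
    (swapOp i.castSucc i.succ).mulVec (ψ i.succ) = ψ i.castSucc := by
  rw [hψ i, Matrix.mulVec_mulVec, swapOp_mul_self, Matrix.one_mulVec]

/-- The swap on a bond takes ψ at either end to ψ at the other, because it is an involution. So the
`b` register is always the one that belongs to the position of the excitation. -/
lemma ham₁_mulVec_tens {ψ : Fin (n + 2) → Reg n} (hψ : Transported ψ) (k : Fin (n + 2)) :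
    (ham₁ n).mulVec (tens (ket k) (ψ k)) = ∑ l, hop n l k • tens (ket l) (ψ l) := by
  have hterm : ∀ i : Fin (n + 1),
      (exchange i.castSucc i.succ ⊗ₖ swapOp i.castSucc i.succ).mulVec (tens (ket k) (ψ k)) =
        ∑ l, (((if k = i.castSucc ∧ l = i.succ then (2 : ℂ) else 0) +
          if k = i.succ ∧ l = i.castSucc then (2 : ℂ) else 0)) • tens (ket l) (ψ l) := by
    intro i
    rw [kronecker_mulVec_tens, exchange_mulVec_ket (castSucc_ne_succ i)]
    by_cases h1 : k = i.castSucc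
    · subst h1
      simp only [if_true, (castSucc_ne_succ i), if_false, zero_smul, add_zero, true_and, false_and,
        ite_smul, Finset.sum_ite_eq', Finset.mem_univ, ← hψ i, tens_smul_left]
    · by_cases h2 : k = i.succ
      · subst h2
        simp only [if_true, (castSucc_ne_succ i).symm, if_false, zero_smul, zero_add, true_and,
          false_and, ite_smul, Finset.sum_ite_eq', Finset.mem_univ, hψ.symm i, tens_smul_left]
      · simp [h1, h2, tens_zero_left]
  rw [ham₁, Matrix.smul_mulVec, Matrix.sum_mulVec, Finset.sum_congr rfl fun i _ => hterm i,
    Finset.sum_comm, Finset.smul_sum]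
  refine Finset.sum_congr rfl fun l _ => ?_
  rw [← Finset.sum_smul, smul_smul, hop_eq_sum, Finset.mul_sum]
  congr 1
  refine Finset.sum_congr rfl fun i _ => ?_
  split_ifs <;> norm_num

end Register

/-! ### Intertwiners of time evolutions -/

section Intertwine

-- The relation passes to all powers, and multiplication by J is continuous, so it passes to the
-- exponential series. J may be rectangular: it will be the inclusion of the single-excitation
-- subspace.
open scoped Matrix.Norms.Operator in
lemma exp_mul_of_intertwine {ι κ : Type*} [Fintype ι] [DecidableEq ι] [Fintype κ] [DecidableEq κ]
    {H : Matrix ι ι ℂ} {A : Matrix κ κ ℂ} {J : Matrix ι κ ℂ} (h : H * J = J * A) :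
    NormedSpace.exp H * J = J * NormedSpace.exp A := by
  have hpow : ∀ m : ℕ, H ^ m * J = J * A ^ m := by
    intro m
    induction m with
    | zero => simp
    | succ m ih => rw [pow_succ, Matrix.mul_assoc, h, ← Matrix.mul_assoc, ih, Matrix.mul_assoc,
        ← pow_succ]
  have h1 := (NormedSpace.exp_series_hasSum_exp' (𝕂 := ℂ) H).map
    (Matrix.addMonoidHomMulRight J) (continuous_id.matrix_mul continuous_const)
  have h2 := (NormedSpace.exp_series_hasSum_exp' (𝕂 := ℂ) A).map
    (Matrix.addMonoidHomMulLeft J) (continuous_const.matrix_mul continuous_id)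
  refine h1.unique ?_
  convert h2 using 1
  · ext1 m
    simp [Matrix.addMonoidHomMulRight, Matrix.addMonoidHomMulLeft, hpow]
  · rfl

lemma evol_mul_of_intertwine {ι κ : Type} [Fintype ι] [DecidableEq ι] [Fintype κ] [DecidableEq κ]
    {H : Matrix ι ι ℂ} {A : Matrix κ κ ℂ} {J : Matrix ι κ ℂ} (h : H * J = J * A) (t : ℝ) :
    evol H t * J = J * evol A t := by
  apply exp_mul_of_intertwine
  rw [Matrix.smul_mul, h, Matrix.mul_smul]

end Intertwine

section Reduction

variable {n : ℕ}

/-- The matrix with columns `|k⟩`. -/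
def ketMat (n : ℕ) : Matrix (Cfg n) (Fin (n + 2)) ℂ := Matrix.of fun x k => ket k x

/-- The matrix with columns `|k⟩|ψ_k⟩`. -/
def dressMat (ψ : Fin (n + 2) → Reg n) : Matrix (Cfg n × Cfg n) (Fin (n + 2)) ℂ :=
  Matrix.of fun p k => tens (ket k) (ψ k) p

lemma chainVec_eq (α : Fin (n + 2) → ℂ) : chainVec α = (ketMat n).mulVec α := by
  ext x
  simp [chainVec, ketMat, Matrix.mulVec, dotProduct, mul_comm]

lemma dressedVec_eq (ψ : Fin (n + 2) → Reg n) (α : Fin (n + 2) → ℂ) :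
    dressedVec ψ α = (dressMat ψ).mulVec α := by
  ext x
  simp [dressedVec, dressMat, Matrix.mulVec, dotProduct, mul_comm]

lemma mul_dressMat_eq {ψ : Fin (n + 2) → Reg n} {H : Op2 n}
    {A : Matrix (Fin (n + 2)) (Fin (n + 2)) ℂ}
    (h : ∀ k, H.mulVec (tens (ket k) (ψ k)) = ∑ l, A l k • tens (ket l) (ψ l)) :
    H * dressMat ψ = dressMat ψ * A := by
  ext p k
  have := congrFun (h k) p
  simp only [Matrix.mulVec, dotProduct, Finset.sum_apply, Pi.smul_apply, smul_eq_mul] at this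
  simp only [Matrix.mul_apply, dressMat, Matrix.of_apply, this, mul_comm]

lemma mul_ketMat_eq {H : Op n} {A : Matrix (Fin (n + 2)) (Fin (n + 2)) ℂ}
    (h : ∀ k, H.mulVec (ket k) = ∑ l, A l k • ket l) :
    H * ketMat n = ketMat n * A := by
  ext p k
  have := congrFun (h k) p
  simp only [Matrix.mulVec, dotProduct, Finset.sum_apply, Pi.smul_apply, smul_eq_mul] at this
  simp only [Matrix.mul_apply, ketMat, Matrix.of_apply, this, mul_comm]

/-- The action of `Z_j` on the single-excitation subspace. -/
def zSite (j : Fin (n + 2)) : Matrix (Fin (n + 2)) (Fin (n + 2)) ℂ :=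
  Matrix.diagonal fun k => if k = j then -1 else 1

/-- The action of `H_1` with fields on the single-excitation subspace. -/
def hopField (n : ℕ) (f g : ℝ) : Matrix (Fin (n + 2)) (Fin (n + 2)) ℂ :=
  hop n + (f : ℂ) • zSite 0 + (g : ℂ) • zSite (Fin.last (n + 1))

@[simp] lemma hopField_zero : hopField n 0 0 = hop n := by simp [hopField]

lemma sum_diagonal_smul {M : Type*} [AddCommMonoid M] [Module ℂ M] (d : Fin (n + 2) → ℂ)
    (v : Fin (n + 2) → M) (k : Fin (n + 2)) :
    ∑ l, (Matrix.diagonal d : Matrix (Fin (n + 2)) (Fin (n + 2)) ℂ) l k • v l = d k • v k := by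
  rw [Finset.sum_eq_single k]
  · simp
  · intro l _ hl
    simp [Matrix.diagonal_apply_ne _ hl]
  · simp

lemma onA_mul_dressMat (ψ : Fin (n + 2) → Reg n) {A : Op n} {d : Fin (n + 2) → ℂ}
    (h : ∀ k, A.mulVec (ket k) = d k • ket k) :
    onA A * dressMat ψ = dressMat ψ * Matrix.diagonal d :=
  mul_dressMat_eq fun k => by
    rw [onA_mulVec_tens, h, tens_smul_left, sum_diagonal_smul d (fun l => tens (ket l) (ψ l))]

lemma hamField_mul_dressMat {ψ : Fin (n + 2) → Reg n} (hψ : Transported ψ) (f g : ℝ) :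
    hamField n f g * dressMat ψ = dressMat ψ * hopField n f g := by
  rw [hamField, hopField, Matrix.add_mul, Matrix.add_mul, Matrix.mul_add, Matrix.mul_add,
     mul_dressMat_eq (ham₁_mulVec_tens hψ),
    Matrix.smul_mul, Matrix.smul_mul, Matrix.mul_smul, Matrix.mul_smul,
    onA_mul_dressMat ψ (site_pauliZ_mulVec_ket 0), onA_mul_dressMat ψ (site_pauliZ_mulVec_ket _)]
  rfl

lemma swapOp_mulVec_one (j k : Fin (n + 2)) : (swapOp j k : Op n).mulVec 1 = 1 := by
  have h : ∀ x y : Cfg n, x = y ∘ Equiv.swap j k ↔ y = x ∘ Equiv.swap j k := fun x y =>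
    ⟨fun h => by ext l; simp [h], fun h => by ext l; simp [h]⟩
  ext x
  simp [swapOp, Matrix.mulVec, dotProduct, h x]

/-- The all-ones vector of the `b` register is fixed by every swap, so the constant family is
transported and the bare chain is a special case of `ham₁_mulVec_tens`. -/
lemma sum_exchange_mulVec_ket (k : Fin (n + 2)) :
    ((1 / 2 : ℂ) • ∑ i : Fin (n + 1), (exchange i.castSucc i.succ : Op n)).mulVec (ket k) =
      ∑ l, hop n l k • ket l := by
  have h := ham₁_mulVec_tens (n := n) (ψ := fun _ => 1)
    (fun i => (swapOp_mulVec_one i.castSucc i.succ).symm) k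
  have h2 : (ham₁ n).mulVec (tens (ket k) 1) =
      tens (((1 / 2 : ℂ) • ∑ i : Fin (n + 1), (exchange i.castSucc i.succ : Op n)).mulVec (ket k))
        1 := by
    rw [ham₁, Matrix.smul_mulVec, Matrix.sum_mulVec, Matrix.smul_mulVec, Matrix.sum_mulVec]
    simp only [kronecker_mulVec_tens, swapOp_mulVec_one]
    ext p
    simp [tens]
  rw [h2] at h
  ext x
  have := congrFun h (x, x)
  simpa [tens] using this

lemma hamST_add_mul_ketMat (h : ℝ) :
    (hamST n + ((h : ℂ) - 1 / 2) • boundaryZ n) * ketMat n = ketMat n * hopField n h h := by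
  have hZ : ∀ j : Fin (n + 2), site j pauliZ * ketMat n = ketMat n * zSite j := fun j =>
    mul_ketMat_eq fun k => by
      rw [site_pauliZ_mulVec_ket, zSite, sum_diagonal_smul _ (fun l => ket l)]
  have h1 : hamST n + ((h : ℂ) - 1 / 2) • boundaryZ n =
      (1 / 2 : ℂ) • ∑ i : Fin (n + 1), (exchange i.castSucc i.succ : Op n) +
        (h : ℂ) • site 0 pauliZ + (h : ℂ) • site (Fin.last (n + 1)) pauliZ := by
    rw [hamST, boundaryZ]
    module
  rw [h1, hopField, Matrix.add_mul, Matrix.add_mul, Matrix.mul_add, Matrix.mul_add,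
     mul_ketMat_eq sum_exchange_mulVec_ket,
    Matrix.smul_mul, Matrix.smul_mul, Matrix.mul_smul, Matrix.mul_smul, hZ, hZ]

lemma mulVec_dressedVec {ψ : Fin (n + 2) → Reg n} {H : Op2 n}
    {A : Matrix (Fin (n + 2)) (Fin (n + 2)) ℂ} (h : H * dressMat ψ = dressMat ψ * A)
    (α : Fin (n + 2) → ℂ) : H.mulVec (dressedVec ψ α) = dressedVec ψ (A.mulVec α) := by
  rw [dressedVec_eq, dressedVec_eq, Matrix.mulVec_mulVec, h, Matrix.mulVec_mulVec]

lemma mulVec_chainVec {H : Op n} {A : Matrix (Fin (n + 2)) (Fin (n + 2)) ℂ}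
    (h : H * ketMat n = ketMat n * A) (α : Fin (n + 2) → ℂ) :
    H.mulVec (chainVec α) = chainVec (A.mulVec α) := by
  rw [chainVec_eq, chainVec_eq, Matrix.mulVec_mulVec, h, Matrix.mulVec_mulVec]

lemma evol_hamField_mulVec_dressedVec {ψ : Fin (n + 2) → Reg n} (hψ : Transported ψ) (f g t : ℝ)
    (α : Fin (n + 2) → ℂ) :
    (evol (hamField n f g) t).mulVec (dressedVec ψ α) =
      dressedVec ψ ((evol (hopField n f g) t).mulVec α) :=
  mulVec_dressedVec (evol_mul_of_intertwine (hamField_mul_dressMat hψ f g) t) α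

/-- The projection of the single-excitation subspace to the last site. -/
def lastProj (n : ℕ) : Matrix (Fin (n + 2)) (Fin (n + 2)) ℂ :=
  Matrix.diagonal fun k => if k = Fin.last (n + 1) then 1 else 0

lemma onA_arrived_mulVec_dressedVec (ψ : Fin (n + 2) → Reg n) (α : Fin (n + 2) → ℂ) :
    (onA (arrived n)).mulVec (dressedVec ψ α) =
      α (Fin.last (n + 1)) • tens (ket (Fin.last (n + 1))) (ψ (Fin.last (n + 1))) := by
  rw [mulVec_dressedVec (onA_mul_dressMat ψ arrived_mulVec_ket), dressedVec,
    Finset.sum_eq_single (Fin.last (n + 1))]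
  · simp [Matrix.mulVec_diagonal]
  · intro l _ hl
    simp [Matrix.mulVec_diagonal, hl]
  · simp

lemma one_sub_arrived_mulVec_ket (k : Fin (n + 2)) : (1 - arrived n).mulVec (ket k) =
    (1 - if k = Fin.last (n + 1) then (1 : ℂ) else 0) • ket k := by
  rw [Matrix.sub_mulVec, Matrix.one_mulVec, arrived_mulVec_ket, sub_smul, one_smul]

lemma one_sub_lastProj : 1 - lastProj n =
    Matrix.diagonal fun k => 1 - if k = Fin.last (n + 1) then (1 : ℂ) else 0 := by
  rw [lastProj, ← Matrix.diagonal_one, Matrix.diagonal_sub]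

lemma onA_one_sub_arrived_mulVec_dressedVec (ψ : Fin (n + 2) → Reg n) (α : Fin (n + 2) → ℂ) :
    (onA (1 - arrived n)).mulVec (dressedVec ψ α) =
      dressedVec ψ ((1 - lastProj n).mulVec α) := by
  rw [one_sub_lastProj]
  exact mulVec_dressedVec (onA_mul_dressMat ψ one_sub_arrived_mulVec_ket) α

lemma one_sub_arrived_mulVec_chainVec (α : Fin (n + 2) → ℂ) :
    (1 - arrived n).mulVec (chainVec α) = chainVec ((1 - lastProj n).mulVec α) := by
  rw [one_sub_lastProj]
  refine mulVec_chainVec (mul_ketMat_eq fun k => ?_) α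
  rw [one_sub_arrived_mulVec_ket, sum_diagonal_smul _ (fun l => ket l)]

lemma ket_apply_single (k l : Fin (n + 2)) :
    ket k (Pi.single l 1 : Cfg n) = if k = l then 1 else 0 := by
  have : (Pi.single l 1 : Cfg n) = Pi.single k 1 ↔ k = l := by
    constructor
    · intro h
      by_contra hkl
      have := congrFun h l
      simp [Ne.symm hkl] at this
    · rintro rfl; rfl
  simp [ket, Pi.single_apply, this]

lemma chainVec_apply_single (α : Fin (n + 2) → ℂ) (l : Fin (n + 2)) :
    chainVec α (Pi.single l 1) = α l := by
  simp [chainVec, ket_apply_single]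

lemma chainVec_single (s : Fin (n + 2)) : chainVec (Pi.single s 1) = ket s := by
  simp [chainVec, Pi.single_apply]

lemma dressedVec_single (ψ : Fin (n + 2) → Reg n) (s : Fin (n + 2)) :
    dressedVec ψ (Pi.single s 1) = tens (ket s) (ψ s) := by
  simp [dressedVec, Pi.single_apply]

/-- Induction over the waiting times for all α at once: a failed measurement leaves a dressed vector
of the same family ψ, with the last component removed. The amplitudes do not involve ψ. -/
lemma measureRepeat_successOps (h : ℝ) (ts : List ℝ≥0) (α : Fin (n + 2) → ℂ) :
    List.Forall₂ (fun K z => ∀ ψ, Transported ψ → K.mulVec (dressedVec ψ α) =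
        z • tens (ket (Fin.last (n + 1))) (ψ (Fin.last (n + 1))))
      (measureRepeat n h ts).successOps
      (arrivalAmps (hamST n + ((h : ℂ) - 1 / 2) • boundaryZ n) ts (chainVec α)) := by
  induction ts generalizing α with
  | nil => exact List.Forall₂.nil
  | cons t ts ih =>
    have hchain : (evol (hamST n + ((h : ℂ) - 1 / 2) • boundaryZ n) t).mulVec (chainVec α) =
        chainVec ((evol (hopField n h h) t).mulVec α) :=
      mulVec_chainVec (evol_mul_of_intertwine (hamST_add_mul_ketMat h) t) α
    simp only [measureRepeat, Protocol.successOps, arrivalAmps, List.map_map,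
      List.map_cons, List.map_nil, List.singleton_append, hchain]
    refine List.Forall₂.cons ?_ ?_
    · intro ψ hψ
      rw [one_mul, ← Matrix.mulVec_mulVec, evol_hamField_mulVec_dressedVec hψ,
        onA_arrived_mulVec_dressedVec, chainVec_apply_single]
    · rw [one_sub_arrived_mulVec_chainVec, List.forall₂_map_left_iff]
      refine (ih _).imp fun K z hK ψ hψ => ?_
      rw [Function.comp_apply, ← Matrix.mulVec_mulVec, ← Matrix.mulVec_mulVec,
        evol_hamField_mulVec_dressedVec hψ, onA_one_sub_arrived_mulVec_dressedVec, hK ψ hψ]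

end Reduction

/-! ### The products of exchanges along the chain -/

section Cycles

variable {n : ℕ}

/-- Both lists are strictly increasing and have the same members. -/
lemma filter_le_finRange (m : ℕ) (i : Fin m) :
    (List.finRange m).filter (fun j => i ≤ j) =
      i :: (List.finRange m).filter (fun j => i < j) := by
  have hs : (List.finRange m).Pairwise (· < ·) := List.pairwise_lt_finRange m
  refine List.Perm.eq_of_pairwise (le := (· < ·)) ?_ (hs.filter _) ?_ ?_
  · intro a b _ _ h1 h2
    exact absurd h1 h2.asymm
  · refine List.Pairwise.cons ?_ (hs.filter _)
    intro j hj
    simpa using hj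
  · refine (List.perm_ext_iff_of_nodup ((List.nodup_finRange m).filter _) ?_).2 ?_
    · exact List.nodup_cons.2 ⟨by simp, (List.nodup_finRange m).filter _⟩
    · intro j
      simp [le_iff_eq_or_lt, @eq_comm _ j]

lemma swapChain_last : (swapChain (Fin.last (n + 1)) : Op n) = 1 := by
  have h : (List.finRange (n + 1)).filter (fun i => Fin.last (n + 1) ≤ i.castSucc) = [] := by
    simp
  rw [swapChain, h]
  rfl

lemma swapChain_castSucc (i : Fin (n + 1)) :
    (swapChain i.castSucc : Op n) = swapChain i.succ * swapOp i.castSucc i.succ := by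
  have h1 : (List.finRange (n + 1)).filter (fun j => i.castSucc ≤ j.castSucc) =
      i :: (List.finRange (n + 1)).filter (fun j => i.succ ≤ j.castSucc) := by
    simpa [Fin.succ_le_castSucc_iff] using filter_le_finRange (n + 1) i
  rw [swapChain, h1]
  simp [swapChain]

/-- The cyclic permutation of the sites `s, …, N`. -/
def cyc (s : Fin (n + 2)) : Fin (n + 2) → Fin (n + 2) := fun j =>
  if h : s ≤ j ∧ (j : ℕ) + 1 < n + 2 then ⟨j + 1, h.2⟩ else if j = Fin.last (n + 1) then s else j

lemma swapChain_mulVec_single (s : Fin (n + 2)) (x : Cfg n) :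
    (swapChain s).mulVec (Pi.single x 1) = Pi.single (x ∘ cyc s) 1 := by
  induction s using Fin.reverseInduction generalizing x with
  | last =>
    rw [swapChain_last, Matrix.one_mulVec]
    congr 1
    ext j
    simp only [cyc, Function.comp_apply]
    rw [dif_neg]
    · split_ifs with h
      · rw [h]
      · rfl
    · rintro ⟨h1, h2⟩
      rw [Fin.le_def, Fin.val_last] at h1
      omega
  | cast i ih =>
    rw [swapChain_castSucc, ← Matrix.mulVec_mulVec, swapOp_eq_permOp, permOp_mulVec_single, ih,
      Function.comp_assoc]
    congr 2
    ext j
    simp only [cyc, Function.comp_apply, Equiv.swap_apply_def, Fin.le_def, Fin.ext_iff,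
      Fin.val_castSucc, Fin.val_succ, Fin.val_last]
    split_ifs <;> simp_all <;> omega

lemma Transported.last_eq {ψ : Fin (n + 2) → Reg n} (hψ : Transported ψ) (s : Fin (n + 2)) :
    ψ (Fin.last (n + 1)) = (swapChain s).mulVec (ψ s) := by
  induction s using Fin.reverseInduction with
  | last => rw [swapChain_last, Matrix.one_mulVec]
  | cast i ih => rw [swapChain_castSucc, ← Matrix.mulVec_mulVec, ← hψ i, ih]

/-- Swaps are invertible, so a transported family may be prescribed at any one site: with W_k the
product of the swaps up to k, take ψ_k = W_k W_s⁻¹ φ. -/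
lemma exists_transported (s : Fin (n + 2)) (φ : Reg n) :
    ∃ ψ : Fin (n + 2) → Reg n, Transported ψ ∧ ψ s = φ := by
  let W : Fin (n + 2) → (Op n)ˣ := Fin.induction 1 fun i U =>
    ⟨swapOp i.castSucc i.succ, swapOp i.castSucc i.succ, swapOp_mul_self _ _,
      swapOp_mul_self _ _⟩ * U
  have hW : ∀ i : Fin (n + 1), (W i.succ : Op n) = swapOp i.castSucc i.succ * W i.castSucc :=
    fun i => rfl
  refine ⟨fun k => ((W k : Op n) * ((W s)⁻¹ : (Op n)ˣ)).mulVec φ, fun i => ?_, ?_⟩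
  · simp only [hW, Matrix.mulVec_mulVec, Matrix.mul_assoc]
  · simp

theorem measureRepeat_heralds (s : Fin (n + 2)) (h : ℝ) (ts : List ℝ≥0) :
    List.Forall₂ (fun K z => ∀ ψ : Reg n, K.mulVec (tens (ket s) ψ) =
        z • tens (ket (Fin.last (n + 1))) ((swapChain s).mulVec ψ))
      (measureRepeat n h ts).successOps
      (arrivalAmps (hamST n + ((h : ℂ) - 1 / 2) • boundaryZ n) ts (ket s)) := by
  have := measureRepeat_successOps (n := n) h ts (Pi.single s 1)
  rw [chainVec_single] at this
  refine this.imp fun K z hK φ => ?_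
  obtain ⟨ψ, hψ, rfl⟩ := exists_transported s φ
  rw [← hψ.last_eq, ← hK ψ hψ, dressedVec_single]

theorem mapping_to_chain {ψ : Fin (n + 2) → Reg n} (hψ : Transported ψ) (α : Fin (n + 2) → ℂ)
    (h : ℝ) : ∃ β : Fin (n + 2) → ℂ,
      (hamST n + ((h : ℂ) - 1 / 2) • boundaryZ n).mulVec (chainVec α) = chainVec β ∧
        (hamField n h h).mulVec (dressedVec ψ α) = dressedVec ψ β :=
  ⟨_, mulVec_chainVec (hamST_add_mul_ketMat h) α,
    mulVec_dressedVec (hamField_mul_dressMat hψ h h) α⟩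

/-! ### Orbits of the two cycles. -/

lemma cyc_zero_val (j : Fin (n + 2)) : (cyc 0 j : ℕ) = (j + 1) % (n + 2) := by
  have hj := j.isLt
  simp only [cyc, Fin.zero_le, true_and]
  split_ifs with h1 h2
  · rw [Nat.mod_eq_of_lt (by omega)]
  · rw [h2]
    simp
  · exact absurd (Fin.ext (by simp; omega)) h2

lemma cyc_zero_iterate_val (m : ℕ) (j : Fin (n + 2)) :
    ((cyc 0)^[m] j : ℕ) = (j + m) % (n + 2) := by
  induction m with
  | zero => simp [Nat.mod_eq_of_lt j.isLt]
  | succ m ih =>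
    rw [Function.iterate_succ_apply', cyc_zero_val, ih, Nat.mod_add_mod, add_assoc]

lemma cyc_one_iterate_zero (l : ℕ) : (cyc (1 : Fin (n + 2)))^[l] 0 = 0 := by
  induction l with
  | zero => rfl
  | succ l ih =>
    rw [Function.iterate_succ_apply', ih, cyc, dif_neg (by simp), if_neg]
    simp [Fin.ext_iff]

lemma cyc_one_iterate_one {l : ℕ} (hl : l < n + 1) :
    ((cyc (1 : Fin (n + 2)))^[l] 1 : ℕ) = 1 + l := by
  induction l with
  | zero => simp
  | succ l ih =>
    have h := ih (by omega)
    rw [Function.iterate_succ_apply', cyc, dif_pos]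
    · simp only [h]; omega
    · rw [Fin.le_def, h]
      simp
      omega

lemma swapChain_pow_mulVec_single (s : Fin (n + 2)) (m : ℕ) (x : Cfg n) :
    (swapChain s ^ m).mulVec (Pi.single x 1) = Pi.single (x ∘ (cyc s)^[m]) 1 := by
  induction m generalizing x with
  | zero => rw [pow_zero, Matrix.one_mulVec]; rfl
  | succ m ih =>
    rw [pow_succ, ← Matrix.mulVec_mulVec, swapChain_mulVec_single, ih, Function.comp_assoc,
      ← Function.iterate_succ']

/-- Rotating the whole ring i times brings qubit i to the first spin. The second cycle fixes that
spin and rotates the rest until j stands next to it. -/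
theorem exists_cycles_to_front {i j : Fin (n + 2)} (hij : i ≠ j) :
    ∃ m < n + 2, ∃ l < n + 1, ∀ x : Cfg n,
      (swapChain 1 ^ l * swapChain 0 ^ m).mulVec (Pi.single x 1) =
          Pi.single (x ∘ (cyc 0)^[m] ∘ (cyc 1)^[l]) 1 ∧
        ((cyc 0)^[m] ∘ (cyc 1)^[l]) 0 = i ∧ ((cyc 0)^[m] ∘ (cyc 1)^[l]) 1 = j := by
  have hij' : (i : ℕ) ≠ j := fun h => hij (Fin.ext h)
  have hi := i.isLt
  have hj := j.isLt
  -- l is j − i − 1 modulo N; the excluded value N − 1 would mean i = j.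
  obtain ⟨l, hl, hl2⟩ : ∃ l < n + 1, (1 + l + i) % (n + 2) = j := by
    rcases lt_or_gt_of_ne hij' with h | h
    · exact ⟨j - i - 1, by omega, by rw [Nat.mod_eq_of_lt (by omega)]; omega⟩
    · refine ⟨j + n + 1 - i, by omega, ?_⟩
      rw [show 1 + (j + n + 1 - i) + i = (j : ℕ) + (n + 2) by omega, Nat.add_mod_right,
        Nat.mod_eq_of_lt hj]
  refine ⟨i, hi, l, hl, fun x => ⟨?_, ?_, ?_⟩⟩
  · rw [← Matrix.mulVec_mulVec, swapChain_pow_mulVec_single, swapChain_pow_mulVec_single,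
      Function.comp_assoc]
  · ext
    rw [Function.comp_apply, cyc_one_iterate_zero, cyc_zero_iterate_val]
    simp [Nat.mod_eq_of_lt hi]
  · ext
    rw [Function.comp_apply, cyc_zero_iterate_val, cyc_one_iterate_one hl, hl2]

end Cycles

/-! ### Controlled spins -/

section Control

variable {n : ℕ}

lemma submatrix_mem_unitaryGroup {ι κ : Type*} [Fintype ι] [DecidableEq ι] [Fintype κ]
    [DecidableEq κ] {A : Matrix ι ι ℂ} (hA : A ∈ Matrix.unitaryGroup ι ℂ) (e : κ ≃ ι) :
    A.submatrix e e ∈ Matrix.unitaryGroup κ ℂ := by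
  rw [Matrix.mem_unitaryGroup_iff, Matrix.star_eq_conjTranspose] at hA ⊢
  rw [Matrix.conjTranspose_submatrix, Matrix.submatrix_mul_equiv, hA, Matrix.submatrix_one_equiv]

/-- The operator `A ⊗ B` is available as an instantaneous control on one of the sets in `R`. -/
def IsControl (R : Set (Finset (Fin (n + 2)))) (A B : Op n) : Prop :=
  ∃ S ∈ R, ∃ V : Matrix.unitaryGroup ((S → Fin 2) × (S → Fin 2)) ℂ,
    onSpins S (V : Matrix _ _ ℂ) = A ⊗ₖ B

lemma isControl_site {R : Set (Finset (Fin (n + 2)))} {k : Fin (n + 2)} (hk : {k} ∈ R)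
    {A : Matrix (Fin 2) (Fin 2) ℂ} (hA : A ∈ Matrix.unitaryGroup (Fin 2) ℂ) :
    IsControl R (site k A) 1 := by
  let e : ((({k} : Finset (Fin (n + 2))) : Type) → Fin 2) ≃ Fin 2 :=
    ⟨fun f => f ⟨k, by simp⟩, fun a _ => a, fun f => by
      ext ⟨l, hl⟩; simp at hl; subst hl; rfl, fun a => rfl⟩
  refine ⟨{k}, hk, ⟨(A ⊗ₖ (1 : Matrix (Fin 2) (Fin 2) ℂ)).submatrix (e.prodCongr e) (e.prodCongr e),
    submatrix_mem_unitaryGroup (Matrix.kronecker_mem_unitary hA (one_mem _)) _⟩, ?_⟩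
  ext ⟨x, y⟩ ⟨x', y'⟩
  simp only [onSpins, site, Matrix.of_apply, Matrix.kroneckerMap_apply, Finset.mem_singleton,
    Matrix.submatrix_apply, Equiv.prodCongr_apply, Prod.map_apply, Matrix.one_apply, e,
    Equiv.coe_fn_mk]
  by_cases hx : ∀ l, l ≠ k → x l = x' l
  · by_cases hy : ∀ l, l ≠ k → y l = y' l
    · rw [if_pos fun l hl => ⟨hx l hl, hy l hl⟩, if_pos hx]
      have : y k = y' k ↔ y = y' :=
        ⟨fun h => funext fun l => if hl : l = k then hl ▸ h else hy l hl, fun h => h ▸ rfl⟩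
      simp only [this]
    · rw [if_neg fun h => hy fun l hl => (h l hl).2, if_neg (c := y = y'), mul_zero]
      rintro rfl
      exact hy fun _ _ => rfl
  · rw [if_neg fun h => hx fun l hl => (h l hl).1, if_neg hx, zero_mul]

lemma zero_ne_one_fin : (0 : Fin (n + 2)) ≠ 1 := by simp

/-- Used with the swap on both registers to shift the excitation, and with the identity on one
register to act on the other alone. -/
lemma isControl_site₂ {R : Set (Finset (Fin (n + 2)))} (hR : {0, 1} ∈ R)
    {A B : Matrix (Fin 2 × Fin 2) (Fin 2 × Fin 2) ℂ}
    (hA : A ∈ Matrix.unitaryGroup (Fin 2 × Fin 2) ℂ)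
    (hB : B ∈ Matrix.unitaryGroup (Fin 2 × Fin 2) ℂ) :
    IsControl R (site₂ 0 1 A) (site₂ 0 1 B) := by
  let e : ((({0, 1} : Finset (Fin (n + 2))) : Type) → Fin 2) ≃ Fin 2 × Fin 2 :=
    ⟨fun f => (f ⟨0, by simp⟩, f ⟨1, by simp⟩), fun p l => if (l : Fin (n + 2)) = 0 then p.1 else p.2,
      fun f => by
        ext ⟨l, hl⟩
        simp only [Finset.mem_insert, Finset.mem_singleton] at hl
        rcases hl with rfl | rfl <;> simp, fun p => by simp⟩
  refine ⟨{0, 1}, hR, ⟨(A ⊗ₖ B).submatrix (e.prodCongr e) (e.prodCongr e),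
    submatrix_mem_unitaryGroup (Matrix.kronecker_mem_unitary hA hB) _⟩, ?_⟩
  ext ⟨x, y⟩ ⟨x', y'⟩
  simp only [onSpins, site₂, Matrix.of_apply, Matrix.kroneckerMap_apply, Finset.mem_insert,
    Finset.mem_singleton, Matrix.submatrix_apply, Equiv.prodCongr_apply, Prod.map_apply, e,
    Equiv.coe_fn_mk, not_or, and_imp]
  by_cases hx : ∀ l, l ≠ 0 → l ≠ 1 → x l = x' l
  · by_cases hy : ∀ l, l ≠ 0 → l ≠ 1 → y l = y' l
    · rw [if_pos fun l h0 h1 => ⟨hx l h0 h1, hy l h0 h1⟩, if_pos hx, if_pos hy]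
    · rw [if_neg fun h => hy fun l h0 h1 => (h l h0 h1).2, if_neg hy, mul_zero]
  · rw [if_neg fun h => hx fun l h0 h1 => (h l h0 h1).1, if_neg hx, zero_mul]

lemma site₂_kronecker_one {j k : Fin (n + 2)} (hjk : j ≠ k) (A : Matrix (Fin 2) (Fin 2) ℂ) :
    (site₂ j k (A ⊗ₖ 1) : Op n) = site j A := by
  ext x y
  simp only [site₂, site, Matrix.of_apply, Matrix.kroneckerMap_apply, Matrix.one_apply]
  by_cases h : ∀ l, l ≠ j → x l = y l
  · rw [if_pos h, if_pos fun l hl _ => h l hl, if_pos (h k hjk.symm), mul_one]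
  · rw [if_neg h]
    split_ifs with h1 h2
    · exact absurd (fun l hl => if hk : l = k then hk ▸ h2 else h1 l hl hk) h
    · simp
    · rfl

lemma site₂_one_kronecker {j k : Fin (n + 2)} (hjk : j ≠ k) (A : Matrix (Fin 2) (Fin 2) ℂ) :
    (site₂ j k (1 ⊗ₖ A) : Op n) = site k A := by
  ext x y
  simp only [site₂, site, Matrix.of_apply, Matrix.kroneckerMap_apply, Matrix.one_apply]
  by_cases h : ∀ l, l ≠ k → x l = y l
  · rw [if_pos h, if_pos fun l _ hl => h l hl, if_pos (h j hjk), one_mul]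
  · rw [if_neg h]
    split_ifs with h1 h2
    · exact absurd (fun l hl => if hk : l = j then hk ▸ h2 else h1 l hk hl) h
    · simp
    · rfl

lemma site₂_one (j k : Fin (n + 2)) : (site₂ j k 1 : Op n) = 1 := by
  ext x y
  simp only [site₂, Matrix.of_apply, Matrix.one_apply, Prod.mk.injEq]
  by_cases h : x = y
  · subst h; simp
  · rw [if_neg h]
    split_ifs with h1 h2
    · refine absurd (funext fun l => ?_) h
      by_cases hj : l = j
      · exact hj ▸ h2.1
      · by_cases hk : l = k
        · exact hk ▸ h2.2
        · exact h1 l hj hk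
    · rfl
    · rfl

/-- The exchange of two qubits. -/
def swapMat : Matrix (Fin 2 × Fin 2) (Fin 2 × Fin 2) ℂ :=
  (1 : Matrix (Fin 2 × Fin 2) (Fin 2 × Fin 2) ℂ).submatrix id Prod.swap

lemma swapMat_mem : swapMat ∈ Matrix.unitaryGroup (Fin 2 × Fin 2) ℂ := by
  rw [Matrix.mem_unitaryGroup_iff, Matrix.star_eq_conjTranspose, swapMat,
    Matrix.conjTranspose_submatrix, Matrix.conjTranspose_one]
  exact (Matrix.submatrix_mul_equiv _ _ id (Equiv.prodComm (Fin 2) (Fin 2)) id).trans (by simp)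

lemma site₂_swapMat {j k : Fin (n + 2)} : (site₂ j k swapMat : Op n) = swapOp j k := by
  ext x y
  simp only [site₂, swapOp, swapMat, Matrix.of_apply, Matrix.submatrix_apply, Matrix.one_apply, id,
    Prod.swap, Prod.mk.injEq]
  have h : x = y ∘ Equiv.swap j k ↔ (∀ l, l ≠ j → l ≠ k → x l = y l) ∧ x j = y k ∧ x k = y j := by
    constructor
    · rintro rfl
      refine ⟨fun l hj hk => ?_, by simp, by simp⟩
      simp [Equiv.swap_apply_of_ne_of_ne hj hk]
    · rintro ⟨h1, h2, h3⟩
      ext l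
      by_cases hj : l = j
      · subst hj; simp [h2]
      · by_cases hk : l = k
        · subst hk; simp [h3]
        · simp [Equiv.swap_apply_of_ne_of_ne hj hk, h1 l hj hk]
  simp only [h]
  split_ifs <;> tauto

/-- The flip of a qubit is unitary. -/
lemma pauliX_mem : pauliX ∈ Matrix.unitaryGroup (Fin 2) ℂ := by
  rw [Matrix.mem_unitaryGroup_iff, Matrix.star_eq_conjTranspose]
  ext i j
  fin_cases i <;> fin_cases j <;> simp [pauliX, Matrix.mul_apply]

lemma singleton_zero_mem : ({0} : Finset (Fin (n + 2))) ∈ endControl n := by simp [endControl]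

lemma singleton_last_mem_end : ({Fin.last (n + 1)} : Finset (Fin (n + 2))) ∈ endControl n := by
  simp [endControl]

lemma singleton_last_mem_full : ({Fin.last (n + 1)} : Finset (Fin (n + 2))) ∈ fullControl n := by
  simp [fullControl]

lemma pair_mem : ({0, 1} : Finset (Fin (n + 2))) ∈ fullControl n := by simp [fullControl]

lemma isControl_site_zero_full {A : Matrix (Fin 2) (Fin 2) ℂ}
    (hA : A ∈ Matrix.unitaryGroup (Fin 2) ℂ) : IsControl (fullControl n) (site 0 A) 1 := by
  rw [← site₂_kronecker_one zero_ne_one_fin, ← site₂_one 0 1]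
  exact isControl_site₂ pair_mem (Matrix.kronecker_mem_unitary hA (one_mem _)) (one_mem _)

lemma isControl_site_one_full {A : Matrix (Fin 2) (Fin 2) ℂ}
    (hA : A ∈ Matrix.unitaryGroup (Fin 2) ℂ) : IsControl (fullControl n) (site 1 A) 1 := by
  rw [← site₂_one_kronecker zero_ne_one_fin, ← site₂_one 0 1]
  exact isControl_site₂ pair_mem (Matrix.kronecker_mem_unitary (one_mem _) hA) (one_mem _)

end Control

/-! ### Composition of protocols -/

section Compose

variable {n : ℕ} {R : Set (Finset (Fin (n + 2)))}

/-- Run `P` and, if it announces success, go on with `Q`. -/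
def Protocol.seq (P Q : Protocol n R) : Protocol n R :=
  match P with
  | .halt true => Q
  | .halt false => .halt false
  | .evolve t f g p => .evolve t f g (p.seq Q)
  | .control S hS V p => .control S hS V (p.seq Q)
  | .measure p q => .measure (p.seq Q) (q.seq Q)

lemma Protocol.duration_nonneg (P : Protocol n R) : 0 ≤ P.duration := by
  induction P with
  | halt b => exact le_rfl
  | evolve t f g p ih => exact add_nonneg t.2 ih
  | control S hS V p ih => exact ih
  | measure p q ihp ihq => exact le_max_of_le_left ihp

lemma Protocol.duration_seq_le (P Q : Protocol n R) :
    (P.seq Q).duration ≤ P.duration + Q.duration := by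
  induction P with
  | halt b =>
    cases b
    · simpa [seq, duration] using Q.duration_nonneg
    · simp [seq, duration]
  | evolve t f g p ih =>
    simp only [seq, duration]
    linarith
  | control S hS V p ih => exact ih
  | measure p q ihp ihq =>
    simp only [seq, duration]
    refine max_le (ihp.trans ?_) (ihq.trans ?_) <;> gcongr <;> simp

lemma Protocol.successOps_seq (P Q : Protocol n R) :
    (P.seq Q).successOps = P.successOps.flatMap fun K => Q.successOps.map fun L => L * K := by
  induction P with
  | halt b => cases b <;> simp [seq, successOps]
  | evolve t f g p ih =>
    simp [seq, successOps, ih, List.map_flatMap, List.flatMap_map, Matrix.mul_assoc,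
      Function.comp_def]
  | control S hS V p ih =>
    simp [seq, successOps, ih, List.map_flatMap, List.flatMap_map, Matrix.mul_assoc,
      Function.comp_def]
  | measure p q ihp ihq =>
    simp [seq, successOps, ihp, ihq, List.map_flatMap, List.flatMap_map, Matrix.mul_assoc,
      Function.comp_def]

lemma sum_flatMap_norm_sq (c d : List ℂ) :
    ((c.flatMap fun z => d.map fun w => w * z).map fun z => ‖z‖ ^ 2).sum =
      (c.map fun z => ‖z‖ ^ 2).sum * (d.map fun z => ‖z‖ ^ 2).sum := by
  induction c with
  | nil => simp
  | cons z c ih =>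
    simp only [List.flatMap_cons, List.map_append, List.sum_append, ih, List.map_cons,
      List.sum_cons, List.map_map, Function.comp_def, norm_mul, mul_pow, List.sum_map_mul_right]
    ring

/-- The successful branches of the composite are pairs of successful branches, with the product
amplitude, so the total probabilities multiply. -/
lemma Protocol.Heralds.seq {P Q : Protocol n R} {u v w : Reg n} {W W' : Op n} {p p' : ℝ}
    (hP : P.Heralds u v W p) (hQ : Q.Heralds v w W' p') (hp : 0 ≤ p) (hp' : 0 ≤ p') :
    (P.seq Q).Heralds u w (W' * W) (p * p') := by
  obtain ⟨c, hc, hcp⟩ := hP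
  obtain ⟨d, hd, hdp⟩ := hQ
  refine ⟨c.flatMap fun z => d.map fun w => w * z, ?_, ?_⟩
  · rw [Protocol.successOps_seq]
    refine List.rel_flatMap hc fun K z hK => ?_
    rw [List.forall₂_map_left_iff, List.forall₂_map_right_iff]
    refine hd.imp fun L y hL ψ => ?_
    rw [← Matrix.mulVec_mulVec, hK ψ, Matrix.mulVec_smul, hL, smul_smul, mul_comm,
      Matrix.mulVec_mulVec]
  · rw [sum_flatMap_norm_sq]
    exact mul_lt_mul'' hcp hdp hp hp'

lemma Protocol.Heralds.mono {P : Protocol n R} {u v : Reg n} {W : Op n} {p p' : ℝ}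
    (hP : P.Heralds u v W p) (h : p' ≤ p) : P.Heralds u v W p' := by
  obtain ⟨c, hc, hcp⟩ := hP
  exact ⟨c, hc, h.trans_lt hcp⟩

lemma heralds_halt (u : Reg n) {p : ℝ} (hp : p < 1) :
    (Protocol.halt true : Protocol n R).Heralds u u 1 p :=
  ⟨[1], by simp [Protocol.successOps], by simpa using hp⟩

/-- A protocol may be preceded by a control. -/
lemma IsControl.exists_heralds {A B : Op n} (h : IsControl R A B) {P : Protocol n R}
    {u v : Reg n} {W : Op n} {p : ℝ} (hP : P.Heralds (A.mulVec u) v W p) :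
    ∃ Q : Protocol n R, Q.duration = P.duration ∧ Q.Heralds u v (W * B) p := by
  obtain ⟨S, hS, V, hV⟩ := h
  obtain ⟨c, hc, hcp⟩ := hP
  refine ⟨.control S hS V P, rfl, c, ?_, hcp⟩
  rw [Protocol.successOps, List.forall₂_map_left_iff]
  refine hc.imp fun K z hK ψ => ?_
  rw [← Matrix.mulVec_mulVec, hV, kronecker_mulVec_tens, hK, Matrix.mulVec_mulVec]

lemma pauliX_site_mulVec_vac (k : Fin (n + 2)) : (site k pauliX).mulVec (vac n) = ket k := by
  ext x
  simp only [vac, ket, Matrix.mulVec_single_one, Matrix.col_apply, site, Matrix.of_apply,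
    Pi.single_apply, Pi.zero_apply]
  by_cases hx : x = Pi.single k 1
  · subst hx
    rw [if_pos (fun l hl => by simp [hl]), if_pos rfl]
    simp [pauliX]
  · rw [if_neg hx]
    split_ifs with h
    · have hk : x k ≠ 1 := fun hk => hx (by
        ext l
        by_cases hl : l = k
        · subst hl; simp [hk]
        · simp [hl, h l hl])
      revert hk
      generalize x k = a
      fin_cases a <;> simp [pauliX]
    · rfl

lemma pauliX_site_mulVec_ket (k : Fin (n + 2)) : (site k pauliX).mulVec (ket k) = vac n := by
  ext x
  simp only [vac, ket, Matrix.mulVec_single_one, Matrix.col_apply, site, Matrix.of_apply,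
    Pi.single_apply]
  by_cases hx : x = 0
  · subst hx
    rw [if_pos (fun l hl => by simp [hl]), if_pos rfl]
    simp [pauliX]
  · rw [if_neg hx]
    split_ifs with h
    · have hk : x k ≠ 0 := fun hk => hx (by
        ext l
        by_cases hl : l = k
        · subst hl; simp [hk]
        · simpa [hl] using h l hl)
      revert hk
      generalize x k = a
      fin_cases a <;> simp [pauliX]
    · simp_all

lemma swapOp_mulVec_ket (j k l : Fin (n + 2)) :
    (swapOp j k).mulVec (ket l) = ket (Equiv.swap j k l) := by
  rw [swapOp_eq_permOp, ket, permOp_mulVec_single, single_comp_swap, ket]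

end Compose

/-! ### Protocols in the single-excitation subspace -/

section Steps

variable {n : ℕ}

/-- The Euclidean norm of a vector. -/
def nrm {ι : Type*} [Fintype ι] (v : ι → ℂ) : ℝ := ‖(WithLp.toLp 2 v : EuclideanSpace ℂ ι)‖

/-! ### The Euclidean norm of amplitude vectors. -/

section Nrm

variable {ι : Type*} [Fintype ι]

lemma nrm_nonneg (v : ι → ℂ) : 0 ≤ nrm v := norm_nonneg _

lemma nrm_sq (v : ι → ℂ) : nrm v ^ 2 = ∑ i, ‖v i‖ ^ 2 := by
  rw [nrm, EuclideanSpace.norm_sq_eq]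

lemma nrm_add_le (v w : ι → ℂ) : nrm (v + w) ≤ nrm v + nrm w := by
  rw [nrm, WithLp.toLp_add]; exact norm_add_le _ _

lemma nrm_sub_le (v w : ι → ℂ) : nrm (v - w) ≤ nrm v + nrm w := by
  rw [nrm, WithLp.toLp_sub]; exact norm_sub_le _ _

lemma nrm_smul (c : ℂ) (v : ι → ℂ) : nrm (c • v) = ‖c‖ * nrm v := by
  rw [nrm, WithLp.toLp_smul]; exact norm_smul _ _

lemma nrm_zero : nrm (0 : ι → ℂ) = 0 := by rw [nrm, WithLp.toLp_zero, norm_zero]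

lemma norm_apply_le_nrm (v : ι → ℂ) (i : ι) : ‖v i‖ ≤ nrm v :=
  PiLp.norm_apply_le (WithLp.toLp 2 v : EuclideanSpace ℂ ι) i

lemma nrm_single [DecidableEq ι] (i : ι) (c : ℂ) : nrm (Pi.single i c) = ‖c‖ := by
  refine (sq_eq_sq₀ (nrm_nonneg _) (norm_nonneg _)).1 ?_
  rw [nrm_sq, Finset.sum_eq_single i]
  · simp
  · intro j _ hj
    simp [hj]
  · simp

lemma nrm_mulVec_of_unitary [DecidableEq ι] {U : Matrix ι ι ℂ} (hU : star U * U = 1) (v : ι → ℂ) :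
    nrm (U.mulVec v) = nrm v := by
  have h : ∀ w : ι → ℂ, ((nrm w ^ 2 : ℝ) : ℂ) = dotProduct (star w) w := by
    intro w
    rw [nrm_sq, dotProduct, Complex.ofReal_sum]
    refine Finset.sum_congr rfl fun i _ => ?_
    rw [Pi.star_apply, Complex.star_def, Complex.conj_mul', Complex.ofReal_pow]
  have h2 : (nrm (U.mulVec v)) ^ 2 = nrm v ^ 2 := by
    have : ((nrm (U.mulVec v) ^ 2 : ℝ) : ℂ) = ((nrm v ^ 2 : ℝ) : ℂ) := by
      rw [h, h, Matrix.star_mulVec, Matrix.dotProduct_mulVec, Matrix.vecMul_vecMul,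
        ← Matrix.star_eq_conjTranspose, hU, Matrix.vecMul_one]
    exact_mod_cast this
  exact (sq_eq_sq₀ (nrm_nonneg _) (nrm_nonneg _)).1 h2

end Nrm

lemma star_evol_mul_evol {ι : Type} [Fintype ι] [DecidableEq ι] {H : Matrix ι ι ℂ}
    (hH : H.IsHermitian) (t : ℝ) : star (evol H t) * evol H t = 1 := by
  have h : star ((-(t : ℂ) * Complex.I) • H) = -((-(t : ℂ) * Complex.I) • H) := by
    rw [star_smul, Matrix.star_eq_conjTranspose, hH.eq, ← neg_smul]
    congr 1
    simp
  rw [evol, Matrix.star_eq_conjTranspose, ← Matrix.exp_conjTranspose, ← Matrix.star_eq_conjTranspose,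
    h, Matrix.exp_neg]
  exact Matrix.nonsing_inv_mul _ ((Matrix.isUnit_iff_isUnit_det _).1 (Matrix.isUnit_exp _))

lemma hop_isHermitian : (hop n).IsHermitian := by
  ext i j
  simp only [hop, Matrix.conjTranspose_apply, Matrix.of_apply]
  have : ((j : ℕ) + 1 = i ∨ (j : ℕ) = i + 1) ↔ ((i : ℕ) + 1 = j ∨ (i : ℕ) = j + 1) := by omega
  simp only [this]
  split_ifs <;> simp

/-- The elementary operations on an excitation: waiting, phases on the first and on the last site,
and a measurement of the last site which does not find the excitation. -/
inductive Step : Type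
  | evolve (t : ℝ≥0) : Step
  | phaseFirst (θ : ℝ) : Step
  | phaseLast (θ : ℝ) : Step
  | measure : Step

/-- The phase `exp (iθ)` on the site `k`. -/
def phaseMat (k : Fin (n + 2)) (θ : ℝ) : Matrix (Fin (n + 2)) (Fin (n + 2)) ℂ :=
  Matrix.diagonal fun l => if l = k then Complex.exp (θ * Complex.I) else 1

/-- The operator of an elementary operation. -/
def Step.mat (n : ℕ) : Step → Matrix (Fin (n + 2)) (Fin (n + 2)) ℂ
  | .evolve t => evol (hop n) t
  | .phaseFirst θ => phaseMat 0 θ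
  | .phaseLast θ => phaseMat (Fin.last (n + 1)) θ
  | .measure => 1 - lastProj n

/-- The duration of an elementary operation. -/
def Step.time : Step → ℝ
  | .evolve t => t
  | _ => 0

/-- The operator of a sequence of elementary operations (the head acts first). -/
def run (n : ℕ) : List Step → Matrix (Fin (n + 2)) (Fin (n + 2)) ℂ
  | [] => 1
  | s :: l => run n l * s.mat n

/-- The duration of a sequence of elementary operations. -/
def time (l : List Step) : ℝ := (l.map Step.time).sum

lemma run_append (l m : List Step) : run n (l ++ m) = run n m * run n l := by
  induction l with
  | nil => simp [run]
  | cons s l ih => simp [run, ih, Matrix.mul_assoc]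

lemma time_append (l m : List Step) : time (l ++ m) = time l + time m := by
  simp [time]

lemma star_phaseMat_mul (k : Fin (n + 2)) (θ : ℝ) : star (phaseMat k θ) * phaseMat k θ = 1 := by
  rw [phaseMat, Matrix.star_eq_conjTranspose, Matrix.diagonal_conjTranspose,
    Matrix.diagonal_mul_diagonal, ← Matrix.diagonal_one]
  congr 1
  ext l
  simp only [Pi.star_apply]
  split_ifs
  · rw [Complex.star_def, Complex.conj_mul', Complex.norm_exp_ofReal_mul_I]
    simp
  · simp

/-- Pythagoras: what the negative outcome loses is the probability of detection. -/
lemma nrm_measure (α : Fin (n + 2) → ℂ) :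
    nrm ((1 - lastProj n).mulVec α) ^ 2 + ‖α (Fin.last (n + 1))‖ ^ 2 = nrm α ^ 2 := by
  rw [nrm_sq, nrm_sq, one_sub_lastProj, Fin.sum_univ_castSucc,
    Fin.sum_univ_castSucc fun i => ‖α i‖ ^ 2]
  simp [Matrix.mulVec_diagonal, (Fin.castSucc_lt_last _).ne]

lemma nrm_mat_mulVec_le (s : Step) (α : Fin (n + 2) → ℂ) : nrm ((s.mat n).mulVec α) ≤ nrm α := by
  cases s with
  | evolve t => exact (nrm_mulVec_of_unitary (star_evol_mul_evol hop_isHermitian _) _).le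
  | phaseFirst θ => exact (nrm_mulVec_of_unitary (star_phaseMat_mul _ _) _).le
  | phaseLast θ => exact (nrm_mulVec_of_unitary (star_phaseMat_mul _ _) _).le
  | measure =>
    refine (pow_le_pow_iff_left₀ (nrm_nonneg _) (nrm_nonneg _) two_ne_zero).1 ?_
    have := nrm_measure α
    simp only [Step.mat]
    nlinarith [sq_nonneg ‖α (Fin.last (n + 1))‖]

lemma nrm_run_mulVec_le (l : List Step) (α : Fin (n + 2) → ℂ) :
    nrm ((run n l).mulVec α) ≤ nrm α := by
  induction l generalizing α with
  | nil => simp [run]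
  | cons s l ih =>
    rw [run, ← Matrix.mulVec_mulVec]
    exact (ih _).trans (nrm_mat_mulVec_le s α)

/-- The phase gate. -/
def phaseGate (θ : ℝ) : Matrix (Fin 2) (Fin 2) ℂ :=
  Matrix.diagonal fun a => if a = 1 then Complex.exp (θ * Complex.I) else 1

lemma phaseGate_mem (θ : ℝ) : phaseGate θ ∈ Matrix.unitaryGroup (Fin 2) ℂ := by
  rw [Matrix.mem_unitaryGroup_iff', phaseGate, Matrix.star_eq_conjTranspose,
    Matrix.diagonal_conjTranspose, Matrix.diagonal_mul_diagonal, ← Matrix.diagonal_one]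
  congr 1
  ext l
  simp only [Pi.star_apply]
  split_ifs
  · rw [Complex.star_def, Complex.conj_mul', Complex.norm_exp_ofReal_mul_I]
    simp
  · simp

lemma site_phaseGate_mulVec_ket (k l : Fin (n + 2)) (θ : ℝ) :
    (site k (phaseGate θ)).mulVec (ket l) =
      (if l = k then Complex.exp (θ * Complex.I) else 1) • ket l := by
  ext x
  simp only [ket, Matrix.mulVec_single_one, Matrix.col_apply, site, Matrix.of_apply, Pi.smul_apply,
    smul_eq_mul, phaseGate, Matrix.diagonal_apply]
  rw [Pi.single_apply (Pi.single l 1 : Cfg n) (1 : ℂ) x]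
  by_cases hx : x = Pi.single l 1
  · subst hx
    by_cases h : l = k
    · subst h; simp
    · simp [h, Ne.symm h]
  · rw [if_neg hx, mul_zero]
    split_ifs with h1 h2 h3
    · exact absurd (funext fun m => if hm : m = k then hm ▸ h2 else h1 m hm) hx
    · exact absurd (funext fun m => if hm : m = k then hm ▸ h2 else h1 m hm) hx
    · rfl
    · rfl

/-- Controls that give the phases on the first and the last site. -/
def HasPhases (R : Set (Finset (Fin (n + 2)))) : Prop :=
  ∀ θ, IsControl R (site 0 (phaseGate θ)) 1 ∧ IsControl R (site (Fin.last (n + 1)) (phaseGate θ)) 1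

lemma hasPhases_endControl : HasPhases (endControl n) := fun θ =>
  ⟨isControl_site singleton_zero_mem (phaseGate_mem θ),
    isControl_site singleton_last_mem_end (phaseGate_mem θ)⟩

lemma hasPhases_fullControl : HasPhases (fullControl n) := fun θ =>
  ⟨isControl_site_zero_full (phaseGate_mem θ),
    isControl_site singleton_last_mem_full (phaseGate_mem θ)⟩

/-- A success operator `K` takes the dressed vector `α` to the last site with amplitude `z`. -/
def Arrives (α : Fin (n + 2) → ℂ) (K : Op2 n) (z : ℂ) : Prop :=
  ∀ ψ, Transported ψ → K.mulVec (dressedVec ψ α) =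
    z • tens (ket (Fin.last (n + 1))) (ψ (Fin.last (n + 1)))

lemma exists_protocol_phase {R : Set (Finset (Fin (n + 2)))} {k : Fin (n + 2)} {θ : ℝ}
    (h : IsControl R (site k (phaseGate θ)) 1) (P : Protocol n R) :
    ∃ Q : Protocol n R, Q.duration = P.duration ∧ ∀ α c,
      List.Forall₂ (Arrives ((phaseMat k θ).mulVec α)) P.successOps c →
        List.Forall₂ (Arrives α) Q.successOps c := by
  obtain ⟨S, hS, V, hV⟩ := h
  refine ⟨.control S hS V P, rfl, fun α c hc => ?_⟩
  rw [Protocol.successOps, List.forall₂_map_left_iff]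
  refine hc.imp fun K z hK ψ hψ => ?_
  rw [← Matrix.mulVec_mulVec, hV, ← onA,
    mulVec_dressedVec (onA_mul_dressMat ψ fun l => site_phaseGate_mulVec_ket k l θ)]
  exact hK ψ hψ

/-- Elementary operations are implemented by protocols which succeed when the excitation is found
on the last spin. -/
lemma exists_protocol_steps {R : Set (Finset (Fin (n + 2)))} (hR : HasPhases R) (l : List Step) :
    ∃ P : Protocol n R, P.duration = time l ∧ ∀ α : Fin (n + 2) → ℂ, ∃ c : List ℂ,
      List.Forall₂ (Arrives α) P.successOps c ∧
        (c.map fun z => ‖z‖ ^ 2).sum + nrm ((run n l).mulVec α) ^ 2 = nrm α ^ 2 := by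
  induction l with
  -- When the operations are used up without a detection, failure is announced; all the norm is then
  -- in the remainder.
  | nil => exact ⟨.halt false, rfl, fun α => ⟨[], .nil, by simp [run]⟩⟩
  | cons s l ih =>
    obtain ⟨P, hP, h⟩ := ih
    cases s with
    | evolve t =>
      refine ⟨.evolve t 0 0 P, by simp [Protocol.duration, hP, time, Step.time], fun α => ?_⟩
      obtain ⟨c, hc, hs⟩ := h ((Step.mat n (.evolve t)).mulVec α)
      refine ⟨c, ?_, ?_⟩
      · rw [Protocol.successOps, List.forall₂_map_left_iff]
        refine hc.imp fun K z hK ψ hψ => ?_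
        rw [← Matrix.mulVec_mulVec, evol_hamField_mulVec_dressedVec hψ, hopField_zero]
        exact hK ψ hψ
      · rw [run, ← Matrix.mulVec_mulVec, hs]
        simp only [Step.mat]
        rw [nrm_mulVec_of_unitary (star_evol_mul_evol hop_isHermitian _)]
    | phaseFirst θ =>
      obtain ⟨Q, hQ, hQ'⟩ := exists_protocol_phase (hR θ).1 P
      refine ⟨Q, by simp [hQ, hP, time, Step.time], fun α => ?_⟩
      obtain ⟨c, hc, hs⟩ := h ((Step.mat n (.phaseFirst θ)).mulVec α)
      refine ⟨c, hQ' α c hc, ?_⟩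
      rw [run, ← Matrix.mulVec_mulVec, hs]
      simp only [Step.mat]
      rw [nrm_mulVec_of_unitary (star_phaseMat_mul _ _)]
    | phaseLast θ =>
      obtain ⟨Q, hQ, hQ'⟩ := exists_protocol_phase (hR θ).2 P
      refine ⟨Q, by simp [hQ, hP, time, Step.time], fun α => ?_⟩
      obtain ⟨c, hc, hs⟩ := h ((Step.mat n (.phaseLast θ)).mulVec α)
      refine ⟨c, hQ' α c hc, ?_⟩
      rw [run, ← Matrix.mulVec_mulVec, hs]
      simp only [Step.mat]
      rw [nrm_mulVec_of_unitary (star_phaseMat_mul _ _)]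
    | measure =>
      refine ⟨.measure (.halt true) P, ?_, fun α => ?_⟩
      · simp [Protocol.duration, hP, time, Step.time]
        rw [← time, ← hP]
        exact P.duration_nonneg
      obtain ⟨c, hc, hs⟩ := h ((Step.mat n .measure).mulVec α)
      -- One new branch: detection at this measurement, with the present amplitude of the last site.
      refine ⟨α (Fin.last (n + 1)) :: c, ?_, ?_⟩
      · simp only [Protocol.successOps, List.map_cons, List.map_nil, List.singleton_append]
        refine List.Forall₂.cons ?_ ?_
        · intro ψ _
          rw [one_mul, onA_arrived_mulVec_dressedVec]
        · rw [List.forall₂_map_left_iff]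
          refine hc.imp fun K z hK ψ hψ => ?_
          rw [← Matrix.mulVec_mulVec, onA_one_sub_arrived_mulVec_dressedVec]
          exact hK ψ hψ
      · rw [run, ← Matrix.mulVec_mulVec, List.map_cons, List.sum_cons, add_assoc, hs, ← nrm_measure α]
        simp only [Step.mat]
        ring

/-- Norm is shared between the successful branches and the remainder, so a bound on the remaining
vector bounds the failure probability. From here on only vectors of the hopping model matter. -/
lemma exists_heralds_of_steps {R : Set (Finset (Fin (n + 2)))} (hR : HasPhases R) (l : List Step)
    {p : ℝ} (hp : nrm ((run n l).mulVec (Pi.single 0 1)) ^ 2 < 1 - p) :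
    ∃ P : Protocol n R, P.duration = time l ∧
      P.Heralds (ket 0) (ket (Fin.last (n + 1))) (swapChain 0) p := by
  obtain ⟨P, hP, h⟩ := exists_protocol_steps hR l
  obtain ⟨c, hc, hs⟩ := h (Pi.single 0 1)
  refine ⟨P, hP, c, hc.imp fun K z hK φ => ?_, ?_⟩
  · obtain ⟨ψ, hψ, rfl⟩ := exists_transported 0 φ
    rw [← hψ.last_eq, ← hK ψ hψ, dressedVec_single]
  · rw [nrm_single, norm_one] at hs
    linarith

/-- Under full control the excitation may start on the second spin. -/
lemma exists_heralds_second {P : Protocol n (fullControl n)} {p : ℝ}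
    (hP : P.Heralds (ket 0) (ket (Fin.last (n + 1))) (swapChain 0) p) :
    ∃ Q : Protocol n (fullControl n), Q.duration = P.duration ∧
      Q.Heralds (ket 1) (ket (Fin.last (n + 1))) (swapChain 1) p := by
  -- Swapping spins 1 and 2 entirely brings the excitation to the first spin; the extra swap of the
  -- `b` qubits cancels the first factor of the longer swap chain.
  have h : IsControl (fullControl n) (swapOp 0 1) (swapOp 0 1) := by
    rw [← site₂_swapMat]
    exact isControl_site₂ pair_mem swapMat_mem swapMat_mem
  have hc : (swapChain 0 : Op n) * swapOp 0 1 = swapChain 1 := by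
    have := swapChain_castSucc (n := n) 0
    rw [Fin.castSucc_zero, Fin.succ_zero_eq_one] at this
    rw [this, Matrix.mul_assoc, swapOp_mul_self, Matrix.mul_one]
  rw [← hc]
  refine h.exists_heralds ?_
  rwa [swapOp_mulVec_ket, Equiv.swap_apply_right]

end Steps

/-! ### Approximate reachability -/

section Reachability

open scoped Matrix.Norms.L2Operator

variable {n : ℕ}

lemma nrm_mulVec_le {ι : Type*} [Fintype ι] [DecidableEq ι] (A : Matrix ι ι ℂ) (v : ι → ℂ) :
    nrm (A.mulVec v) ≤ ‖A‖ * nrm v :=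
  Matrix.l2_opNorm_mulVec A (WithLp.toLp 2 v)

/-- Curves in a function space are differentiated for the sup norm. The crude constant is harmless,
since n is fixed while the step size tends to zero. -/
lemma nrm_le_card_mul_norm {ι : Type*} [Fintype ι] (v : ι → ℂ) :
    nrm v ≤ Fintype.card ι * ‖v‖ := by
  have h : nrm v ≤ ∑ i, ‖v i‖ := by
    refine (sq_le_sq₀ (nrm_nonneg _) (Finset.sum_nonneg fun _ _ => norm_nonneg _)).1 ?_
    rw [nrm_sq]
    exact Finset.sum_sq_le_sq_sum_of_nonneg fun i _ => norm_nonneg _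
  refine h.trans ((Finset.sum_le_sum fun i _ => norm_le_pi_norm v i).trans ?_)
  simp

lemma norm_le_one_of_star_mul {U : Matrix (Fin (n + 2)) (Fin (n + 2)) ℂ} (hU : star U * U = 1) :
    ‖U‖ ≤ 1 :=
  (CStarRing.norm_of_mem_unitary ((Matrix.mem_unitaryGroup_iff').2 hU)).le

lemma norm_mat_le {s : Step} (hs : s ≠ .measure) : ‖s.mat n‖ ≤ 1 := by
  cases s with
  | evolve t => exact norm_le_one_of_star_mul (star_evol_mul_evol hop_isHermitian _)
  | phaseFirst θ => exact norm_le_one_of_star_mul (star_phaseMat_mul _ _)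
  | phaseLast θ => exact norm_le_one_of_star_mul (star_phaseMat_mul _ _)
  | measure => exact absurd rfl hs

/-- A sequence of operations without measurements. -/
def Coherent (l : List Step) : Prop := ∀ s ∈ l, s ≠ Step.measure

lemma Coherent.append {l m : List Step} (hl : Coherent l) (hm : Coherent m) :
    Coherent (l ++ m) := fun s hs => (List.mem_append.1 hs).elim (hl s) (hm s)

lemma coherent_nil : Coherent [] := fun _ h => absurd h List.not_mem_nil

lemma Coherent.norm_run_le {l : List Step} (hl : Coherent l) : ‖run n l‖ ≤ 1 := by
  induction l with
  | nil => exact norm_le_one_of_star_mul (by simp [run])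
  | cons s l ih =>
    refine (norm_mul_le _ _).trans (mul_le_one₀ (ih fun a ha => hl a (List.mem_cons_of_mem _ ha))
      (norm_nonneg _) (norm_mat_le (hl s List.mem_cons_self)))

/-- Starting from `x`, one may come arbitrarily close to `y` in the time `T`, without
measurements. -/
def Reach (T : ℝ) (x y : Fin (n + 2) → ℂ) : Prop :=
  ∀ η > 0, ∃ l, Coherent l ∧ time l ≤ T ∧ nrm ((run n l).mulVec x - y) ≤ η

lemma Reach.mono {T T' : ℝ} {x y : Fin (n + 2) → ℂ} (h : Reach T x y) (hT : T ≤ T') :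
    Reach T' x y := fun η hη =>
  let ⟨l, hl, hlT, hlx⟩ := h η hη
  ⟨l, hl, hlT.trans hT, hlx⟩

lemma Reach.smul {T : ℝ} {x y : Fin (n + 2) → ℂ} (h : Reach T x y) (c : ℂ) :
    Reach T (c • x) (c • y) := by
  intro η hη
  -- The added 1 covers c = 0.
  obtain ⟨l, hl, hlT, hlx⟩ := h (η / (‖c‖ + 1)) (by positivity)
  refine ⟨l, hl, hlT, ?_⟩
  rw [Matrix.mulVec_smul, ← smul_sub, nrm_smul]
  rw [le_div_iff₀ (by positivity)] at hlx
  nlinarith [nrm_nonneg ((run n l).mulVec x - y)]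

/-- The first point may be approximated. -/
lemma reach_of_forall_near {T : ℝ} {x y : Fin (n + 2) → ℂ}
    (h : ∀ η > 0, ∃ x', nrm (x - x') ≤ η ∧ Reach T x' y) : Reach T x y := by
  intro η hη
  obtain ⟨x', hx', hr⟩ := h (η / 2) (by linarith)
  obtain ⟨l, hl, hlT, hlx⟩ := hr (η / 2) (by linarith)
  refine ⟨l, hl, hlT, ?_⟩
  -- Runs are contractions, so the initial error is not amplified.
  have : (run n l).mulVec x - y = (run n l).mulVec (x - x') + ((run n l).mulVec x' - y) := by
    rw [Matrix.mulVec_sub]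
    abel
  rw [this]
  refine (nrm_add_le _ _).trans ?_
  have := nrm_run_mulVec_le (n := n) l (x - x')
  linarith

/-! Reflection of the chain. -/

/-- The reflected operation. -/
def Step.reflect : Step → Step
  | .evolve t => .evolve t
  | .phaseFirst θ => .phaseLast θ
  | .phaseLast θ => .phaseFirst θ
  | .measure => .measure

/-- The path is symmetric under reversal, so free evolution is unchanged while the two ends trade
places. Measurements are excluded because only the last site is measured. -/
lemma mat_reflect {s : Step} (hs : s ≠ .measure) :
    s.reflect.mat n = (s.mat n).submatrix Fin.rev Fin.rev := by
  have hphase : ∀ (k : Fin (n + 2)) (θ : ℝ),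
      phaseMat k.rev θ = (phaseMat k θ).submatrix Fin.rev Fin.rev := by
    intro k θ
    rw [phaseMat, phaseMat, Matrix.submatrix_diagonal _ _ Fin.rev_injective]
    congr 1
    ext l
    simp [Fin.rev_eq_iff]
  cases s with
  | evolve t =>
    have hJ : hop n * (1 : Matrix (Fin (n + 2)) (Fin (n + 2)) ℂ).submatrix Fin.rev id =
        (1 : Matrix (Fin (n + 2)) (Fin (n + 2)) ℂ).submatrix Fin.rev id * hop n := by
      ext i j
      have h1 : ∀ k : Fin (n + 2), k.rev = j ↔ k = j.rev := fun k => Fin.rev_eq_iff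
      simp only [Matrix.mul_apply, Matrix.submatrix_apply, Matrix.one_apply, id, mul_ite, mul_one,
        mul_zero, ite_mul, one_mul, zero_mul, h1, Finset.sum_ite_eq, Finset.sum_ite_eq',
        Finset.mem_univ, if_true]
      simp only [hop, Matrix.of_apply, Fin.val_rev]
      have := i.isLt
      have := j.isLt
      congr 1
      apply propext
      omega
    have h := evol_mul_of_intertwine hJ t
    ext i j
    have h2 := congrFun (congrFun h i) j.rev
    simp only [Matrix.mul_apply, Matrix.submatrix_apply, Matrix.one_apply, id, mul_ite, mul_one,
      mul_zero, ite_mul, one_mul, zero_mul, Finset.sum_ite_eq, Fin.rev_inj, Finset.sum_ite_eq',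
      Finset.mem_univ, if_true] at h2
    simpa [Step.reflect, Step.mat] using h2
  | phaseFirst θ =>
    have := hphase 0 θ
    rw [Fin.rev_zero] at this
    exact this
  | phaseLast θ =>
    have := hphase (Fin.last (n + 1)) θ
    rw [Fin.rev_last] at this
    exact this
  | measure => exact absurd rfl hs

lemma run_reflect {l : List Step} (hl : Coherent l) :
    run n (l.map Step.reflect) = (run n l).submatrix Fin.rev Fin.rev := by
  induction l with
  | nil => exact (Matrix.submatrix_one_equiv Fin.revPerm).symm
  | cons s l ih =>
    rw [List.map_cons, run, run, ih fun a ha => hl a (List.mem_cons_of_mem _ ha),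
      mat_reflect (hl s List.mem_cons_self)]
    exact Matrix.submatrix_mul_equiv _ _ _ Fin.revPerm _

lemma time_reflect (l : List Step) : time (l.map Step.reflect) = time l := by
  rw [time, time, List.map_map]
  congr 2
  ext s
  cases s <;> rfl

lemma nrm_comp_rev (x : Fin (n + 2) → ℂ) : nrm (x ∘ Fin.rev) = nrm x := by
  refine (sq_eq_sq₀ (nrm_nonneg _) (nrm_nonneg _)).1 ?_
  rw [nrm_sq, nrm_sq]
  exact Equiv.sum_comp Fin.revPerm fun i => ‖x i‖ ^ 2

/-- Lets a drive built at the first site be used at the last one. -/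
lemma Reach.reflect {T : ℝ} {x y : Fin (n + 2) → ℂ} (h : Reach T x y) :
    Reach T (x ∘ Fin.rev) (y ∘ Fin.rev) := by
  intro η hη
  obtain ⟨l, hl, hlT, hlx⟩ := h η hη
  refine ⟨l.map Step.reflect, ?_, by rwa [time_reflect], ?_⟩
  · intro s hs
    obtain ⟨a, ha, rfl⟩ := List.mem_map.1 hs
    have := hl a ha
    cases a <;> simp_all [Step.reflect]
  · rw [run_reflect hl]
    have h1 := Matrix.submatrix_mulVec_equiv (run n l) (x ∘ Fin.rev) Fin.rev Fin.revPerm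
    have h2 : (x ∘ Fin.rev) ∘ (Fin.revPerm (n := n + 2)).symm = x := by
      ext i; simp
    rw [h2] at h1
    rw [show (run n l).submatrix Fin.rev Fin.rev = (run n l).submatrix Fin.rev Fin.revPerm from rfl,
      h1]
    rw [← nrm_comp_rev] at hlx
    exact hlx

/-! Generators of short sequences of operations. -/

/-- Sequences of operations of duration `c δ` act as `1 + δ K t + o(δ)`, uniformly in `t ∈ s`. -/
def Generates (s : Set ℝ) (c : ℝ) (K : ℝ → Matrix (Fin (n + 2)) (Fin (n + 2)) ℂ) : Prop :=
  ∀ η > 0, ∃ δ₀ > 0, ∀ δ, 0 < δ → δ ≤ δ₀ → ∀ t ∈ s, ∃ l, Coherent l ∧ time l ≤ c * δ ∧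
    ‖run n l - 1 - (δ : ℂ) • K t‖ ≤ η * δ

/-- First-order Trotter splitting: apart from the two given errors, running the sequences one after
the other costs only δ (run − 1) K₁, which is O(δ²). The bound B makes this uniform in t. -/
lemma Generates.add {s : Set ℝ} {c₁ c₂ B : ℝ} {K₁ K₂ : ℝ → Matrix (Fin (n + 2)) (Fin (n + 2)) ℂ}
    (h₁ : Generates s c₁ K₁) (h₂ : Generates s c₂ K₂) (hB₁ : ∀ t ∈ s, ‖K₁ t‖ ≤ B)
    (hB₂ : ∀ t ∈ s, ‖K₂ t‖ ≤ B) :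
    Generates s (c₁ + c₂) fun t => K₁ t + K₂ t := by
  intro η hη
  obtain ⟨δ₁, hδ₁, h₁⟩ := h₁ (η / 3) (by linarith)
  obtain ⟨δ₂, hδ₂, h₂⟩ := h₂ (η / 3) (by linarith)
  set C : ℝ := |B| with hC
  have hC0 : 0 ≤ C := abs_nonneg _
  -- The last entry is the step size at which (C + η) δ (C + 1) = η / 3.
  refine ⟨min (min δ₁ δ₂) (η / (3 * (C + η) * (C + 1))), by positivity, fun δ hδ hδ₀ t ht => ?_⟩
  simp only [le_min_iff] at hδ₀
  obtain ⟨l, hl, hlt, hln⟩ := h₁ δ hδ hδ₀.1.1 t ht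
  obtain ⟨m, hm, hmt, hmn⟩ := h₂ δ hδ hδ₀.1.2 t ht
  refine ⟨l ++ m, hl.append hm, by rw [time_append]; linarith, ?_⟩
  have heq : run n (l ++ m) - 1 - (δ : ℂ) • (K₁ t + K₂ t) =
      run n m * (run n l - 1 - (δ : ℂ) • K₁ t) + (run n m - 1 - (δ : ℂ) • K₂ t) +
        (δ : ℂ) • ((run n m - 1) * K₁ t) := by
    rw [run_append, mul_sub, mul_sub, sub_mul, mul_one, one_mul, smul_sub, Matrix.mul_smul, smul_add]
    abel
  have hδn : ‖(δ : ℂ)‖ = δ := by simp [hδ.le]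
  have e1 : ‖run n m * (run n l - 1 - (δ : ℂ) • K₁ t)‖ ≤ η / 3 * δ :=
    (norm_mul_le _ _).trans ((mul_le_of_le_one_left (norm_nonneg _) hm.norm_run_le).trans hln)
  have e2 : ‖run n m - 1‖ ≤ (C + η) * δ := by
    have : run n m - 1 = (run n m - 1 - (δ : ℂ) • K₂ t) + (δ : ℂ) • K₂ t := by abel
    rw [this]
    refine (norm_add_le _ _).trans ?_
    rw [norm_smul, hδn]
    have := (hB₂ t ht).trans (le_abs_self B)
    nlinarith
  have e3 : ‖(δ : ℂ) • ((run n m - 1) * K₁ t)‖ ≤ η / 3 * δ := by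
    rw [norm_smul, hδn, mul_comm]
    refine mul_le_mul_of_nonneg_right ?_ hδ.le
    refine (norm_mul_le _ _).trans ?_
    have hK := (hB₁ t ht).trans (le_abs_self B)
    calc ‖run n m - 1‖ * ‖K₁ t‖ ≤ ((C + η) * δ) * (C + 1) := by
          gcongr; linarith
      _ ≤ ((C + η) * (η / (3 * (C + η) * (C + 1)))) * (C + 1) := by
          gcongr; exact hδ₀.2
      _ = η / 3 := by
          have : C + η ≠ 0 := by positivity
          have : C + 1 ≠ 0 := by positivity
          field_simp
  rw [heq]
  refine (norm_add₃_le).trans ?_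
  linarith

/-- The end of a curve driven by an available generator is reachable from its beginning. -/
lemma Generates.reach {t₀ T c : ℝ} {K : ℝ → Matrix (Fin (n + 2)) (Fin (n + 2)) ℂ} (hT : t₀ ≤ T)
    (hK : Generates (Set.Icc t₀ T) c K) {x y : ℝ → Fin (n + 2) → ℂ}
    (hx : ∀ t ∈ Set.Icc t₀ T, HasDerivAt x (y t) t) (hy : ContinuousOn y (Set.Icc t₀ T))
    (hxy : ∀ t ∈ Set.Icc t₀ T, (K t).mulVec (x t) = y t) :
    Reach (c * (T - t₀)) (x t₀) (x T) := by
  rcases hT.eq_or_lt with rfl | hT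
  · intro η hη
    exact ⟨[], coherent_nil, by simp [time], by simp [run, nrm_zero, hη.le]⟩
  have hxc : ContinuousOn x (Set.Icc t₀ T) := fun t ht => (hx t ht).continuousAt.continuousWithinAt
  obtain ⟨B, hB⟩ := isCompact_Icc.exists_bound_of_continuousOn hxc
  have hB0 : 0 ≤ B := (norm_nonneg _).trans (hB t₀ ⟨le_rfl, hT.le⟩)
  have hU := isCompact_Icc.uniformContinuousOn_of_continuous hy
  rw [Metric.uniformContinuousOn_iff_le] at hU
  intro η hη
  set D : ℝ := (Fintype.card (Fin (n + 2)) : ℝ) with hD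
  have hD0 : 0 < D := by rw [hD, Fintype.card_fin]; positivity
  -- A step of length δ costs ζ δ D B for the generator, applied to a vector of size at most D B,
  -- and ζ δ D for the Taylor error of the curve; over the whole interval this adds up to η.
  set ζ : ℝ := η / ((T - t₀) * (D * B + D)) with hζ
  have hT' : 0 < T - t₀ := by linarith
  have hζ0 : 0 < ζ := by positivity
  obtain ⟨δ₁, hδ₁, hK⟩ := hK ζ hζ0
  obtain ⟨δ₂, hδ₂, hU⟩ := hU ζ hζ0
  obtain ⟨m, hm⟩ := exists_nat_gt (max ((T - t₀) / δ₁) ((T - t₀) / δ₂))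
  have hm1 : (T - t₀) / δ₁ < m := (le_max_left _ _).trans_lt hm
  have hm2 : (T - t₀) / δ₂ < m := (le_max_right _ _).trans_lt hm
  have hm0 : (0 : ℝ) < m := lt_trans (by positivity) hm1
  set δ : ℝ := (T - t₀) / m with hδ
  have hδ0 : 0 < δ := by positivity
  have hδ1 : δ ≤ δ₁ := by
    rw [hδ, div_le_iff₀ hm0]; rw [div_lt_iff₀ hδ₁] at hm1; linarith
  have hδ2 : δ ≤ δ₂ := by
    rw [hδ, div_le_iff₀ hm0]; rw [div_lt_iff₀ hδ₂] at hm2; linarith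
  have hmδ : m * δ = T - t₀ := by rw [hδ]; field_simp
  -- Euler scheme. The error grows only linearly, because each run is a contraction.
  have key : ∀ k : ℕ, k ≤ m → ∃ l, Coherent l ∧ time l ≤ c * (k * δ) ∧
      nrm ((run n l).mulVec (x t₀) - x (t₀ + k * δ)) ≤ k * δ * (ζ * (D * B + D)) := by
    intro k
    induction k with
    | zero => intro _; exact ⟨[], coherent_nil, by simp [time], by simp [run, nrm_zero]⟩
    | succ k ih =>
      intro hk
      obtain ⟨l, hl, hlt, hln⟩ := ih (by omega)
      have hk' : ((k : ℝ) + 1) ≤ m := by exact_mod_cast hk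
      have ht : t₀ + k * δ ∈ Set.Icc t₀ T := by
        constructor
        · have : 0 ≤ k * δ := by positivity
          linarith
        · nlinarith
      have ht' : t₀ + (k + 1) * δ ∈ Set.Icc t₀ T := by
        constructor
        · have : 0 ≤ (k + 1) * δ := by positivity
          linarith
        · nlinarith
      obtain ⟨p, hp, hpt, hpn⟩ := hK δ hδ0 hδ1 _ ht
      refine ⟨l ++ p, hl.append hp, ?_, ?_⟩
      · rw [time_append]
        push_cast
        linarith
      set s := t₀ + k * δ with hs
      have hss : t₀ + ((k + 1 : ℕ) : ℝ) * δ = s + δ := by rw [hs]; push_cast; ring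
      have hs' : s + δ ∈ Set.Icc t₀ T := by
        rw [← hss]; push_cast; exact ht'
      have hsub : Set.Icc s (s + δ) ⊆ Set.Icc t₀ T := Set.Icc_subset_Icc ht.1 hs'.2
      -- Mean value inequality for the curve minus its tangent; uniform continuity keeps y within ζ
      -- of y s during the step.
      have e1 : ‖x (s + δ) - x s - (δ : ℂ) • y s‖ ≤ ζ * δ := by
        have := Convex.norm_image_sub_le_of_norm_hasDerivWithin_le
          (f := fun r => x r - (r : ℝ) • y s) (f' := fun r => y r - y s) (C := ζ)
          (s := Set.Icc s (s + δ)) (x := s) (y := s + δ)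
          (fun r hr => by
            have h2 := ((hx r (hsub hr)).sub ((hasDerivAt_id r).smul_const (y s))).hasDerivWithinAt
              (s := Set.Icc s (s + δ))
            rw [one_smul] at h2
            exact h2)
          (fun r hr => by
            rw [← dist_eq_norm]
            refine hU r (hsub hr) s ht ?_
            rw [Real.dist_eq, abs_of_nonneg (by linarith [hr.1])]
            linarith [hr.2])
          (convex_Icc _ _) ⟨le_rfl, by linarith⟩ ⟨by linarith, le_rfl⟩
        have hd : ‖s + δ - s‖ = δ := by simp [hδ0.le]
        rw [hd] at this
        have he : x (s + δ) - x s - (δ : ℂ) • y s =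
            x (s + δ) - (s + δ) • y s - (x s - s • y s) := by
          rw [Complex.coe_smul, add_smul]
          abel
        rw [he]
        exact this
      have heq : (run n (l ++ p)).mulVec (x t₀) - x (s + δ) =
          (run n p).mulVec ((run n l).mulVec (x t₀) - x s) +
            (run n p - 1 - (δ : ℂ) • K s).mulVec (x s) - (x (s + δ) - x s - (δ : ℂ) • y s) := by
        rw [run_append, ← Matrix.mulVec_mulVec, Matrix.mulVec_sub, Matrix.sub_mulVec,
          Matrix.sub_mulVec, Matrix.one_mulVec, Matrix.smul_mulVec, hxy s ht]
        abel
      rw [hss, heq]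
      have b1 := nrm_run_mulVec_le (n := n) p ((run n l).mulVec (x t₀) - x s)
      have b2 : nrm ((run n p - 1 - (δ : ℂ) • K s).mulVec (x s)) ≤ ζ * δ * (D * B) := by
        exact (nrm_mulVec_le _ _).trans (mul_le_mul hpn ((nrm_le_card_mul_norm _).trans
          (mul_le_mul_of_nonneg_left (hB s ht) hD0.le)) (nrm_nonneg _) (by positivity))
      have b3 : nrm (x (s + δ) - x s - (δ : ℂ) • y s) ≤ D * (ζ * δ) :=
        (nrm_le_card_mul_norm _).trans (mul_le_mul_of_nonneg_left e1 hD0.le)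
      refine (nrm_sub_le _ _).trans ?_
      have b4 := nrm_add_le ((run n p).mulVec ((run n l).mulVec (x t₀) - x s))
        ((run n p - 1 - (δ : ℂ) • K s).mulVec (x s))
      push_cast
      nlinarith
  obtain ⟨l, hl, hlt, hln⟩ := key m le_rfl
  rw [hmδ] at hlt hln
  refine ⟨l, hl, hlt, ?_⟩
  rw [show t₀ + (T - t₀) = T by ring] at hln
  refine hln.trans (le_of_eq ?_)
  rw [hζ]
  field_simp

/-! The available generators. -/

lemma hasDerivAt_evol_zero (H : Matrix (Fin (n + 2)) (Fin (n + 2)) ℂ) :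
    HasDerivAt (evol H) (-Complex.I • H) 0 := by
  have h := hasDerivAt_exp_smul_const (𝕂 := ℝ) (-Complex.I • H) 0
  rw [zero_smul, NormedSpace.exp_zero, one_mul] at h
  have he : evol H = fun u : ℝ => NormedSpace.exp (u • (-Complex.I • H)) := by
    ext1 t
    rw [evol]
    congr 1
    rw [← Complex.coe_smul, smul_smul]
    simp
  rw [he]
  exact h

lemma norm_phaseMat_le (k : Fin (n + 2)) (θ : ℝ) : ‖phaseMat k θ‖ ≤ 1 :=
  norm_le_one_of_star_mul (star_phaseMat_mul k θ)

lemma phaseMat_neg_mul (k : Fin (n + 2)) (θ : ℝ) : phaseMat k (-θ) * phaseMat k θ = 1 := by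
  rw [phaseMat, phaseMat, Matrix.diagonal_mul_diagonal, ← Matrix.diagonal_one]
  congr 1
  ext l
  split_ifs
  · rw [← Complex.exp_add]; simp
  · simp

lemma phaseMat_comm (k l : Fin (n + 2)) (θ φ : ℝ) :
    phaseMat k θ * phaseMat l φ = phaseMat l φ * phaseMat k θ := by
  rw [phaseMat, phaseMat, Matrix.diagonal_mul_diagonal, Matrix.diagonal_mul_diagonal]
  simp_rw [mul_comm]

/-- The hopping matrix conjugated with phases on the first and the last site. -/
def hopPhase (n : ℕ) (θ φ : ℝ) : Matrix (Fin (n + 2)) (Fin (n + 2)) ℂ :=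
  phaseMat (Fin.last (n + 1)) (-φ) * (phaseMat 0 (-θ) * hop n * phaseMat 0 θ) *
    phaseMat (Fin.last (n + 1)) φ

/-- Waiting for δ/2 between phases and their inverses is evolution under the conjugated hopping
matrix. Half of the time is left free for a second setting of the phases. -/
lemma generates_hopPhase (s : Set ℝ) (θ φ : ℝ → ℝ) :
    Generates (n := n) s (1 / 2) fun t => (-(Complex.I / 2)) • hopPhase n (θ t) (φ t) := by
  intro η hη
  have h := (hasDerivAt_evol_zero (hop n)).isLittleO
  rw [Asymptotics.isLittleO_iff] at h
  -- With the waiting time δ/2, the tolerance 2η becomes ηδ.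
  have h := h (show (0 : ℝ) < 2 * η by linarith)
  rw [Metric.eventually_nhds_iff] at h
  obtain ⟨δ₁, hδ₁, h⟩ := h
  refine ⟨δ₁, hδ₁, fun δ hδ hδ1 t _ => ?_⟩
  obtain ⟨τ, hτ⟩ : ∃ τ : ℝ≥0, (τ : ℝ) = δ / 2 := ⟨⟨δ / 2, by positivity⟩, rfl⟩
  refine ⟨[.phaseFirst (θ t), .phaseLast (φ t), .evolve τ, .phaseFirst (-θ t), .phaseLast (-φ t)],
    by simp [Coherent], ?_, ?_⟩
  · simp [time, Step.time, hτ]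
    linarith
  have h2 := @h (δ / 2) (by
    rw [Real.dist_eq, sub_zero, abs_of_pos (by linarith)]
    linarith)
  have e0 : evol (hop n) 0 = 1 := by simp [evol, NormedSpace.exp_zero]
  rw [sub_zero, e0, Real.norm_of_nonneg (by positivity)] at h2
  set L := phaseMat (Fin.last (n + 1)) (φ t) with hL
  set L' := phaseMat (Fin.last (n + 1)) (-φ t) with hL'
  set F := phaseMat (0 : Fin (n + 2)) (θ t) with hF
  set F' := phaseMat (0 : Fin (n + 2)) (-θ t) with hF'
  have hLL : L' * L = 1 := phaseMat_neg_mul _ _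
  have hFF : F' * F = 1 := phaseMat_neg_mul _ _
  have hLF : L * F = F * L := phaseMat_comm _ _ _ _
  have heq : run n [.phaseFirst (θ t), .phaseLast (φ t), .evolve τ, .phaseFirst (-θ t),
      .phaseLast (-φ t)] - 1 -
        (δ : ℂ) • ((-(Complex.I / 2)) • hopPhase n (θ t) (φ t)) =
      L' * (F' * (evol (hop n) (δ / 2) - 1 - (δ / 2) • -Complex.I • hop n) * F) * L := by
    simp only [run, Step.mat, one_mul, hopPhase, hτ]
    rw [← hL, ← hL', ← hF, ← hF', mul_sub, mul_sub, sub_mul, sub_mul, mul_sub, mul_sub, sub_mul,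
      sub_mul, mul_one, hFF, mul_one, hLL, ← Complex.coe_smul, smul_smul, smul_smul]
    simp only [Matrix.mul_smul, Matrix.smul_mul]
    congr 1
    · congr 1
      simp only [mul_assoc]
      rw [hLF]
    · congr 1
      push_cast
      ring
  rw [heq]
  have nl : ∀ M : Matrix (Fin (n + 2)) (Fin (n + 2)) ℂ, ‖L' * (F' * M * F) * L‖ ≤ ‖M‖ := by
    intro M
    have a1 : ‖L‖ ≤ 1 := norm_phaseMat_le _ _
    have a2 : ‖L'‖ ≤ 1 := norm_phaseMat_le _ _
    have a3 : ‖F‖ ≤ 1 := norm_phaseMat_le _ _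
    have a4 : ‖F'‖ ≤ 1 := norm_phaseMat_le _ _
    calc ‖L' * (F' * M * F) * L‖ ≤ ‖L'‖ * ((‖F'‖ * ‖M‖) * ‖F‖) * ‖L‖ :=
          (norm_mul_le _ _).trans (mul_le_mul_of_nonneg_right ((norm_mul_le _ _).trans
            (mul_le_mul_of_nonneg_left ((norm_mul_le _ _).trans (mul_le_mul_of_nonneg_right
              (norm_mul_le _ _) (norm_nonneg _))) (norm_nonneg _))) (norm_nonneg _))
      _ ≤ 1 * ((1 * ‖M‖) * 1) * 1 := by gcongr
      _ = ‖M‖ := by ring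
  refine (nl _).trans (h2.trans (le_of_eq (by ring)))

/-- A phase of angle δ f(t) takes no time, and |e^z − 1 − z| ≤ |z|² for |z| ≤ 1 makes the error
quadratic in δ. The two bounds on δ ensure |z| ≤ 1 and |z|² ≤ ηδ. -/
lemma generates_phaseFirst {s : Set ℝ} {f : ℝ → ℝ} {B : ℝ} (hf : ∀ t ∈ s, |f t| ≤ B) :
    Generates (n := n) s 0 fun t =>
      Matrix.diagonal (Pi.single 0 (Complex.I * (f t : ℂ))) := by
  intro η hη
  have hB : 0 ≤ |B| := abs_nonneg B
  refine ⟨min (1 / (|B| + 1)) (η / (|B| + 1) ^ 2), by positivity, fun δ hδ hδ₀ t ht =>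
    ⟨[.phaseFirst (δ * f t)], by simp [Coherent], by simp [time, Step.time], ?_⟩⟩
  simp only [le_min_iff] at hδ₀
  have hft := (hf t ht).trans (le_abs_self B)
  have heq : run n [.phaseFirst (δ * f t)] - 1 -
      (δ : ℂ) • Matrix.diagonal (Pi.single 0 (Complex.I * (f t : ℂ))) =
      Matrix.diagonal (Pi.single 0 (Complex.exp ((δ * f t : ℝ) * Complex.I) - 1 -
        (δ * f t : ℝ) * Complex.I)) := by
    simp only [run, Step.mat, one_mul, phaseMat]
    rw [← Matrix.diagonal_one, Matrix.diagonal_sub, ← Matrix.diagonal_smul, Matrix.diagonal_sub]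
    congr 1
    ext l
    by_cases hl : l = 0
    · subst hl
      simp
      ring
    · simp [hl]
  rw [heq, Matrix.l2_opNorm_diagonal, Pi.norm_single]
  have hz : ‖((δ * f t : ℝ) : ℂ) * Complex.I‖ = δ * |f t| := by
    rw [norm_mul, Complex.norm_I, mul_one, Complex.norm_real, Real.norm_eq_abs, abs_mul,
      abs_of_pos hδ]
  have h1 : δ * (|B| + 1) ≤ 1 := (le_div_iff₀ (by positivity)).1 hδ₀.1
  have h2 : δ * (|B| + 1) ^ 2 ≤ η := (le_div_iff₀ (by positivity)).1 hδ₀.2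
  refine (Complex.norm_exp_sub_one_sub_id_le ?_).trans ?_
  · rw [hz]
    nlinarith
  · rw [hz]
    have : δ * |f t| ≤ δ * (|B| + 1) := by gcongr; linarith
    calc (δ * |f t|) ^ 2 ≤ (δ * (|B| + 1)) ^ 2 := by gcongr
      _ = (δ * (|B| + 1) ^ 2) * δ := by ring
      _ ≤ η * δ := by gcongr

end Reachability

/-! ### Modes of the interior of the chain -/

section Modes

/-- Dirichlet kernel: 2 sin(x/2) cos(kx) is a difference of consecutive sines at half-integer
multiples of x, so the sum telescopes. -/
lemma sum_range_cos (q : ℕ) (x : ℝ) :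
    2 * Real.sin (x / 2) * ∑ k ∈ Finset.range q, Real.cos (k * x) =
      Real.sin ((q - 1 / 2) * x) + Real.sin (x / 2) := by
  induction q with
  | zero =>
    rw [Finset.sum_range_zero, mul_zero, Nat.cast_zero, show (0 - 1 / 2) * x = -(x / 2) by ring,
      Real.sin_neg]
    ring
  | succ q ih =>
    rw [Finset.sum_range_succ, mul_add, ih]
    have h1 : Real.sin (((q + 1 : ℕ) - 1 / 2) * x) = Real.sin (q * x + x / 2) := by
      push_cast; congr 1; ring
    have h2 : Real.sin ((q - 1 / 2) * x) = Real.sin (q * x - x / 2) := by congr 1; ring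
    rw [h1, h2, Real.sin_add, Real.sin_sub]
    ring

/-- For 0 < |j| < 2q the factor sin(πj/2q) does not vanish and may be divided out of
`sum_range_cos`. -/
lemma sum_range_cos_int {q : ℕ} (hq : 0 < q) {j : ℤ} (hj0 : j ≠ 0) (hj : |j| < 2 * q) :
    ∑ k ∈ Finset.range q, Real.cos (k * (Real.pi * j / q)) = (1 - (-1) ^ j) / 2 := by
  have h := sum_range_cos q (Real.pi * j / q)
  have hq' : (q : ℝ) ≠ 0 := by positivity
  have hs : Real.sin (Real.pi * j / q / 2) ≠ 0 := by
    intro h0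
    rw [Real.sin_eq_zero_iff] at h0
    obtain ⟨m, hm⟩ := h0
    have h1 : (m : ℝ) * (2 * q) = j := by
      field_simp at hm
      linarith
    have h2 : m * (2 * q) = j := by exact_mod_cast h1
    have hm0 : m ≠ 0 := by rintro rfl; simp at h2; exact hj0 h2.symm
    have : |j| = |m| * (2 * q) := by rw [← h2, abs_mul, abs_of_nonneg (by positivity : (0 : ℤ) ≤ 2 * q)]
    have : 1 ≤ |m| := Int.one_le_abs hm0
    nlinarith
  have h1 : Real.sin ((q - 1 / 2) * (Real.pi * j / q)) =
      -(-1) ^ j * Real.sin (Real.pi * j / q / 2) := by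
    have : (q - 1 / 2) * (Real.pi * j / q) = j * Real.pi - Real.pi * j / q / 2 := by field_simp
    rw [this, Real.sin_sub, Real.sin_int_mul_pi, Real.cos_int_mul_pi]
    ring
  rw [h1] at h
  have : 2 * Real.sin (Real.pi * j / q / 2) *
      (∑ k ∈ Finset.range q, Real.cos (k * (Real.pi * j / q)) - (1 - (-1) ^ j) / 2) = 0 := by
    rw [mul_sub, h]; ring
  have := (mul_eq_zero.1 this).resolve_left (mul_ne_zero two_ne_zero hs)
  linarith

/-- Orthogonality of the discrete sine transform. -/
lemma sum_sin_mul_sin {q a b : ℕ} (ha : 1 ≤ a) (ha' : a < q) (hb : 1 ≤ b) (hb' : b < q) :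
    ∑ k ∈ Finset.range q, Real.sin (Real.pi * k * a / q) * Real.sin (Real.pi * k * b / q) =
      if a = b then (q : ℝ) / 2 else 0 := by
  have hq : 0 < q := by omega
  have hterm : ∀ k : ℕ, Real.sin (Real.pi * k * a / q) * Real.sin (Real.pi * k * b / q) =
      (Real.cos (k * (Real.pi * ((a : ℤ) - b : ℤ) / q)) -
        Real.cos (k * (Real.pi * ((a : ℤ) + b : ℤ) / q))) / 2 := by
    intro k
    have h1 : (k : ℝ) * (Real.pi * ((a : ℤ) - b : ℤ) / q) =
        Real.pi * k * a / q - Real.pi * k * b / q := by push_cast; ring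
    have h2 : (k : ℝ) * (Real.pi * ((a : ℤ) + b : ℤ) / q) =
        Real.pi * k * a / q + Real.pi * k * b / q := by push_cast; ring
    rw [h1, h2, Real.cos_sub, Real.cos_add]
    ring
  simp_rw [hterm]
  rw [← Finset.sum_div, Finset.sum_sub_distrib,
    sum_range_cos_int hq (j := (a : ℤ) + b) (by omega) (by rw [abs_lt]; omega)]
  split_ifs with hab
  · subst hab
    have : (-1 : ℝ) ^ ((a : ℤ) + a) = 1 := Even.neg_one_zpow ⟨a, rfl⟩
    rw [this]
    simp
  · rw [sum_range_cos_int hq (j := (a : ℤ) - b) (by omega) (by rw [abs_lt]; omega)]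
    have : (-1 : ℝ) ^ ((a : ℤ) + b) = (-1) ^ ((a : ℤ) - b) := by
      rw [show (a : ℤ) + b = (a - b) + 2 * b by ring, zpow_add₀ (by norm_num), zpow_mul]
      simp
    rw [this]
    ring

variable {n : ℕ}

/-- The amplitude at the site `m` of the `k`-th mode of the interior of the chain. -/
def modeAmp (n k m : ℕ) : ℝ :=
  √(2 / ((n : ℝ) + 1)) * Real.sin (Real.pi * k * m / ((n : ℝ) + 1))

/-- The energy of the `k`-th mode. -/
def modeE (n k : ℕ) : ℝ := 2 * Real.cos (Real.pi * k / ((n : ℝ) + 1))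

/-- The `k`-th mode. -/
def mode (n k : ℕ) : Fin (n + 2) → ℂ := fun m => (modeAmp n k m : ℂ)

lemma modeAmp_comm (k m : ℕ) : modeAmp n k m = modeAmp n m k := by
  rw [modeAmp, modeAmp, mul_right_comm Real.pi]

lemma modeAmp_zero (k : ℕ) : modeAmp n k 0 = 0 := by simp [modeAmp]

lemma modeAmp_last (k : ℕ) : modeAmp n k (n + 1) = 0 := by
  have h : Real.pi * k * ((n + 1 : ℕ) : ℝ) / ((n : ℝ) + 1) = k * Real.pi := by
    push_cast; field_simp
  rw [modeAmp, h, Real.sin_nat_mul_pi, mul_zero]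

lemma sum_modeAmp_mul {a b : ℕ} (ha : a ∈ Finset.Icc 1 n) (hb : b ∈ Finset.Icc 1 n) :
    ∑ k ∈ Finset.Icc 1 n, modeAmp n k a * modeAmp n k b = if a = b then 1 else 0 := by
  rw [Finset.mem_Icc] at ha hb
  have h0 : ∑ k ∈ Finset.Icc 1 n, modeAmp n k a * modeAmp n k b =
      ∑ k ∈ Finset.range (n + 1), modeAmp n k a * modeAmp n k b := by
    refine Finset.sum_subset (fun k hk => ?_) fun k hk hk' => ?_
    · simp only [Finset.mem_Icc, Finset.mem_range] at hk ⊢; omega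
    · have : k = 0 := by
        simp only [Finset.mem_Icc, Finset.mem_range] at hk hk'; omega
      subst this
      rw [modeAmp_comm, modeAmp_zero, zero_mul]
  have h := sum_sin_mul_sin (q := n + 1) ha.1 (by omega) hb.1 (by omega)
  push_cast at h
  have hterm : ∀ k : ℕ, modeAmp n k a * modeAmp n k b = 2 / ((n : ℝ) + 1) *
      (Real.sin (Real.pi * k * a / ((n : ℝ) + 1)) * Real.sin (Real.pi * k * b / ((n : ℝ) + 1))) := by
    intro k
    have := Real.mul_self_sqrt (show (0 : ℝ) ≤ 2 / ((n : ℝ) + 1) by positivity)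
    rw [← this, modeAmp, modeAmp]
    generalize √(2 / ((n : ℝ) + 1)) = r
    ring
  rw [h0, Finset.sum_congr rfl fun k _ => hterm k, ← Finset.mul_sum, h]
  split_ifs
  · field_simp
  · simp

/-- sin(x+y) + sin(x−y) = 2 sin x cos y: the eigenvalue equation at interior sites. -/
lemma modeAmp_rec (k m : ℕ) :
    modeAmp n k (m + 2) + modeAmp n k m = modeE n k * modeAmp n k (m + 1) := by
  have h1 : Real.pi * k * ((m + 2 : ℕ) : ℝ) / ((n : ℝ) + 1) =
      Real.pi * k * ((m + 1 : ℕ) : ℝ) / ((n : ℝ) + 1) + Real.pi * k / ((n : ℝ) + 1) := by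
    push_cast; ring
  have h2 : Real.pi * k * (m : ℝ) / ((n : ℝ) + 1) =
      Real.pi * k * ((m + 1 : ℕ) : ℝ) / ((n : ℝ) + 1) - Real.pi * k / ((n : ℝ) + 1) := by
    push_cast; ring
  rw [modeAmp, modeAmp, h1, h2, Real.sin_add, Real.sin_sub, modeAmp, modeE]
  ring

lemma hop_mulVec_apply (v : ℕ → ℂ) (l : Fin (n + 2)) :
    (hop n).mulVec (fun m => v m) l =
      (if (l : ℕ) = 0 then 0 else v (l - 1)) + if (l : ℕ) = n + 1 then 0 else v (l + 1) := by
  have hl := l.isLt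
  have hsplit : ∀ k : Fin (n + 2), hop n l k * v k =
      (if (l : ℕ) = k + 1 then v k else 0) + if (l : ℕ) + 1 = k then v k else 0 := by
    intro k
    simp only [hop, Matrix.of_apply]
    by_cases h1 : (l : ℕ) + 1 = k
    · have h2 : ¬ (l : ℕ) = k + 1 := by omega
      simp [h1, h2]
    · simp [h1]
  simp only [Matrix.mulVec, dotProduct, hsplit, Finset.sum_add_distrib]
  congr 1
  · split_ifs with h
    · exact Finset.sum_eq_zero fun k _ => if_neg (by omega)
    · rw [Finset.sum_eq_single ⟨l - 1, by omega⟩]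
      · rw [if_pos]
        simp only
        omega
      · intro k _ hk
        exact if_neg fun h' => hk (Fin.ext (by simp only; omega))
      · simp
  · split_ifs with h
    · exact Finset.sum_eq_zero fun k _ => if_neg (by have := k.isLt; omega)
    · rw [Finset.sum_eq_single ⟨l + 1, by omega⟩]
      · simp
      · intro k _ hk
        exact if_neg fun h' => hk (Fin.ext (by simp only; omega))
      · simp

/-- A mode vanishes on both end sites, so it is an eigenvector except for what hops onto these two
sites. -/
lemma hop_mulVec_mode (k : ℕ) : (hop n).mulVec (mode n k) =
    (modeE n k : ℂ) • mode n k + Pi.single 0 (modeAmp n k 1 : ℂ) +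
      Pi.single (Fin.last (n + 1)) (modeAmp n k n : ℂ) := by
  ext l
  have h := hop_mulVec_apply (n := n) (fun m => (modeAmp n k m : ℂ)) l
  rw [show mode n k = fun m : Fin (n + 2) => (modeAmp n k m : ℂ) from rfl, h]
  have hl := l.isLt
  simp only [Pi.add_apply, Pi.smul_apply, smul_eq_mul, Pi.single_apply]
  rcases Nat.eq_zero_or_pos (l : ℕ) with h0 | h0
  · have hl0 : l = 0 := Fin.ext h0
    subst hl0
    simp [modeAmp_zero, Fin.ext_iff]
  · have hl0 : l ≠ 0 := fun h => by simp [h] at h0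
    by_cases h1 : (l : ℕ) = n + 1
    · have hl1 : l = Fin.last (n + 1) := Fin.ext h1
      subst hl1
      simp [modeAmp_last]
    · have hl1 : l ≠ Fin.last (n + 1) := fun h => h1 (by simp [h])
      obtain ⟨m, hm⟩ : ∃ m, (l : ℕ) = m + 1 := ⟨l - 1, by omega⟩
      have hr := modeAmp_rec (n := n) k m
      simp only [hl0, hl1, if_false, add_zero, h1, show ¬ (l : ℕ) = 0 by omega]
      rw [hm, Nat.add_sub_cancel, ← Complex.ofReal_add, ← Complex.ofReal_mul, ← hr, add_comm]

lemma hop_mulVec_single_zero (a : ℂ) :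
    (hop n).mulVec (Pi.single 0 a) = Pi.single 1 a := by
  ext l
  rw [Matrix.mulVec_single]
  simp only [hop, Pi.smul_apply, Matrix.col_apply, Matrix.of_apply, Pi.single_apply, Fin.val_zero,
    Fin.ext_iff, Fin.val_one]
  simp

lemma hop_mulVec_single_last (a : ℂ) :
    (hop n).mulVec (Pi.single (Fin.last (n + 1)) a) = Pi.single (Fin.last n).castSucc a := by
  ext l
  rw [Matrix.mulVec_single]
  simp only [hop, Pi.smul_apply, Matrix.col_apply, Matrix.of_apply, Pi.single_apply, Fin.val_last,
    Fin.ext_iff, Fin.val_castSucc]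
  have hl := l.isLt
  have : ((l : ℕ) + 1 = n + 1 ∨ (l : ℕ) = n + 1 + 1) ↔ (l : ℕ) = n := by omega
  simp only [this, MulOpposite.smul_eq_mul_unop, MulOpposite.unop_op, ite_mul, one_mul, zero_mul]

/-- A site next to the end as a combination of modes. -/
lemma sum_modeAmp_one_smul_mode (hn : 1 ≤ n) :
    ∑ k ∈ Finset.Icc 1 n, (modeAmp n k 1 : ℂ) • mode n k = Pi.single 1 1 := by
  ext m
  have hm := m.isLt
  rw [Finset.sum_apply]
  have hterm : ∀ k ∈ Finset.Icc 1 n, ((modeAmp n k 1 : ℂ) • mode n k) m =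
      ((modeAmp n k 1 * modeAmp n k m : ℝ) : ℂ) := fun k _ => by simp [mode]
  rw [Finset.sum_congr rfl hterm, ← Complex.ofReal_sum, Pi.single_apply]
  simp only [Fin.ext_iff, Fin.val_one]
  by_cases h0 : (m : ℕ) = 0
  · simp [h0, modeAmp_zero]
  · by_cases h1 : (m : ℕ) = n + 1
    · simp [h1, modeAmp_last]
      omega
    · rw [sum_modeAmp_mul (Finset.mem_Icc.2 ⟨le_rfl, hn⟩) (Finset.mem_Icc.2 (by omega))]
      simp only [@eq_comm _ 1]
      split_ifs <;> simp

lemma mode_zero (k : ℕ) : mode n k 0 = 0 := by simp [mode, modeAmp_zero]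

lemma mode_last (k : ℕ) : mode n k (Fin.last (n + 1)) = 0 := by simp [mode, modeAmp_last]

/-- The amplitudes are symmetric in the mode and the site, so orthogonality over modes is
orthogonality over sites. -/
lemma sum_mode_mul {k l : ℕ} (hk : k ∈ Finset.Icc 1 n) (hl : l ∈ Finset.Icc 1 n) :
    ∑ m : Fin (n + 2), modeAmp n k m * modeAmp n l m = if k = l then 1 else 0 := by
  rw [Fin.sum_univ_eq_sum_range fun m => modeAmp n k m * modeAmp n l m, ← sum_modeAmp_mul hk hl]
  simp_rw [modeAmp_comm (n := n) k, modeAmp_comm (n := n) l]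
  refine (Finset.sum_subset (fun m hm => ?_) fun m hm hm' => ?_).symm
  · simp only [Finset.mem_Icc, Finset.mem_range] at hm ⊢; omega
  · have : m = 0 ∨ m = n + 1 := by
      simp only [Finset.mem_Icc, Finset.mem_range] at hm hm'; omega
    rcases this with rfl | rfl
    · rw [modeAmp_comm, modeAmp_zero, zero_mul]
    · rw [modeAmp_comm, modeAmp_last, zero_mul]

/-- The norm of a combination of modes. -/
lemma nrm_sum_mode_sq (s : Finset ℕ) (hs : s ⊆ Finset.Icc 1 n) (c : ℕ → ℂ) :
    nrm (∑ k ∈ s, c k • mode n k) ^ 2 = ∑ k ∈ s, ‖c k‖ ^ 2 := by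
  rw [nrm_sq]
  apply Complex.ofReal_injective
  push_cast
  have h1 : ∀ m : Fin (n + 2), ((‖(∑ k ∈ s, c k • mode n k) m‖ : ℂ)) ^ 2 =
      ∑ k ∈ s, ∑ l ∈ s, starRingEnd ℂ (c k) * c l * ((modeAmp n k m * modeAmp n l m : ℝ) : ℂ) := by
    intro m
    rw [← Complex.conj_mul', Finset.sum_apply, map_sum, Finset.sum_mul_sum]
    refine Finset.sum_congr rfl fun k _ => Finset.sum_congr rfl fun l _ => ?_
    simp only [Pi.smul_apply, smul_eq_mul, mode, map_mul, Complex.conj_ofReal]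
    push_cast
    ring
  simp_rw [h1]
  rw [Finset.sum_comm]
  refine Finset.sum_congr rfl fun k hk => ?_
  rw [Finset.sum_comm, Finset.sum_eq_single k]
  · rw [← Finset.mul_sum, ← Complex.ofReal_sum, sum_mode_mul (hs hk) (hs hk), if_pos rfl,
      Complex.conj_mul']
    simp
  · intro l hl hkl
    rw [← Finset.mul_sum, ← Complex.ofReal_sum, sum_mode_mul (hs hk) (hs hl), if_neg hkl.symm]
    simp
  · exact fun h => absurd hk h

/-- sin(kπ − x) = (−1)^{k+1} sin x. Modes have a definite parity, so a mode filled from one end can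
be emptied from the other. -/
lemma mode_comp_rev {k : ℕ} (hk : 1 ≤ k) : mode n k ∘ Fin.rev = (-1 : ℂ) ^ (k + 1) • mode n k := by
  ext m
  have hm : ((m.rev : Fin (n + 2)) : ℝ) = (n : ℝ) + 1 - (m : ℕ) := by
    rw [Fin.val_rev, Nat.cast_sub (by omega)]
    push_cast
    ring
  simp only [Function.comp_apply, mode, modeAmp, hm, Pi.smul_apply, smul_eq_mul]
  have : Real.pi * k * ((n : ℝ) + 1 - (m : ℕ)) / ((n : ℝ) + 1) =
      k * Real.pi - Real.pi * k * (m : ℕ) / ((n : ℝ) + 1) := by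
    field_simp
  rw [this, Real.sin_sub, Real.sin_nat_mul_pi, Real.cos_nat_mul_pi]
  push_cast
  ring

end Modes

/-! ### Driving the interior of the chain from its first site -/

section Drive

open scoped Matrix.Norms.L2Operator

variable {n : ℕ}

lemma phaseMat_mulVec (k : Fin (n + 2)) (θ : ℝ) (v : Fin (n + 2) → ℂ) :
    (phaseMat k θ).mulVec v = v + Pi.single k ((Complex.exp (θ * Complex.I) - 1) * v k) := by
  ext l
  rw [phaseMat, Matrix.mulVec_diagonal]
  by_cases h : l = k
  · subst h; simp; ring
  · simp [h]

/-- A vector of the interior of the chain, with its image under the hopping matrix. -/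
structure InteriorImage (b Bb : Fin (n + 2) → ℂ) (w z : ℂ) : Prop where
  zero : b 0 = 0
  last : b (Fin.last (n + 1)) = 0
  image_zero : Bb 0 = 0
  image_last : Bb (Fin.last (n + 1)) = 0
  hop_eq : (hop n).mulVec b = Bb + Pi.single 0 w + Pi.single (Fin.last (n + 1)) z

/-- A hop out of an end site picks up its phase, a hop into it the inverse phase; hops inside the
interior are unaffected. For n ≥ 1 the two ends are not neighbours, so the phases do not mix. -/
lemma hopPhase_mulVec (hn : 1 ≤ n) {b Bb : Fin (n + 2) → ℂ} {w z : ℂ}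
    (hb : InteriorImage b Bb w z) (θ φ : ℝ) (a d : ℂ) :
    (hopPhase n θ φ).mulVec (Pi.single 0 a + Pi.single (Fin.last (n + 1)) d + b) =
      Bb + Pi.single 1 (Complex.exp (θ * Complex.I) * a) +
        Pi.single (Fin.last n).castSucc (Complex.exp (φ * Complex.I) * d) +
        Pi.single 0 (Complex.exp (-θ * Complex.I) * w) +
        Pi.single (Fin.last (n + 1)) (Complex.exp (-φ * Complex.I) * z) := by
  have h01 : (0 : Fin (n + 2)) ≠ Fin.last (n + 1) := by simp [Fin.ext_iff]
  have h1 : (1 : Fin (n + 2)) ≠ Fin.last (n + 1) := by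
    rw [Ne, Fin.ext_iff, Fin.val_one, Fin.val_last]; omega
  have h2 : (Fin.last n).castSucc ≠ (0 : Fin (n + 2)) := by
    rw [Ne, Fin.ext_iff, Fin.val_castSucc, Fin.val_last, Fin.val_zero]; omega
  have h3 : (Fin.last n).castSucc ≠ Fin.last (n + 1) := (Fin.castSucc_lt_last _).ne
  have e1 : (phaseMat (Fin.last (n + 1)) φ).mulVec
      (Pi.single 0 a + Pi.single (Fin.last (n + 1)) d + b) =
      Pi.single 0 a + Pi.single (Fin.last (n + 1)) (Complex.exp (φ * Complex.I) * d) + b := by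
    ext l
    by_cases hl : l = Fin.last (n + 1)
    · subst hl
      simp [phaseMat_mulVec, hb.last, h01.symm]
      ring
    · simp [phaseMat_mulVec, hl]
  have e2 : ∀ d : ℂ, (phaseMat 0 θ).mulVec
      (Pi.single 0 a + Pi.single (Fin.last (n + 1)) d + b) =
      Pi.single 0 (Complex.exp (θ * Complex.I) * a) + Pi.single (Fin.last (n + 1)) d + b := by
    intro d
    ext l
    by_cases hl : l = 0
    · subst hl
      simp [phaseMat_mulVec, hb.zero, h01]
      ring
    · simp [phaseMat_mulVec, hl]
  have e3 : ∀ u v : ℂ, (phaseMat 0 (-θ)).mulVec (Pi.single 1 u + Pi.single (Fin.last n).castSucc v +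
      (Bb + Pi.single 0 w + Pi.single (Fin.last (n + 1)) z)) =
      (Pi.single 1 u + Pi.single (Fin.last n).castSucc v + (Bb +
        Pi.single 0 (Complex.exp (-θ * Complex.I) * w) + Pi.single (Fin.last (n + 1)) z)) := by
    intro u v
    ext l
    by_cases hl : l = 0
    · subst hl
      simp [phaseMat_mulVec, hb.image_zero, h01, h2.symm]
      ring
    · simp [phaseMat_mulVec, hl]
  have e4 : ∀ u v w : ℂ, (phaseMat (Fin.last (n + 1)) (-φ)).mulVec
      (Pi.single 1 u + Pi.single (Fin.last n).castSucc v +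
      (Bb + Pi.single 0 w + Pi.single (Fin.last (n + 1)) z)) =
      (Pi.single 1 u + Pi.single (Fin.last n).castSucc v + (Bb +
        Pi.single 0 w + Pi.single (Fin.last (n + 1)) (Complex.exp (-φ * Complex.I) * z))) := by
    intro u v w
    ext l
    by_cases hl : l = Fin.last (n + 1)
    · subst hl
      simp [phaseMat_mulVec, hb.image_last, h01.symm, h1.symm, h3.symm]
      ring
    · simp [phaseMat_mulVec, hl]
  rw [hopPhase, ← Matrix.mulVec_mulVec, e1, ← Matrix.mulVec_mulVec, ← Matrix.mulVec_mulVec,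
    ← Matrix.mulVec_mulVec, e2, Matrix.mulVec_add (hop n), Matrix.mulVec_add (hop n),
    hop_mulVec_single_zero, hop_mulVec_single_last, hb.hop_eq, e3, e4]
  abel

lemma norm_hopPhase_le (θ φ : ℝ) : ‖hopPhase n θ φ‖ ≤ ‖hop n‖ := by
  have a : ∀ (k : Fin (n + 2)) (θ : ℝ) (M : Matrix (Fin (n + 2)) (Fin (n + 2)) ℂ),
      ‖phaseMat k θ * M‖ ≤ ‖M‖ := fun k θ M =>
    (norm_mul_le _ _).trans (mul_le_of_le_one_left (norm_nonneg _) (norm_phaseMat_le _ _))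
  have b : ∀ (k : Fin (n + 2)) (θ : ℝ) (M : Matrix (Fin (n + 2)) (Fin (n + 2)) ℂ),
      ‖M * phaseMat k θ‖ ≤ ‖M‖ := fun k θ M =>
    (norm_mul_le _ _).trans (mul_le_of_le_one_right (norm_nonneg _) (norm_phaseMat_le _ _))
  exact (b _ _ _).trans ((a _ _ _).trans ((b _ _ _).trans (a _ _ _)))

/-- An effective coupling `ρ exp (iχ)` of the first site to the interior, with a field `g` on the
first site, and with the last site decoupled. -/
def driveGen (n : ℕ) (χ ρ g : ℝ) : Matrix (Fin (n + 2)) (Fin (n + 2)) ℂ :=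
  (-(Complex.I / 2)) • hopPhase n (χ + Real.arccos ρ) 0 +
    (-(Complex.I / 2)) • hopPhase n (χ - Real.arccos ρ) Real.pi +
    Matrix.diagonal (Pi.single 0 (Complex.I * (g : ℂ)))

/-- Two waits of δ/2 and an instantaneous phase: the total time is δ. -/
lemma generates_driveGen {s : Set ℝ} (χ ρ : ℝ → ℝ) {g : ℝ → ℝ} {B : ℝ}
    (hg : ∀ t ∈ s, |g t| ≤ B) :
    Generates s 1 fun t => driveGen n (χ t) (ρ t) (g t) := by
  have hI : ‖(-(Complex.I / 2) : ℂ)‖ ≤ 1 := by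
    rw [norm_neg, norm_div, Complex.norm_I]; norm_num
  have hb : ∀ θ φ : ℝ, ‖(-(Complex.I / 2)) • hopPhase n θ φ‖ ≤ ‖hop n‖ := fun θ φ => by
    rw [norm_smul]
    exact (mul_le_of_le_one_left (norm_nonneg _) hI).trans (norm_hopPhase_le _ _)
  have h1 := (generates_hopPhase (n := n) s (fun t => χ t + Real.arccos (ρ t)) fun _ => 0).add
    (generates_hopPhase (n := n) s (fun t => χ t - Real.arccos (ρ t)) fun _ => Real.pi)
    (fun t _ => hb _ _) (fun t _ => hb _ _)
  have h2 := h1.add (generates_phaseFirst (n := n) hg) (B := max (‖hop n‖ + ‖hop n‖) B)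
    (fun t _ => (norm_add_le _ _).trans ((add_le_add (hb _ _) (hb _ _)).trans (le_max_left _ _)))
    (fun t ht => by
      rw [Matrix.l2_opNorm_diagonal, Pi.norm_single, norm_mul, Complex.norm_I, one_mul,
        Complex.norm_real, Real.norm_eq_abs]
      exact (hg t ht).trans (le_max_right _ _))
  have hc : (1 : ℝ) = 1 / 2 + 1 / 2 + 0 := by norm_num
  rw [hc]
  exact h2

/-- Opposite phases 0 and π on the last site cancel its bond in both directions. On the first site
e^{i(χ+ω)} + e^{i(χ−ω)} = 2 cos ω e^{iχ}, which with ω = arccos ρ gives any coupling of modulus at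
most one. -/
lemma driveGen_mulVec (hn : 1 ≤ n) {b Bb : Fin (n + 2) → ℂ} {w z : ℂ}
    (hb : InteriorImage b Bb w z) {χ ρ : ℝ} (g : ℝ) (a d : ℂ) (hρ : -1 ≤ ρ) (hρ' : ρ ≤ 1) :
    (driveGen n χ ρ g).mulVec (Pi.single 0 a + Pi.single (Fin.last (n + 1)) d + b) =
      -Complex.I • Bb + Pi.single 1 (-Complex.I * ρ * Complex.exp (χ * Complex.I) * a) +
        Pi.single 0 (-Complex.I * ρ * Complex.exp (-χ * Complex.I) * w + Complex.I * g * a) := by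
  have h01 : (0 : Fin (n + 2)) ≠ Fin.last (n + 1) := by simp [Fin.ext_iff]
  set ω := Real.arccos ρ with hω
  have hcos : ∀ χ : ℂ, Complex.exp ((χ + ω) * Complex.I) + Complex.exp ((χ - ω) * Complex.I) =
      2 * ρ * Complex.exp (χ * Complex.I) := by
    intro χ
    have h : (ρ : ℂ) = (Complex.exp (ω * Complex.I) + Complex.exp (-ω * Complex.I)) / 2 := by
      rw [← Complex.cos, ← Complex.ofReal_cos, hω, Real.cos_arccos hρ hρ']
    rw [h, add_mul, sub_mul, Complex.exp_add, sub_eq_add_neg, Complex.exp_add, ← neg_mul]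
    ring
  have hc1 := hcos χ
  have hc2 : Complex.exp (-(χ + ω) * Complex.I) + Complex.exp (-(χ - ω) * Complex.I) =
      2 * ρ * Complex.exp (-χ * Complex.I) := by
    rw [← hcos (-χ), add_comm]
    congr 2 <;> ring
  have hpi : Complex.exp ((Real.pi : ℝ) * Complex.I) = -1 := Complex.exp_pi_mul_I
  have hpi' : Complex.exp (-(Real.pi : ℝ) * Complex.I) = -1 := by
    rw [neg_mul, Complex.exp_neg, hpi]; norm_num
  have hd : (Matrix.diagonal (Pi.single 0 (Complex.I * (g : ℂ))) :
      Matrix (Fin (n + 2)) (Fin (n + 2)) ℂ).mulVec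
        (Pi.single 0 a + Pi.single (Fin.last (n + 1)) d + b) =
      Pi.single 0 (Complex.I * g * a) := by
    ext l
    rw [Matrix.mulVec_diagonal]
    by_cases hl : l = 0
    · subst hl; simp [hb.zero, h01]
    · simp [hl]
  rw [driveGen, Matrix.add_mulVec, Matrix.add_mulVec, Matrix.smul_mulVec, Matrix.smul_mulVec,
    hopPhase_mulVec hn hb, hopPhase_mulVec hn hb, hd]
  ext l
  push_cast
  rw [hpi, hpi']
  simp only [Pi.add_apply, Pi.smul_apply, smul_eq_mul, Pi.single_apply, neg_zero, zero_mul,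
    Complex.exp_zero]
  rw [← hω]
  by_cases h0 : l = 0
  · by_cases h1 : l = 1
    · exact absurd (h0.symm.trans h1) zero_ne_one_fin
    · simp only [h0, if_true, zero_ne_one_fin, if_false, h01]
      split_ifs
      · linear_combination (-(Complex.I / 2) * w) * hc2
      · linear_combination (-(Complex.I / 2) * w) * hc2
  · simp only [h0, if_false]
    split_ifs
    all_goals first
      | linear_combination (-(Complex.I / 2) * a) * hc1
      | ring

end Drive

/-! ### Reverse-engineered driving of one mode -/

section DriveMode

variable {n : ℕ}

/-- The coefficient of the `k`-th mode, in the interaction picture, when the mode `k₀` is populated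
with the amplitude `β` and then driven with the strength `κ`. -/
def driveCoeff (n k₀ : ℕ) (G : ℝ → ℝ → ℂ) (β κ : ℝ) (k : ℕ) (t : ℝ) : ℂ :=
  (if k = k₀ then (β : ℂ) else 0) + κ * modeAmp n k 1 * G (modeE n k - modeE n k₀) t

/-- The population of the interior of the driven chain. -/
def drivePop (n k₀ : ℕ) (G : ℝ → ℝ → ℂ) (β κ : ℝ) (t : ℝ) : ℝ :=
  ∑ k ∈ Finset.Icc 1 n, ‖driveCoeff n k₀ G β κ k t‖ ^ 2

/-- The state of the interior of the driven chain. -/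
def driveBulk (n k₀ : ℕ) (G : ℝ → ℝ → ℂ) (β κ : ℝ) (t : ℝ) : Fin (n + 2) → ℂ :=
  ∑ k ∈ Finset.Icc 1 n,
    (driveCoeff n k₀ G β κ k t * Complex.exp (-(modeE n k * t * Complex.I))) • mode n k

/-- The state of the driven chain, with the total population `r` of the first site and the interior,
and the amplitude `d` on the last site. -/
def driveState (n k₀ : ℕ) (G : ℝ → ℝ → ℂ) (β κ r : ℝ) (d : ℂ) (t : ℝ) : Fin (n + 2) → ℂ :=
  Pi.single 0 ((√(r - drivePop n k₀ G β κ t) : ℝ) : ℂ) + Pi.single (Fin.last (n + 1)) d +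
    driveBulk n k₀ G β κ t

variable {k₀ : ℕ} {f : ℝ → ℝ} {G : ℝ → ℝ → ℂ} {β κ : ℝ}

lemma interiorImage_sum_mode (c : ℕ → ℂ) :
    InteriorImage (n := n) (∑ k ∈ Finset.Icc 1 n, c k • mode n k)
      (∑ k ∈ Finset.Icc 1 n, (c k * modeE n k) • mode n k)
      (∑ k ∈ Finset.Icc 1 n, c k * modeAmp n k 1) (∑ k ∈ Finset.Icc 1 n, c k * modeAmp n k n) where
  zero := by simp [Finset.sum_apply, mode_zero]
  last := by simp [Finset.sum_apply, mode_last]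
  image_zero := by simp [Finset.sum_apply, mode_zero]
  image_last := by simp [Finset.sum_apply, mode_last]
  hop_eq := by
    have hsum : ∀ (i : Fin (n + 2)) (d : ℕ → ℂ), (Pi.single i (∑ k ∈ Finset.Icc 1 n, d k) :
        Fin (n + 2) → ℂ) = ∑ k ∈ Finset.Icc 1 n, Pi.single i (d k) := by
      intro i d
      ext l
      by_cases hl : l = i
      · subst hl; simp [Finset.sum_apply]
      · simp [Finset.sum_apply, hl]
    rw [Matrix.mulVec_sum, hsum, hsum, ← Finset.sum_add_distrib, ← Finset.sum_add_distrib]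
    refine Finset.sum_congr rfl fun k _ => ?_
    rw [Matrix.mulVec_smul, hop_mulVec_mode, smul_add, smul_add, smul_smul, ← Pi.single_smul,
      ← Pi.single_smul, smul_eq_mul, smul_eq_mul]

lemma hasDerivAt_driveCoeff
    (hG : ∀ Δ t, HasDerivAt (G Δ) (f t * Complex.exp (Δ * t * Complex.I)) t) (k : ℕ) (t : ℝ) :
    HasDerivAt (driveCoeff n k₀ G β κ k) (κ * modeAmp n k 1 * (f t *
      Complex.exp ((modeE n k - modeE n k₀ : ℝ) * t * Complex.I))) t :=
  ((hG _ t).const_mul _).const_add _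

/-- The amplitude on the first site of the interior, in the frame of the mode `k₀`. -/
def driveEdge (n k₀ : ℕ) (G : ℝ → ℝ → ℂ) (β κ : ℝ) (t : ℝ) : ℂ :=
  Complex.exp (modeE n k₀ * t * Complex.I) * ∑ k ∈ Finset.Icc 1 n,
    driveCoeff n k₀ G β κ k t * Complex.exp (-(modeE n k * t * Complex.I)) * modeAmp n k 1

/-- All modes are fed through the first interior site, so the sum of 2 Re(c̄_k c_k') depends on the
state only through the amplitude there. -/
lemma hasDerivAt_drivePop
    (hG : ∀ Δ t, HasDerivAt (G Δ) (f t * Complex.exp (Δ * t * Complex.I)) t) (t : ℝ) :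
    HasDerivAt (drivePop n k₀ G β κ) (2 * κ * f t * (driveEdge n k₀ G β κ t).re) t := by
  have h := HasDerivAt.fun_sum (u := Finset.Icc 1 n) fun k _ =>
    (hasDerivAt_driveCoeff (n := n) (k₀ := k₀) (β := β) (κ := κ) hG k t).norm_sq
  refine h.congr_deriv ?_
  rw [driveEdge, Finset.mul_sum, Complex.re_sum, Finset.mul_sum]
  refine Finset.sum_congr rfl fun k _ => ?_
  rw [Complex.inner]
  set c := driveCoeff n k₀ G β κ k t
  have e1 : Complex.exp (modeE n k₀ * t * Complex.I) *
      (c * Complex.exp (-(modeE n k * t * Complex.I)) * modeAmp n k 1) =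
      starRingEnd ℂ (modeAmp n k 1 * (starRingEnd ℂ c *
        Complex.exp ((modeE n k - modeE n k₀ : ℝ) * t * Complex.I))) := by
    rw [map_mul, map_mul, Complex.conj_conj, ← Complex.exp_conj, map_mul, map_mul, Complex.conj_I,
      Complex.conj_ofReal, Complex.conj_ofReal, Complex.conj_ofReal, mul_comm (modeAmp n k 1 : ℂ),
      ← mul_assoc, mul_left_comm, ← Complex.exp_add]
    congr 3
    push_cast
    ring
  rw [e1, Complex.conj_re, Complex.re_ofReal_mul]
  have e2 : κ * modeAmp n k 1 * (f t *
      Complex.exp ((modeE n k - modeE n k₀ : ℝ) * t * Complex.I)) * starRingEnd ℂ c =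
      ((κ * modeAmp n k 1 * f t : ℝ) : ℂ) * (starRingEnd ℂ c *
        Complex.exp ((modeE n k - modeE n k₀ : ℝ) * t * Complex.I)) := by
    push_cast
    ring
  rw [e2, Complex.re_ofReal_mul]
  ring

/-- Reverse engineering. The interior follows a prescribed curve, and norm conservation gives the
first site the amplitude a = √(r − population). The coupling ρ = κf/a then provides the source that
the curve needs, and the field g cancels the imaginary part of the back-action, so a stays real; the
real part of the back-action is a'. The hypotheses say that a > 0 and |ρ| ≤ 1 after time 0. -/
lemma reach_driveState (hn : 1 ≤ n) (hf : Continuous f)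
    (hG : ∀ Δ t, HasDerivAt (G Δ) (f t * Complex.exp (Δ * t * Complex.I)) t) {T : ℝ} (hT : 0 < T)
    {r : ℝ} (d : ℂ) (hpos : ∀ t ∈ Set.Ioc 0 T, 0 < r - drivePop n k₀ G β κ t)
    (hle : ∀ t ∈ Set.Ioc 0 T, (κ * f t) ^ 2 ≤ r - drivePop n k₀ G β κ t) :
    Reach T (driveState n k₀ G β κ r d 0) (driveState n k₀ G β κ r d T) := by
  have hGc : ∀ Δ, Continuous (G Δ) := fun Δ =>
    continuous_iff_continuousAt.2 fun t => (hG Δ t).continuousAt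
  have hcc : ∀ k, Continuous (driveCoeff n k₀ G β κ k) := fun k =>
    continuous_iff_continuousAt.2 fun t => (hasDerivAt_driveCoeff hG k t).continuousAt
  have hpc : Continuous (drivePop n k₀ G β κ) :=
    continuous_iff_continuousAt.2 fun t => (hasDerivAt_drivePop hG t).continuousAt
  have hwc : Continuous (driveEdge n k₀ G β κ) := by
    unfold driveEdge
    fun_prop
  set a : ℝ → ℝ := fun t => √(r - drivePop n k₀ G β κ t) with ha
  have hac : Continuous a := by fun_prop
  have hsingle : ∀ z : ℂ, (Pi.single 0 z : Fin (n + 2) → ℂ) = z • Pi.single 0 1 := fun z => by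
    rw [← Pi.single_smul, smul_eq_mul, mul_one]
  have hsc : Continuous fun z : ℂ => (Pi.single 0 z : Fin (n + 2) → ℂ) := by
    rw [show (fun z : ℂ => (Pi.single 0 z : Fin (n + 2) → ℂ)) = fun z => z • Pi.single 0 1 from
      funext hsingle]
    fun_prop
  have hxc : Continuous (driveState n k₀ G β κ r d) := by
    unfold driveState driveBulk
    refine ((hsc.comp (Complex.continuous_ofReal.comp hac)).add continuous_const).add ?_
    fun_prop
  set a' : ℝ → ℝ := fun t => -(κ * f t * (driveEdge n k₀ G β κ t).re / a t) with ha'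
  set y : ℝ → Fin (n + 2) → ℂ := fun t => Pi.single 0 ((a' t : ℝ) : ℂ) + ∑ k ∈ Finset.Icc 1 n,
    ((κ * modeAmp n k 1 * (f t * Complex.exp ((modeE n k - modeE n k₀ : ℝ) * t * Complex.I))) *
        Complex.exp (-(modeE n k * t * Complex.I)) +
      driveCoeff n k₀ G β κ k t * (Complex.exp (-(modeE n k * t * Complex.I)) *
        (-(modeE n k * Complex.I)))) • mode n k with hy
  have hapos : ∀ t ∈ Set.Ioc 0 T, 0 < a t := fun t ht => Real.sqrt_pos.2 (hpos t ht)
  have hderiv : ∀ t ∈ Set.Ioc 0 T, HasDerivAt (driveState n k₀ G β κ r d) (y t) t := by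
    intro t ht
    have h1 : HasDerivAt a (a' t) t := by
      have := ((hasDerivAt_drivePop (n := n) (k₀ := k₀) (β := β) (κ := κ) hG t).const_sub r).sqrt
        (hpos t ht).ne'
      refine this.congr_deriv ?_
      have := (hapos t ht).ne'
      rw [ha', ha] at *
      field_simp
    have h2 : HasDerivAt (fun t : ℝ => (Pi.single 0 ((a t : ℝ) : ℂ) : Fin (n + 2) → ℂ))
        (Pi.single 0 ((a' t : ℝ) : ℂ)) t := by
      rw [hsingle (a' t), show (fun t : ℝ => (Pi.single 0 ((a t : ℝ) : ℂ) : Fin (n + 2) → ℂ)) =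
        fun t => ((a t : ℝ) : ℂ) • Pi.single 0 1 from funext fun t => hsingle _]
      exact h1.ofReal_comp.smul_const _
    have h3 : HasDerivAt (driveBulk n k₀ G β κ) (∑ k ∈ Finset.Icc 1 n,
        ((κ * modeAmp n k 1 * (f t * Complex.exp ((modeE n k - modeE n k₀ : ℝ) * t * Complex.I))) *
            Complex.exp (-(modeE n k * t * Complex.I)) +
          driveCoeff n k₀ G β κ k t * (Complex.exp (-(modeE n k * t * Complex.I)) *
            (-(modeE n k * Complex.I)))) • mode n k) t := by
      refine HasDerivAt.fun_sum fun k _ => HasDerivAt.smul_const (HasDerivAt.mul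
        (hasDerivAt_driveCoeff hG k t) ?_) _
      have : HasDerivAt (fun t : ℝ => (modeE n k : ℂ) * (t : ℂ) * Complex.I)
          (modeE n k * Complex.I) t := by
        have h := ((hasDerivAt_id t).ofReal_comp.const_mul (modeE n k : ℂ)).mul_const Complex.I
        simpa using h
      exact this.fun_neg.cexp
    exact (h2.add_const _).add h3
  -- The first site may be empty at time 0, where the controls ρ and g are singular. The drive
  -- therefore starts at a small t₀ > 0, from a vector close to the initial one.
  refine reach_of_forall_near fun η hη => ?_
  have hnc : Continuous fun t => nrm (driveState n k₀ G β κ r d 0 - driveState n k₀ G β κ r d t) := by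
    unfold nrm
    exact ((PiLp.continuous_toLp 2 _).comp (continuous_const.sub hxc)).norm
  have hnear := Metric.continuous_iff.1 hnc 0 η hη
  obtain ⟨ε, hε, hnear⟩ := hnear
  set t₀ : ℝ := min (ε / 2) T with ht₀
  have ht₀0 : 0 < t₀ := lt_min (by linarith) hT
  have ht₀T : t₀ ≤ T := min_le_right _ _
  refine ⟨driveState n k₀ G β κ r d t₀, ?_, ?_⟩
  · have := hnear t₀ (by
      rw [Real.dist_eq, sub_zero, abs_of_pos ht₀0]
      linarith [min_le_left (ε / 2) T])
    rw [sub_self, nrm_zero, Real.dist_eq, sub_zero, abs_of_nonneg (nrm_nonneg _)] at this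
    exact this.le
  have hsub : Set.Icc t₀ T ⊆ Set.Ioc 0 T := fun t ht => ⟨ht₀0.trans_le ht.1, ht.2⟩
  set ρ : ℝ → ℝ := fun t => κ * f t / a t with hρ
  set g : ℝ → ℝ := fun t => ρ t * (driveEdge n k₀ G β κ t).im / a t with hg
  have hne : ∀ t ∈ Set.Icc t₀ T, a t ≠ 0 := fun t ht => (hapos t (hsub ht)).ne'
  have hgc : ContinuousOn g (Set.Icc t₀ T) := by
    refine ContinuousOn.div (ContinuousOn.mul (ContinuousOn.div ?_ hac.continuousOn hne) ?_)
      hac.continuousOn hne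
    · fun_prop
    · exact (Complex.continuous_im.comp hwc).continuousOn
  obtain ⟨B, hB⟩ := isCompact_Icc.exists_bound_of_continuousOn hgc
  have hgen := generates_driveGen (n := n) (s := Set.Icc t₀ T)
    (fun t => Real.pi / 2 - modeE n k₀ * t) ρ (g := g) (B := B) hB
  have hr := hgen.reach ht₀T (x := driveState n k₀ G β κ r d) (y := y)
    (fun t ht => hderiv t (hsub ht)) ?_ ?_
  · exact hr.mono (by linarith)
  · rw [hy]
    have hca : ContinuousOn a' (Set.Icc t₀ T) := by
      refine (ContinuousOn.div ?_ hac.continuousOn hne).neg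
      exact (((continuous_const.mul hf)).mul (Complex.continuous_re.comp hwc)).continuousOn
    refine ContinuousOn.add ?_ (Continuous.continuousOn ?_)
    · exact hsc.comp_continuousOn (Complex.continuous_ofReal.comp_continuousOn hca)
    · fun_prop
  · intro t ht
    have hat : 0 < a t := hapos t (hsub ht)
    have hρ1 : |ρ t| ≤ 1 := by
      rw [hρ]
      simp only
      rw [abs_div, abs_of_pos hat, div_le_one hat]
      exact Real.abs_le_sqrt (hle t (hsub ht))
    have h := driveGen_mulVec hn (interiorImage_sum_mode (n := n) fun k =>
      driveCoeff n k₀ G β κ k t * Complex.exp (-(modeE n k * t * Complex.I)))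
      (χ := Real.pi / 2 - modeE n k₀ * t) (g t) (a t : ℂ) d (neg_le_of_abs_le hρ1)
      (le_of_abs_le hρ1)
    -- The angle −E t makes the source resonant with the mode k₀; the shift π/2 compensates the
    -- factor −i of the Schrödinger equation.
    have e1 : Complex.exp ((Real.pi / 2 - modeE n k₀ * t : ℝ) * Complex.I) =
        Complex.I * Complex.exp (-(modeE n k₀ * t * Complex.I)) := by
      rw [show ((Real.pi / 2 - modeE n k₀ * t : ℝ) : ℂ) * Complex.I =
        Real.pi / 2 * Complex.I + -(modeE n k₀ * t * Complex.I) by push_cast; ring,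
        Complex.exp_add, Complex.exp_pi_div_two_mul_I]
    have e2 : Complex.exp (-(Real.pi / 2 - modeE n k₀ * t : ℝ) * Complex.I) =
        -Complex.I * Complex.exp (modeE n k₀ * t * Complex.I) := by
      rw [show -((Real.pi / 2 - modeE n k₀ * t : ℝ) : ℂ) * Complex.I =
        -Real.pi / 2 * Complex.I + modeE n k₀ * t * Complex.I by push_cast; ring,
        Complex.exp_add, Complex.exp_neg_pi_div_two_mul_I]
    rw [e1, e2] at h
    refine h.trans ?_
    have hat' : (a t : ℂ) ≠ 0 := by exact_mod_cast hat.ne'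
    have c1 : -Complex.I * (ρ t : ℂ) * (Complex.I * Complex.exp (-(modeE n k₀ * t * Complex.I))) *
        (a t : ℂ) = κ * f t * Complex.exp (-(modeE n k₀ * t * Complex.I)) := by
      have hρa : (ρ t : ℂ) * (a t : ℂ) = κ * f t := by
        rw [hρ]
        push_cast
        field_simp
      linear_combination (-Complex.I ^ 2 * Complex.exp (-(modeE n k₀ * t * Complex.I))) * hρa -
        (κ * f t * Complex.exp (-(modeE n k₀ * t * Complex.I))) * Complex.I_sq
    have c2 : -Complex.I * (ρ t : ℂ) * (-Complex.I * Complex.exp (modeE n k₀ * t * Complex.I)) *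
        (∑ k ∈ Finset.Icc 1 n, driveCoeff n k₀ G β κ k t *
          Complex.exp (-(modeE n k * t * Complex.I)) * modeAmp n k 1) +
        Complex.I * (g t : ℂ) * (a t : ℂ) = ((a' t : ℝ) : ℂ) := by
      have hw : Complex.exp (modeE n k₀ * t * Complex.I) * (∑ k ∈ Finset.Icc 1 n,
          driveCoeff n k₀ G β κ k t * Complex.exp (-(modeE n k * t * Complex.I)) *
            modeAmp n k 1) = driveEdge n k₀ G β κ t := rfl
      have hwri := Complex.re_add_im (driveEdge n k₀ G β κ t)
      have hga : (g t : ℂ) * (a t : ℂ) = ρ t * (driveEdge n k₀ G β κ t).im := by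
        rw [hg]
        push_cast
        field_simp
      have ha'ρ : ((a' t : ℝ) : ℂ) = -(ρ t * (driveEdge n k₀ G β κ t).re) := by
        rw [ha', hρ]
        push_cast
        ring
      rw [ha'ρ]
      linear_combination (ρ t : ℂ) * Complex.I ^ 2 * hw + Complex.I * hga -
        (ρ t : ℂ) * Complex.I ^ 2 * hwri +
        (ρ t : ℂ) * (driveEdge n k₀ G β κ t).re * Complex.I_sq +
        (ρ t : ℂ) * (driveEdge n k₀ G β κ t).im * Complex.I * Complex.I_sq
    rw [c1, c2, hy]
    -- Expanding the source over the modes gives each coefficient exactly its prescribed derivative.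
    have hone : (Pi.single 1 (κ * f t * Complex.exp (-(modeE n k₀ * t * Complex.I))) :
        Fin (n + 2) → ℂ) = ∑ k ∈ Finset.Icc 1 n,
          (κ * f t * Complex.exp (-(modeE n k₀ * t * Complex.I)) * modeAmp n k 1) • mode n k := by
      have := sum_modeAmp_one_smul_mode hn
      simp_rw [mul_smul _ ((modeAmp n _ 1 : ℝ) : ℂ)]
      rw [← Finset.smul_sum, this, ← Pi.single_smul, smul_eq_mul, mul_one]
    rw [hone, Finset.smul_sum, ← Finset.sum_add_distrib]
    refine (add_comm _ _).trans ?_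
    congr 1
    refine Finset.sum_congr rfl fun k _ => ?_
    rw [smul_smul, ← add_smul]
    congr 1
    have e3 : Complex.exp (-(modeE n k₀ * t * Complex.I)) =
        Complex.exp ((modeE n k - modeE n k₀ : ℝ) * t * Complex.I) *
          Complex.exp (-(modeE n k * t * Complex.I)) := by
      rw [← Complex.exp_add]
      congr 1
      push_cast
      ring
    rw [e3]
    ring

end DriveMode

/-! ### Pulses -/

/-- A normalized pulse `f`, with the width `L`, supported on `[0, T]`; `F` is its primitive
and `G Δ` the primitive of its modulation by the frequency `Δ`. -/
structure IsPulse (L T : ℝ) (f F : ℝ → ℝ) (G : ℝ → ℝ → ℂ) : Prop where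
  continuous : Continuous f
  hasDerivAt : ∀ Δ t, HasDerivAt (G Δ) (f t * Complex.exp (Δ * t * Complex.I)) t
  of_nonpos : ∀ Δ t, t ≤ 0 → G Δ t = 0
  of_le : ∀ Δ t, T ≤ t → G Δ t = G Δ T
  zero_eq : ∀ t, G 0 t = F t
  nonneg : ∀ t, 0 ≤ F t
  pos : ∀ t, 0 < t → 0 < F t
  le_one : ∀ t, F t ≤ 1
  last : F T = 1
  sq_le : ∀ t, f t ^ 2 ≤ 36 * F t / L ^ 2
  norm_sq_le : ∀ Δ t, Δ ^ 2 * ‖G Δ t‖ ^ 2 ≤ 144 * F t / L ^ 2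

/-- The average of a modulated primitive with its delayed copy. -/
def delayAvg (G : ℝ → ℝ → ℂ) (τ : ℝ) (Δ t : ℝ) : ℂ :=
  (G Δ t + Complex.exp (Δ * τ * Complex.I) * G Δ (t - τ)) / 2

lemma norm_half_add_sq_le (a b : ℂ) : ‖(a + b) / 2‖ ^ 2 ≤ (‖a‖ ^ 2 + ‖b‖ ^ 2) / 2 := by
  rw [norm_div, Complex.norm_ofNat]
  have h := norm_add_le a b
  have := norm_nonneg (a + b)
  nlinarith [sq_nonneg (‖a‖ - ‖b‖)]

lemma norm_exp_mul_I (x y : ℝ) : ‖Complex.exp (x * y * Complex.I)‖ = 1 := by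
  rw [← Complex.ofReal_mul, Complex.norm_exp_ofReal_mul_I]

/-- The bounded quantities are convex quadratic and their bounds are linear in F, so averaging with
a delayed copy keeps them; the phase on the delayed copy has modulus one. -/
lemma IsPulse.delayAvg {L T : ℝ} {f F : ℝ → ℝ} {G : ℝ → ℝ → ℂ} (h : IsPulse L T f F G) {τ : ℝ}
    (hτ : 0 ≤ τ) :
    IsPulse L (T + τ) (fun t => (f t + f (t - τ)) / 2) (fun t => (F t + F (t - τ)) / 2)
      (delayAvg G τ) where
  continuous := by
    have := h.continuous
    fun_prop
  hasDerivAt Δ t := by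
    have h2 : HasDerivAt (fun t => G Δ (t - τ)) (f (t - τ) *
        Complex.exp (Δ * (t - τ : ℝ) * Complex.I)) t := (h.hasDerivAt Δ (t - τ)).comp_sub_const t τ
    refine (((h.hasDerivAt Δ t).add (h2.const_mul _)).div_const 2).congr_deriv ?_
    have e : Complex.exp (Δ * t * Complex.I) = Complex.exp (Δ * τ * Complex.I) *
        Complex.exp (Δ * (t - τ : ℝ) * Complex.I) := by
      rw [← Complex.exp_add]
      congr 1
      push_cast
      ring
    rw [e]
    push_cast
    ring
  of_nonpos Δ t ht := by
    rw [UQI.delayAvg, h.of_nonpos Δ t ht, h.of_nonpos Δ (t - τ) (by linarith)]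
    simp
  of_le Δ t ht := by
    rw [UQI.delayAvg, UQI.delayAvg, h.of_le Δ t (by linarith), h.of_le Δ (t - τ) (by linarith),
      h.of_le Δ (T + τ) (by linarith), add_sub_cancel_right]
  zero_eq t := by
    rw [UQI.delayAvg, h.zero_eq, h.zero_eq]
    simp
  nonneg t := by linarith [h.nonneg t, h.nonneg (t - τ)]
  pos t ht := by linarith [h.pos t ht, h.nonneg (t - τ)]
  le_one t := by linarith [h.le_one t, h.le_one (t - τ)]
  last := by
    have h1 : F (T + τ) = F T := by
      have := h.of_le 0 (T + τ) (by linarith)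
      rw [h.zero_eq, h.zero_eq] at this
      exact_mod_cast this
    rw [add_sub_cancel_right, h1, h.last]
    norm_num
  sq_le t := by
    have h1 := h.sq_le t
    have h2 := h.sq_le (t - τ)
    have e : 36 * ((F t + F (t - τ)) / 2) / L ^ 2 =
        (36 * F t / L ^ 2 + 36 * F (t - τ) / L ^ 2) / 2 := by ring
    rw [e]
    nlinarith [sq_nonneg (f t - f (t - τ))]
  norm_sq_le Δ t := by
    have h1 := h.norm_sq_le Δ t
    have h2 := h.norm_sq_le Δ (t - τ)
    have e : 144 * ((F t + F (t - τ)) / 2) / L ^ 2 =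
        (144 * F t / L ^ 2 + 144 * F (t - τ) / L ^ 2) / 2 := by ring
    have h3 := norm_half_add_sq_le (G Δ t) (Complex.exp (Δ * τ * Complex.I) * G Δ (t - τ))
    rw [norm_mul, norm_exp_mul_I, one_mul] at h3
    rw [e, UQI.delayAvg]
    have h4 := mul_le_mul_of_nonneg_left h3 (sq_nonneg Δ)
    linarith

/-- The averaging multiplies the final component at the frequency Δ by (1 + e^{iΔτ})/2. This is zero
for τ = π/|Δ|, and components that already vanish keep vanishing. -/
lemma IsPulse.delayAvg_last {L T : ℝ} {f F : ℝ → ℝ} {G : ℝ → ℝ → ℂ} (h : IsPulse L T f F G)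
    {τ : ℝ} (hτ : 0 ≤ τ) (Δ : ℝ) :
    UQI.delayAvg G τ Δ (T + τ) = (1 + Complex.exp (Δ * τ * Complex.I)) / 2 * G Δ T := by
  rw [UQI.delayAvg, h.of_le Δ (T + τ) (by linarith), add_sub_cancel_right]
  ring

lemma one_add_exp_pi_div_abs {Δ : ℝ} (hΔ : Δ ≠ 0) :
    1 + Complex.exp (Δ * (Real.pi / |Δ| : ℝ) * Complex.I) = 0 := by
  rcases lt_or_gt_of_ne hΔ with h | h
  · rw [abs_of_neg h]
    have : (Δ : ℂ) * (Real.pi / -Δ : ℝ) * Complex.I = -(Real.pi * Complex.I) := by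
      have : (Δ : ℂ) ≠ 0 := by exact_mod_cast hΔ
      push_cast
      field_simp
    rw [this, Complex.exp_neg, Complex.exp_pi_mul_I]
    norm_num
  · rw [abs_of_pos h]
    have : (Δ : ℂ) * (Real.pi / Δ : ℝ) * Complex.I = Real.pi * Complex.I := by
      have : (Δ : ℂ) ≠ 0 := by exact_mod_cast hΔ
      push_cast
      field_simp
    rw [this, Complex.exp_pi_mul_I]
    norm_num

/-- A pulse may be prolonged so as to have no component at given frequencies. -/
lemma IsPulse.exists_orthogonal {ι : Type*} [DecidableEq ι] {L T : ℝ} {f F : ℝ → ℝ}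
    {G : ℝ → ℝ → ℂ} (h : IsPulse L T f F G) (s : Finset ι) (Δ : ι → ℝ) (hΔ : ∀ k ∈ s, Δ k ≠ 0) :
    ∃ f' F' G', IsPulse L (T + ∑ k ∈ s, Real.pi / |Δ k|) f' F' G' ∧
      ∀ k ∈ s, G' (Δ k) (T + ∑ k ∈ s, Real.pi / |Δ k|) = 0 := by
  induction s using Finset.induction_on with
  | empty => exact ⟨f, F, G, by simpa using h, by simp⟩
  | insert a s ha ih =>
    obtain ⟨f', F', G', hp, hz⟩ := ih fun k hk => hΔ k (Finset.mem_insert_of_mem hk)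
    have hτ : 0 ≤ Real.pi / |Δ a| := div_nonneg Real.pi_pos.le (abs_nonneg _)
    have e : T + ∑ k ∈ insert a s, Real.pi / |Δ k| =
        T + ∑ k ∈ s, Real.pi / |Δ k| + Real.pi / |Δ a| := by
      rw [Finset.sum_insert ha]; ring
    rw [e]
    refine ⟨_, _, _, hp.delayAvg hτ, fun k hk => ?_⟩
    rw [hp.delayAvg_last hτ]
    rcases Finset.mem_insert.1 hk with rfl | hk
    · rw [one_add_exp_pi_div_abs (hΔ k (Finset.mem_insert_self _ _)), zero_div, zero_mul]
    · rw [hz k hk, mul_zero]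

/-- The parabolic pulse. -/
def parabola (L t : ℝ) : ℝ := 6 * max (t * (L - t)) 0 / L ^ 3

/-- The modulated primitive of the parabolic pulse. -/
def parabolaInt (L Δ t : ℝ) : ℂ :=
  ∫ s in (0 : ℝ)..t, (parabola L s : ℂ) * Complex.exp (Δ * s * Complex.I)

lemma continuous_parabola (L : ℝ) : Continuous (parabola L) := by
  unfold parabola
  fun_prop

lemma parabola_of_mem {L t : ℝ} (h0 : 0 ≤ t) (h1 : t ≤ L) :
    parabola L t = 6 * (t * (L - t)) / L ^ 3 := by
  rw [parabola, max_eq_left (mul_nonneg h0 (by linarith))]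

lemma parabola_of_nonpos {L t : ℝ} (hL : 0 < L) (h : t ≤ 0) : parabola L t = 0 := by
  rw [parabola, max_eq_right (mul_nonpos_of_nonpos_of_nonneg h (by linarith)), mul_zero, zero_div]

lemma parabola_of_ge {L t : ℝ} (hL : 0 < L) (h : L ≤ t) : parabola L t = 0 := by
  rw [parabola, max_eq_right (mul_nonpos_of_nonneg_of_nonpos (by linarith) (by linarith)),
    mul_zero, zero_div]

lemma hasDerivAt_parabolaInt (L Δ t : ℝ) :
    HasDerivAt (parabolaInt L Δ) (parabola L t * Complex.exp (Δ * t * Complex.I)) t := by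
  have hc : Continuous fun s : ℝ => (parabola L s : ℂ) * Complex.exp (Δ * s * Complex.I) := by
    have := continuous_parabola L
    fun_prop
  exact (hc.integral_hasStrictDerivAt 0 t).hasDerivAt

lemma parabolaInt_of_nonpos {L : ℝ} (hL : 0 < L) (Δ : ℝ) {t : ℝ} (ht : t ≤ 0) :
    parabolaInt L Δ t = 0 := by
  rw [parabolaInt]
  refine (intervalIntegral.integral_congr (g := fun _ => 0) fun s hs => ?_).trans
    intervalIntegral.integral_zero
  rw [Set.uIcc_of_ge ht] at hs
  simp [parabola_of_nonpos hL hs.2]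

lemma parabolaInt_of_ge {L : ℝ} (hL : 0 < L) (Δ : ℝ) {t : ℝ} (ht : L ≤ t) :
    parabolaInt L Δ t = parabolaInt L Δ L := by
  have hc : Continuous fun s : ℝ => (parabola L s : ℂ) * Complex.exp (Δ * s * Complex.I) := by
    have := continuous_parabola L
    fun_prop
  rw [parabolaInt, parabolaInt, ← sub_eq_zero, intervalIntegral.integral_interval_sub_left
    (hc.intervalIntegrable _ _) (hc.intervalIntegrable _ _)]
  refine (intervalIntegral.integral_congr (g := fun _ => 0) fun s hs => ?_).trans
    intervalIntegral.integral_zero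
  rw [Set.uIcc_of_le ht] at hs
  simp [parabola_of_ge hL hs.1]

lemma parabolaInt_zero_of_mem {L : ℝ} (hL : 0 < L) {t : ℝ} (h0 : 0 ≤ t) (h1 : t ≤ L) :
    parabolaInt L 0 t = ((3 * (t / L) ^ 2 - 2 * (t / L) ^ 3 : ℝ) : ℂ) := by
  have e1 : parabolaInt L 0 t = ∫ s in (0 : ℝ)..t, ((6 * (s * (L - s)) / L ^ 3 : ℝ) : ℂ) := by
    refine intervalIntegral.integral_congr fun s hs => ?_
    rw [Set.uIcc_of_le h0] at hs
    simp [parabola_of_mem hs.1 (hs.2.trans h1)]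
  rw [e1, intervalIntegral.integral_ofReal]
  congr 1
  have hd : ∀ s ∈ Set.uIcc 0 t, HasDerivAt (fun s => 3 * (s / L) ^ 2 - 2 * (s / L) ^ 3)
      (6 * (s * (L - s)) / L ^ 3) s := by
    intro s _
    have h1 : HasDerivAt (fun s : ℝ => s / L) (1 / L) s := (hasDerivAt_id s).div_const L
    refine (((h1.pow 2).const_mul 3).sub ((h1.pow 3).const_mul 2)).congr_deriv ?_
    push_cast
    field_simp
    ring
  rw [intervalIntegral.integral_eq_sub_of_hasDerivAt hd
    (Continuous.intervalIntegrable (by fun_prop) _ _)]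
  simp

/-- Integration by parts: iΔG − p e^{iΔt} vanishes at 0 and its derivative has modulus |p'| ≤ 6/L²,
while p(t) ≤ 6t/L². -/
lemma norm_mul_parabolaInt_le {L : ℝ} (hL : 0 < L) (Δ : ℝ) {t : ℝ} (h0 : 0 ≤ t) (h1 : t ≤ L) :
    |Δ| * ‖parabolaInt L Δ t‖ ≤ 12 * (t / L) / L := by
  set p : ℝ → ℝ := fun s => 6 * (s * (L - s)) / L ^ 3 with hp
  set D : ℝ → ℂ := fun s => Δ * Complex.I * parabolaInt L Δ s -
    p s * Complex.exp (Δ * s * Complex.I) with hD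
  have hdp : ∀ s, HasDerivAt p (6 * (L - 2 * s) / L ^ 3) s := by
    intro s
    have : HasDerivAt (fun s : ℝ => s * (L - s)) (1 * (L - s) + s * -1) s :=
      (hasDerivAt_id s).mul ((hasDerivAt_id s).const_sub L)
    refine ((this.const_mul 6).div_const (L ^ 3)).congr_deriv ?_
    ring
  have hde : ∀ s : ℝ, HasDerivAt (fun s : ℝ => Complex.exp (Δ * s * Complex.I))
      (Complex.exp (Δ * s * Complex.I) * (Δ * Complex.I)) s := by
    intro s
    have h := (((hasDerivAt_id s).ofReal_comp.const_mul (Δ : ℂ)).mul_const Complex.I).cexp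
    simpa using h
  have hdD : ∀ s ∈ Set.Icc 0 t, HasDerivWithinAt D
      (-(((6 * (L - 2 * s) / L ^ 3 : ℝ) : ℂ) * Complex.exp (Δ * s * Complex.I)))
      (Set.Icc 0 t) s := by
    intro s hs
    have h := (((hasDerivAt_parabolaInt L Δ s).const_mul (Δ * Complex.I)).sub
      ((hdp s).ofReal_comp.mul (hde s)))
    refine (h.congr_deriv ?_).hasDerivWithinAt
    rw [parabola_of_mem hs.1 (hs.2.trans h1), hp]
    ring
  have hbound : ∀ s ∈ Set.Ico 0 t,
      ‖-(((6 * (L - 2 * s) / L ^ 3 : ℝ) : ℂ) * Complex.exp (Δ * s * Complex.I))‖ ≤ 6 / L ^ 2 := by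
    intro s hs
    rw [norm_neg, norm_mul, norm_exp_mul_I, mul_one, Complex.norm_real, Real.norm_eq_abs, abs_div,
      abs_mul, abs_of_pos (pow_pos hL 3), abs_of_pos (by norm_num : (0 : ℝ) < 6)]
    have : |L - 2 * s| ≤ L := abs_le.2 ⟨by linarith [hs.2], by linarith [hs.1]⟩
    rw [show 6 / L ^ 2 = 6 * L / L ^ 3 by field_simp]
    gcongr
  have h := norm_image_sub_le_of_norm_deriv_le_segment' hdD hbound t ⟨h0, le_rfl⟩
  have hD0 : D 0 = 0 := by
    rw [hD]
    simp [parabolaInt_of_nonpos hL Δ le_rfl, hp]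
  rw [hD0, sub_zero, sub_zero] at h
  have e : ‖(Δ * Complex.I * parabolaInt L Δ t : ℂ)‖ = |Δ| * ‖parabolaInt L Δ t‖ := by
    rw [norm_mul, norm_mul, Complex.norm_I, mul_one, Complex.norm_real, Real.norm_eq_abs]
  have h2 : (Δ * Complex.I * parabolaInt L Δ t : ℂ) =
      D t + p t * Complex.exp (Δ * t * Complex.I) := by rw [hD]; ring
  have hpt : 0 ≤ p t := by
    rw [hp]
    have : 0 ≤ L - t := by linarith
    positivity
  rw [← e, h2]
  refine (norm_add_le _ _).trans ?_
  rw [norm_mul, norm_exp_mul_I, mul_one, Complex.norm_real, Real.norm_of_nonneg hpt]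
  have hpt' : p t ≤ 6 / L ^ 2 * t := by
    rw [hp]
    simp only
    rw [show 6 / L ^ 2 * t = 6 * (t * L) / L ^ 3 by field_simp]
    gcongr
    linarith
  have : 12 * (t / L) / L = 6 / L ^ 2 * t + 6 / L ^ 2 * t := by field_simp; ring
  linarith

/-- With x = t/L the primitive is F = 3x² − 2x³, and both quadratic bounds are of order x²/L², like
F/L² near x = 0. A bound by F instead of a constant is what allows a drive to start from an empty
site. -/
lemma isPulse_parabola {L : ℝ} (hL : 0 < L) :
    IsPulse L L (parabola L) (fun t => (parabolaInt L 0 t).re) (parabolaInt L) := by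
  have hF : ∀ t, 0 ≤ t → t ≤ L →
      (parabolaInt L 0 t).re = 3 * (t / L) ^ 2 - 2 * (t / L) ^ 3 := fun t h0 h1 => by
    rw [parabolaInt_zero_of_mem hL h0 h1, Complex.ofReal_re]
  have hFL : (parabolaInt L 0 L).re = 1 := by
    rw [hF L hL.le le_rfl, div_self hL.ne']; norm_num
  have hF0 : ∀ t, t ≤ 0 → (parabolaInt L 0 t).re = 0 := fun t ht => by
    rw [parabolaInt_of_nonpos hL 0 ht, Complex.zero_re]
  have hF1 : ∀ t, L ≤ t → (parabolaInt L 0 t).re = 1 := fun t ht => by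
    rw [parabolaInt_of_ge hL 0 ht, hFL]
  have hx : ∀ t, 0 ≤ t → t ≤ L → 0 ≤ t / L ∧ t / L ≤ 1 := fun t h0 h1 =>
    ⟨div_nonneg h0 hL.le, (div_le_one hL).2 h1⟩
  have hpos : ∀ t, 0 < t → 0 < (parabolaInt L 0 t).re := by
    intro t h0
    rcases le_total t L with h1 | h1
    · rw [hF t h0.le h1]
      have h := hx t h0.le h1
      have h' : 0 < t / L := div_pos h0 hL
      nlinarith [pow_pos h' 2, mul_nonneg (pow_pos h' 2).le (sub_nonneg.2 h.2)]
    · rw [hF1 t h1]; norm_num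
  refine ⟨continuous_parabola L, hasDerivAt_parabolaInt L,
    fun Δ t ht => parabolaInt_of_nonpos hL Δ ht, fun Δ t ht => parabolaInt_of_ge hL Δ ht, ?_,
    ?_, hpos, ?_, hFL, ?_, ?_⟩
  · intro t
    rcases le_total t L with h1 | h1
    · rcases le_total t 0 with h0 | h0
      · rw [parabolaInt_of_nonpos hL 0 h0]; simp
      · rw [parabolaInt_zero_of_mem hL h0 h1, Complex.ofReal_re]
    · rw [parabolaInt_of_ge hL 0 h1, parabolaInt_zero_of_mem hL hL.le le_rfl, Complex.ofReal_re]
  · intro t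
    rcases le_or_gt t 0 with h0 | h0
    · rw [hF0 t h0]
    · exact (hpos t h0).le
  · intro t
    rcases le_total t L with h1 | h1
    · rcases le_total t 0 with h0 | h0
      · rw [hF0 t h0]; norm_num
      · rw [hF t h0 h1]
        have h := hx t h0 h1
        nlinarith [mul_nonneg (sq_nonneg (1 - t / L)) (by linarith : 0 ≤ 1 + 2 * (t / L))]
    · rw [hF1 t h1]
  · intro t
    rcases le_total t L with h1 | h1
    · rcases le_total t 0 with h0 | h0
      · rw [parabola_of_nonpos hL h0, hF0 t h0]; simp
      · rw [hF t h0 h1, parabola_of_mem h0 h1]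
        have h := hx t h0 h1
        have e : 6 * (t * (L - t)) / L ^ 3 = 6 * (t / L) * (1 - t / L) / L := by field_simp
        rw [e, div_pow]
        gcongr
        -- The difference of the two sides is a multiple of x²(2 − x²).
        nlinarith [mul_nonneg (sq_nonneg (t / L)) (by nlinarith : 0 ≤ 2 - (t / L) ^ 2)]
    · rw [parabola_of_ge hL h1, hF1 t h1, zero_pow two_ne_zero]
      positivity
  · have key : ∀ Δ t, 0 ≤ t → t ≤ L → Δ ^ 2 * ‖parabolaInt L Δ t‖ ^ 2 ≤
        144 * (parabolaInt L 0 t).re / L ^ 2 := by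
      intro Δ t h0 h1
      have h := norm_mul_parabolaInt_le hL Δ h0 h1
      have hxt := hx t h0 h1
      rw [← sq_abs Δ, ← mul_pow, hF t h0 h1]
      refine (pow_le_pow_left₀ (by positivity) h 2).trans ?_
      rw [div_pow]
      gcongr
      nlinarith [mul_nonneg (sq_nonneg (t / L)) (sub_nonneg.2 hxt.2)]
    intro Δ t
    rcases le_total t L with h1 | h1
    · rcases le_total t 0 with h0 | h0
      · rw [parabolaInt_of_nonpos hL Δ h0, hF0 t h0]; simp
      · exact key Δ t h0 h1
    · rw [parabolaInt_of_ge hL Δ h1, parabolaInt_of_ge hL 0 h1]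
      exact key Δ L hL.le le_rfl


/-! ### The spectrum around the central mode -/

section Spectrum

variable {n : ℕ}

/-- The mode in the middle of the band. -/
def midMode (n : ℕ) : ℕ := (n + 1) / 2

lemma midMode_mem (hn : 1 ≤ n) : midMode n ∈ Finset.Icc 1 n := by
  rw [midMode, Finset.mem_Icc]; omega

/-- The worst case is n = 2, where the angle is π/3. Staying near π/2 gives the mode a large
amplitude at the edge and puts it where the band is steep. -/
lemma midMode_angle (hn : 1 ≤ n) : Real.pi / 3 ≤ Real.pi * midMode n / ((n : ℝ) + 1) ∧
    Real.pi * midMode n / ((n : ℝ) + 1) ≤ Real.pi / 2 := by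
  have hq : (0 : ℝ) < (n : ℝ) + 1 := by positivity
  have h1 : ((2 * midMode n : ℕ) : ℝ) ≤ ((n + 1 : ℕ) : ℝ) := Nat.cast_le.2 (by rw [midMode]; omega)
  have h2 : ((n + 1 : ℕ) : ℝ) ≤ ((3 * midMode n : ℕ) : ℝ) := Nat.cast_le.2 (by rw [midMode]; omega)
  push_cast at h1 h2
  rw [le_div_iff₀ hq, div_le_iff₀ hq]
  constructor <;> nlinarith [Real.pi_pos]

lemma le_modeAmp_midMode_sq (hn : 1 ≤ n) : 3 / (2 * ((n : ℝ) + 1)) ≤ modeAmp n (midMode n) 1 ^ 2 := by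
  obtain ⟨h1, h2⟩ := midMode_angle hn
  set θ := Real.pi * midMode n / ((n : ℝ) + 1)
  have hs : √3 / 2 ≤ Real.sin θ := by
    rw [← Real.sin_pi_div_three]
    exact Real.sin_le_sin_of_le_of_le_pi_div_two (by linarith [Real.pi_pos]) h2 h1
  have hs2 : 3 / 4 ≤ Real.sin θ ^ 2 := by
    have := pow_le_pow_left₀ (by positivity) hs 2
    rw [div_pow, Real.sq_sqrt (by norm_num)] at this
    linarith
  rw [modeAmp, Nat.cast_one, mul_one, mul_pow, Real.sq_sqrt (by positivity)]
  calc 3 / (2 * ((n : ℝ) + 1)) = 2 / ((n : ℝ) + 1) * (3 / 4) := by field_simp; norm_num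
    _ ≤ _ := by gcongr

lemma modeAmp_sq_le (k : ℕ) : modeAmp n k 1 ^ 2 ≤ 2 / ((n : ℝ) + 1) := by
  rw [modeAmp, mul_pow, Real.sq_sqrt (by positivity)]
  exact mul_le_of_le_one_right (by positivity) (Real.sin_sq_le_one _)

lemma modeAmp_midMode_ne_zero (hn : 1 ≤ n) : modeAmp n (midMode n) 1 ≠ 0 := by
  intro h
  have := le_modeAmp_midMode_sq hn
  rw [h, zero_pow two_ne_zero] at this
  have : 0 < 3 / (2 * ((n : ℝ) + 1)) := by positivity
  linarith

lemma two_div_pi_mul_abs_le_abs_sin {x : ℝ} (hx : |x| ≤ Real.pi / 2) :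
    2 / Real.pi * |x| ≤ |Real.sin x| := by
  rw [Real.abs_sin_eq_sin_abs_of_abs_le_pi (hx.trans (by linarith [Real.pi_pos]))]
  exact Real.mul_le_sin (abs_nonneg x) hx

/-- The difference of cosines is a product of two sines. The half-sum of the angles lies between π/6
and 3π/4, where the sine is at least 1/2; the half-difference is at most π/2 in modulus, where |sin
x| ≥ 2|x|/π. -/
lemma le_abs_modeE_sub (hn : 1 ≤ n) {k : ℕ} (hk : k ∈ Finset.Icc 1 n) :
    2 * |(k : ℝ) - midMode n| / ((n : ℝ) + 1) ≤ |modeE n k - modeE n (midMode n)| := by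
  have hq : (0 : ℝ) < (n : ℝ) + 1 := by positivity
  obtain ⟨h1, h2⟩ := midMode_angle hn
  rw [Finset.mem_Icc] at hk
  set θ₀ := Real.pi * midMode n / ((n : ℝ) + 1) with hθ₀
  set θ := Real.pi * k / ((n : ℝ) + 1) with hθ
  have hpi := Real.pi_pos
  have hk0 : 0 ≤ θ := by positivity
  have hk1 : θ ≤ Real.pi := by
    rw [hθ, div_le_iff₀ hq]
    have : (k : ℝ) ≤ n := by exact_mod_cast hk.2
    nlinarith
  rw [modeE, modeE, ← hθ₀, ← hθ, ← mul_sub, Real.cos_sub_cos, abs_mul, abs_mul, abs_mul]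
  have hs1 : 1 / 2 ≤ |Real.sin ((θ + θ₀) / 2)| := by
    refine le_trans ?_ (le_abs_self _)
    rcases le_total ((θ + θ₀) / 2) (Real.pi / 2) with h | h
    · rw [← Real.sin_pi_div_six]
      exact Real.sin_le_sin_of_le_of_le_pi_div_two (by linarith) h (by linarith)
    · rw [← Real.sin_pi_div_six, ← Real.sin_pi_sub ((θ + θ₀) / 2)]
      exact Real.sin_le_sin_of_le_of_le_pi_div_two (by linarith) (by linarith) (by linarith)
  have hs2 : |(k : ℝ) - midMode n| / ((n : ℝ) + 1) ≤ |Real.sin ((θ - θ₀) / 2)| := by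
    refine le_trans (le_of_eq ?_)
      (two_div_pi_mul_abs_le_abs_sin (abs_le.2 ⟨by linarith, by linarith⟩))
    have : (θ - θ₀) / 2 = Real.pi / (2 * ((n : ℝ) + 1)) * ((k : ℝ) - midMode n) := by
      rw [hθ, hθ₀]; field_simp
    rw [this, abs_mul, abs_of_pos (show 0 < Real.pi / (2 * ((n : ℝ) + 1)) by positivity)]
    field_simp
  rw [abs_of_pos (by norm_num : (0 : ℝ) < 2), abs_neg, abs_of_pos (by norm_num : (0 : ℝ) < 2)]
  have h0 : 0 ≤ |(k : ℝ) - midMode n| / ((n : ℝ) + 1) := by positivity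
  rw [mul_div_assoc]
  nlinarith [mul_le_mul hs1 hs2 h0 (abs_nonneg _)]

lemma abs_sub_midMode_pos {k : ℕ} (hk : k ≠ midMode n) : 0 < |(k : ℝ) - midMode n| :=
  abs_pos.2 (sub_ne_zero.2 (by exact_mod_cast hk))

/-- A sum over the modes other than the central one, in terms of the distance to it. -/
lemma sum_erase_midMode_le {g : ℝ → ℝ} (hg : ∀ x, 0 ≤ g x) :
    ∑ k ∈ (Finset.Icc 1 n).erase (midMode n), g |(k : ℝ) - midMode n| ≤
      2 * ∑ j ∈ Finset.Icc 1 n, g j := by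
  have hsplit : (Finset.Icc 1 n).erase (midMode n) =
      (Finset.Icc 1 n).filter (· < midMode n) ∪ (Finset.Icc 1 n).filter (midMode n < ·) := by
    ext k
    simp only [Finset.mem_erase, Finset.mem_union, Finset.mem_filter]
    constructor
    · rintro ⟨h, h'⟩
      rcases lt_or_gt_of_ne h with h | h
      · exact Or.inl ⟨h', h⟩
      · exact Or.inr ⟨h', h⟩
    · rintro (⟨h, h'⟩ | ⟨h, h'⟩)
      · exact ⟨h'.ne, h⟩
      · exact ⟨h'.ne', h⟩
  rw [hsplit, Finset.sum_union, two_mul]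
  · refine add_le_add ?_ ?_
    · have : ∑ k ∈ (Finset.Icc 1 n).filter (· < midMode n), g |(k : ℝ) - midMode n| =
          ∑ j ∈ ((Finset.Icc 1 n).filter (· < midMode n)).image (midMode n - ·), g j := by
        rw [Finset.sum_image]
        · refine Finset.sum_congr rfl fun k hk => ?_
          have hk := (Finset.mem_filter.1 hk).2
          rw [Nat.cast_sub hk.le, abs_sub_comm, abs_of_nonneg]
          rw [sub_nonneg]; exact_mod_cast hk.le
        · intro a ha b hb hab
          simp only [Finset.coe_filter, Set.mem_ofPred_eq] at ha hb
          simp only at hab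
          omega
      rw [this]
      refine Finset.sum_le_sum_of_subset_of_nonneg ?_ fun _ _ _ => hg _
      intro j hj
      obtain ⟨k, hk, rfl⟩ := Finset.mem_image.1 hj
      simp only [Finset.mem_filter, Finset.mem_Icc] at hk ⊢
      have : midMode n ≤ n + 1 := Nat.div_le_self _ _
      omega
    · have : ∑ k ∈ (Finset.Icc 1 n).filter (midMode n < ·), g |(k : ℝ) - midMode n| =
          ∑ j ∈ ((Finset.Icc 1 n).filter (midMode n < ·)).image (· - midMode n), g j := by
        rw [Finset.sum_image]
        · refine Finset.sum_congr rfl fun k hk => ?_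
          have hk := (Finset.mem_filter.1 hk).2
          rw [Nat.cast_sub hk.le, abs_of_nonneg]
          rw [sub_nonneg]; exact_mod_cast hk.le
        · intro a ha b hb hab
          simp only [Finset.coe_filter, Set.mem_ofPred_eq] at ha hb
          simp only at hab
          omega
      rw [this]
      refine Finset.sum_le_sum_of_subset_of_nonneg ?_ fun _ _ _ => hg _
      intro j hj
      obtain ⟨k, hk, rfl⟩ := Finset.mem_image.1 hj
      simp only [Finset.mem_filter, Finset.mem_Icc] at hk ⊢
      omega
  · rw [Finset.disjoint_filter]
    intro k _ h h'
    exact absurd h h'.asymm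

lemma sum_Icc_inv_sq_le : ∑ j ∈ Finset.Icc 1 n, 1 / (j : ℝ) ^ 2 ≤ 2 := by
  have h := sum_Ioo_inv_sq_le (α := ℝ) 0 (n + 1)
  have e : Finset.Ioo 0 (n + 1) = Finset.Icc 1 n := by ext; simp; omega
  rw [e] at h
  simpa using h

lemma sum_Icc_inv_le : ∑ j ∈ Finset.Icc 1 n, 1 / (j : ℝ) ≤ 1 + Real.log (n + 1) := by
  have h := harmonic_le_one_add_log n
  rw [harmonic_eq_sum_Icc] at h
  push_cast at h
  simp only [one_div]
  refine h.trans ?_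
  rcases Nat.eq_zero_or_pos n with rfl | hn
  · simp
  · gcongr; linarith

/-- The relative population of the modes other than the central one, in a drive of the
central mode. -/
def leak (n : ℕ) (G : ℝ → ℝ → ℂ) (t : ℝ) : ℝ :=
  ∑ k ∈ (Finset.Icc 1 n).erase (midMode n),
    (modeAmp n k 1 / modeAmp n (midMode n) 1) ^ 2 *
      ‖G (modeE n k - modeE n (midMode n)) t‖ ^ 2

lemma leak_nonneg (G : ℝ → ℝ → ℂ) (t : ℝ) : 0 ≤ leak n G t :=
  Finset.sum_nonneg fun _ _ => by positivity

/-- Dividing the strength by the edge amplitude of the central mode normalizes the drive: that mode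
then has amplitude β + l F(t). -/
lemma drivePop_midMode (hn : 1 ≤ n) {L T : ℝ} {f F : ℝ → ℝ} {G : ℝ → ℝ → ℂ}
    (h : IsPulse L T f F G) (β l t : ℝ) :
    drivePop n (midMode n) G β (l / modeAmp n (midMode n) 1) t =
      (β + l * F t) ^ 2 + l ^ 2 * leak n G t := by
  have h0 := modeAmp_midMode_ne_zero hn
  rw [drivePop, ← Finset.add_sum_erase _ _ (midMode_mem hn), leak, Finset.mul_sum]
  congr 1
  · rw [driveCoeff, if_pos rfl, sub_self, h.zero_eq]
    have : (β : ℂ) + (l / modeAmp n (midMode n) 1 : ℝ) * modeAmp n (midMode n) 1 * F t =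
        ((β + l * F t : ℝ) : ℂ) := by
      have : (modeAmp n (midMode n) 1 : ℂ) ≠ 0 := by exact_mod_cast h0
      push_cast
      field_simp
    rw [this, Complex.norm_real, Real.norm_eq_abs, sq_abs]
  · refine Finset.sum_congr rfl fun k hk => ?_
    rw [driveCoeff, if_neg (Finset.ne_of_mem_erase hk), zero_add, norm_mul, ← Complex.ofReal_mul,
      Complex.norm_real, Real.norm_eq_abs, mul_pow, sq_abs]
    ring

/-- A mode at distance j from the centre is detuned by at least 2j/(n+1), so its population is at
most of order F (n+1)²/(L j)². The ratio of squared edge amplitudes is at most 4/3 and Σ 1/j² ≤ 2,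
so the width 56(n+1) brings the total below F/16. -/
lemma leak_le (hn : 1 ≤ n) {T : ℝ} {f F : ℝ → ℝ} {G : ℝ → ℝ → ℂ}
    (h : IsPulse (56 * ((n : ℝ) + 1)) T f F G) (t : ℝ) : leak n G t ≤ F t / 16 := by
  have hq : (0 : ℝ) < (n : ℝ) + 1 := by positivity
  have hterm : ∀ k ∈ (Finset.Icc 1 n).erase (midMode n),
      (modeAmp n k 1 / modeAmp n (midMode n) 1) ^ 2 *
        ‖G (modeE n k - modeE n (midMode n)) t‖ ^ 2 ≤
      F t / 64 * (1 / |(k : ℝ) - midMode n| ^ 2) := by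
    intro k hk
    have hk0 := abs_sub_midMode_pos (Finset.ne_of_mem_erase hk)
    have h1 : (modeAmp n k 1 / modeAmp n (midMode n) 1) ^ 2 ≤ 4 / 3 := by
      rw [div_pow, div_le_iff₀ (pow_pos (abs_pos.2 (modeAmp_midMode_ne_zero hn)) 2 |>.trans_eq
        (sq_abs _))]
      refine (modeAmp_sq_le k).trans ?_
      have := le_modeAmp_midMode_sq hn
      calc 2 / ((n : ℝ) + 1) = 4 / 3 * (3 / (2 * ((n : ℝ) + 1))) := by field_simp; norm_num
        _ ≤ _ := by gcongr
    have h2 := h.norm_sq_le (modeE n k - modeE n (midMode n)) t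
    have h3 := le_abs_modeE_sub hn (Finset.mem_of_mem_erase hk)
    set Δ := modeE n k - modeE n (midMode n)
    have h4 : (2 * |(k : ℝ) - midMode n| / ((n : ℝ) + 1)) ^ 2 * ‖G Δ t‖ ^ 2 ≤
        144 * F t / (56 * ((n : ℝ) + 1)) ^ 2 := by
      refine le_trans ?_ h2
      rw [← sq_abs Δ]
      gcongr
    have h5 : ‖G Δ t‖ ^ 2 ≤ 144 * F t / (56 * ((n : ℝ) + 1)) ^ 2 /
        (2 * |(k : ℝ) - midMode n| / ((n : ℝ) + 1)) ^ 2 := by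
      rw [le_div_iff₀ (by positivity), mul_comm]
      exact h4
    refine (mul_le_mul h1 h5 (by positivity) (by norm_num)).trans ?_
    have hF := h.nonneg t
    rw [show 4 / 3 * (144 * F t / (56 * ((n : ℝ) + 1)) ^ 2 /
      (2 * |(k : ℝ) - midMode n| / ((n : ℝ) + 1)) ^ 2) =
      F t * (3 / 196) * (1 / |(k : ℝ) - midMode n| ^ 2) by field_simp; ring]
    gcongr
    linarith
  refine (Finset.sum_le_sum hterm).trans ?_
  rw [← Finset.mul_sum]
  have hs := sum_erase_midMode_le (n := n) (g := fun x => 1 / x ^ 2) fun x => by positivity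
  have hs2 := sum_Icc_inv_sq_le (n := n)
  have hF := h.nonneg t
  calc _ ≤ F t / 64 * (2 * 2) := by gcongr; exact hs.trans (by gcongr)
    _ = F t / 16 := by ring

/-- This bounds the coupling that a drive requires: the edge amplitude is of order N^{-1/2} and the
pulse of order √F / N, so a wide pulse leaves ample room below modulus one. -/
lemma sq_div_modeAmp_le (hn : 1 ≤ n) {T : ℝ} {f F : ℝ → ℝ} {G : ℝ → ℝ → ℂ}
    (h : IsPulse (56 * ((n : ℝ) + 1)) T f F G) (l t : ℝ) :
    (l / modeAmp n (midMode n) 1 * f t) ^ 2 ≤ l ^ 2 * (F t / 2) := by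
  have hq : (0 : ℝ) < (n : ℝ) + 1 := by positivity
  have h1 := h.sq_le t
  have h2 := le_modeAmp_midMode_sq hn
  have hF := h.nonneg t
  have h3 : 0 < 3 / (2 * ((n : ℝ) + 1)) := by positivity
  rw [mul_pow, div_pow, div_mul_eq_mul_div, mul_div_assoc]
  refine mul_le_mul_of_nonneg_left ?_ (sq_nonneg l)
  refine (div_le_div₀ (by positivity) h1 h3 h2).trans ?_
  rw [div_div, div_le_div_iff₀ (by positivity) (by norm_num)]
  have : (1 : ℝ) ≤ (n : ℝ) + 1 := by linarith [(Nat.cast_nonneg n : (0 : ℝ) ≤ n)]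
  have e : (56 * ((n : ℝ) + 1)) ^ 2 * (3 / (2 * ((n : ℝ) + 1))) = 4704 * ((n : ℝ) + 1) := by
    field_simp; norm_num
  rw [e]
  nlinarith

end Spectrum

/-! ### Transfer through the central mode -/

section Transfer

variable {n : ℕ} {L T : ℝ} {f F : ℝ → ℝ} {G : ℝ → ℝ → ℂ}

lemma norm_exp_neg_mul_I (x y : ℝ) : ‖Complex.exp (-(x * y * Complex.I))‖ = 1 := by
  rw [Complex.exp_neg, norm_inv, norm_exp_mul_I, inv_one]

/-- The central mode is split off, and orthonormality of the modes gives the norm of the rest. -/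
lemma exists_driveBulk_eq (hn : 1 ≤ n) (h : IsPulse L T f F G) (β l t : ℝ) :
    ∃ e, driveBulk n (midMode n) G β (l / modeAmp n (midMode n) 1) t =
      (((β + l * F t : ℝ) : ℂ) * Complex.exp (-(modeE n (midMode n) * t * Complex.I))) •
        mode n (midMode n) + e ∧ nrm e ^ 2 = l ^ 2 * leak n G t := by
  have h0 : (modeAmp n (midMode n) 1 : ℂ) ≠ 0 := by exact_mod_cast modeAmp_midMode_ne_zero hn
  refine ⟨_, ?_, nrm_sum_mode_sq ((Finset.Icc 1 n).erase (midMode n)) (Finset.erase_subset _ _)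
    (fun k => driveCoeff n (midMode n) G β (l / modeAmp n (midMode n) 1) k t *
      Complex.exp (-(modeE n k * t * Complex.I))) |>.trans ?_⟩
  · rw [driveBulk, ← Finset.add_sum_erase _ _ (midMode_mem hn)]
    congr 3
    rw [driveCoeff, if_pos rfl, sub_self, h.zero_eq]
    push_cast
    field_simp
  · rw [leak, Finset.mul_sum]
    refine Finset.sum_congr rfl fun k hk => ?_
    rw [driveCoeff, if_neg (Finset.ne_of_mem_erase hk), zero_add, norm_mul, norm_mul,
      norm_exp_neg_mul_I, mul_one, ← Complex.ofReal_mul, Complex.norm_real, Real.norm_eq_abs,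
      mul_pow, sq_abs]
    ring

lemma leak_zero (h : IsPulse L T f F G) : leak n G 0 = 0 :=
  Finset.sum_eq_zero fun k _ => by rw [h.of_nonpos _ 0 le_rfl]; simp

lemma eq_zero_of_nrm_sq {ι : Type*} [Fintype ι] {v : ι → ℂ} (h : nrm v ^ 2 = 0) : v = 0 := by
  ext i
  have := norm_apply_le_nrm v i
  rw [pow_eq_zero_iff two_ne_zero] at h
  rw [h] at this
  exact norm_le_zero_iff.1 this

lemma IsPulse.value_zero (h : IsPulse L T f F G) : F 0 = 0 := by
  have := h.zero_eq 0
  rw [h.of_nonpos 0 0 le_rfl] at this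
  exact_mod_cast this.symm

/-- Half of the amplitude of the first site is moved to the central mode. -/
lemma exists_reach_mid (hn : 1 ≤ n) (h : IsPulse (56 * ((n : ℝ) + 1)) T f F G) (hT : 0 < T) :
    ∃ e, Reach (n := n) T (Pi.single 0 1)
      (Pi.single 0 ((√(3 / 4 - leak n G T / 4) : ℝ) : ℂ) +
        (1 / 2 * Complex.exp (-(modeE n (midMode n) * T * Complex.I))) • mode n (midMode n) + e) ∧
      nrm e ^ 2 = leak n G T / 4 := by
  have hpop : ∀ t, drivePop n (midMode n) G 0 (1 / 2 / modeAmp n (midMode n) 1) t =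
      F t ^ 2 / 4 + leak n G t / 4 := fun t => by rw [drivePop_midMode hn h]; ring
  obtain ⟨e, he, hen⟩ := exists_driveBulk_eq hn h 0 (1 / 2) T
  obtain ⟨e₀, he₀, hen₀⟩ := exists_driveBulk_eq hn h 0 (1 / 2) 0
  rw [leak_zero h, mul_zero] at hen₀
  rw [eq_zero_of_nrm_sq hen₀, h.value_zero] at he₀
  have hle : ∀ t, 0 ≤ F t ∧ F t ≤ 1 ∧ leak n G t ≤ F t / 16 := fun t =>
    ⟨h.nonneg t, h.le_one t, leak_le hn h t⟩
  -- With only amplitude 1/2 in the mode, the first site keeps a population of at least 3/4 − 1/64,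
  -- so it never empties and the coupling stays admissible.
  have hr := reach_driveState (r := 1) (β := 0) (κ := 1 / 2 / modeAmp n (midMode n) 1) hn
    h.continuous h.hasDerivAt hT (k₀ := midMode n) 0
    (fun t _ => by
      obtain ⟨h1, h2, h3⟩ := hle t
      rw [hpop]
      nlinarith)
    (fun t _ => by
      obtain ⟨h1, h2, h3⟩ := hle t
      refine (sq_div_modeAmp_le hn h _ _).trans ?_
      rw [hpop]
      nlinarith)
  refine ⟨e, ?_, by rw [hen]; ring⟩
  have hx : driveState n (midMode n) G 0 (1 / 2 / modeAmp n (midMode n) 1) 1 0 0 =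
      Pi.single 0 1 := by
    rw [driveState, hpop, h.value_zero, leak_zero h, he₀]
    simp
  have hy : driveState n (midMode n) G 0 (1 / 2 / modeAmp n (midMode n) 1) 1 0 T =
      Pi.single 0 ((√(3 / 4 - leak n G T / 4) : ℝ) : ℂ) +
        (1 / 2 * Complex.exp (-(modeE n (midMode n) * T * Complex.I))) • mode n (midMode n) +
          e := by
    rw [driveState, hpop, h.last, he, h.last, Pi.single_zero, add_zero, ← add_assoc,
      show 1 - (1 ^ 2 / 4 + leak n G T / 4) = 3 / 4 - leak n G T / 4 by ring]
    norm_num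
  rwa [hx, hy] at hr

/-- The central mode is emptied to the driven end. -/
lemma exists_reach_end (hn : 1 ≤ n) (h : IsPulse (56 * ((n : ℝ) + 1)) T f F G) (hT : 0 < T)
    (d : ℂ) :
    ∃ e, Reach (n := n) T (Pi.single (Fin.last (n + 1)) d + (1 / 2 : ℂ) • mode n (midMode n))
      (Pi.single 0 ((√(1 / 4 - leak n G T / 4) : ℝ) : ℂ) + Pi.single (Fin.last (n + 1)) d + e) ∧
      nrm e ^ 2 = leak n G T / 4 := by
  have hpop : ∀ t, drivePop n (midMode n) G (1 / 2) (-(1 / 2) / modeAmp n (midMode n) 1) t =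
      (1 - F t) ^ 2 / 4 + leak n G t / 4 := fun t => by rw [drivePop_midMode hn h]; ring
  obtain ⟨e, he, hen⟩ := exists_driveBulk_eq hn h (1 / 2) (-(1 / 2)) T
  obtain ⟨e₀, he₀, hen₀⟩ := exists_driveBulk_eq hn h (1 / 2) (-(1 / 2)) 0
  rw [leak_zero h, mul_zero] at hen₀
  rw [eq_zero_of_nrm_sq hen₀, h.value_zero] at he₀
  have hle : ∀ t, 0 ≤ F t ∧ F t ≤ 1 ∧ leak n G t ≤ F t / 16 := fun t =>
    ⟨h.nonneg t, h.le_one t, leak_le hn h t⟩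
  -- Here the first site starts empty. Its population is at least F/4 − F/64, which dominates the
  -- F/8 needed for the coupling although both vanish at time 0.
  have hr := reach_driveState (r := 1 / 4) (β := 1 / 2)
    (κ := -(1 / 2) / modeAmp n (midMode n) 1) hn
    h.continuous h.hasDerivAt hT (k₀ := midMode n) d
    (fun t ht => by
      obtain ⟨h1, h2, h3⟩ := hle t
      have := h.pos t ht.1
      rw [hpop]
      nlinarith)
    (fun t _ => by
      obtain ⟨h1, h2, h3⟩ := hle t
      refine (sq_div_modeAmp_le hn h _ _).trans ?_
      rw [hpop]
      nlinarith)
  refine ⟨e, ?_, by rw [hen]; ring⟩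
  have hx : driveState n (midMode n) G (1 / 2) (-(1 / 2) / modeAmp n (midMode n) 1) (1 / 4) d 0 =
      Pi.single (Fin.last (n + 1)) d + (1 / 2 : ℂ) • mode n (midMode n) := by
    rw [driveState, hpop, h.value_zero, leak_zero h, he₀]
    norm_num
  have hy : driveState n (midMode n) G (1 / 2) (-(1 / 2) / modeAmp n (midMode n) 1) (1 / 4) d T =
      Pi.single 0 ((√(1 / 4 - leak n G T / 4) : ℝ) : ℂ) + Pi.single (Fin.last (n + 1)) d + e := by
    rw [driveState, hpop, h.last, he, h.last]
    norm_num
  rwa [hx, hy] at hr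

lemma single_comp_rev (i : Fin (n + 2)) (c : ℂ) :
    (Pi.single i c : Fin (n + 2) → ℂ) ∘ Fin.rev = Pi.single i.rev c := by
  ext l
  by_cases hl : l = i.rev
  · subst hl; simp
  · have : l.rev ≠ i := fun h => hl (by rw [← h, Fin.rev_rev])
    simp [hl, this]

/-- A quarter of the population is transferred from the first to the last site. -/
lemma exists_transfer (hn : 1 ≤ n) (h : IsPulse (56 * ((n : ℝ) + 1)) T f F G) (hT : 0 < T) {η : ℝ}
    (hη : 0 < η) :
    ∃ (l : List Step) (a b : ℂ), Coherent l ∧ time l ≤ 2 * T ∧ ‖a‖ ^ 2 ≤ 3 / 4 ∧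
      ‖b‖ ^ 2 = 1 / 4 - leak n G T / 4 ∧
      nrm ((run n l).mulVec (Pi.single 0 1) - (Pi.single 0 a + Pi.single (Fin.last (n + 1)) b)) ≤
        √(leak n G T) + η := by
  have hl0 := leak_nonneg (n := n) G T
  have hl1 : leak n G T ≤ 1 / 16 := by
    have := leak_le hn h T
    rwa [h.last] at this
  set k := midMode n
  have hk1 : 1 ≤ k := (Finset.mem_Icc.1 (midMode_mem hn)).1
  set ω : ℂ := Complex.exp (-(modeE n k * T * Complex.I)) with hω
  set s : ℂ := (-1) ^ (k + 1) with hs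
  have hss : s * s = 1 := by rw [hs, ← mul_pow]; simp
  have hsn : ‖s‖ = 1 := by rw [hs]; simp
  have hωn : ‖ω‖ = 1 := norm_exp_neg_mul_I _ _
  have hω0 : ω ≠ 0 := Complex.exp_ne_zero _
  have hs0 : s ≠ 0 := left_ne_zero_of_mul_eq_one hss
  set a : ℂ := ((√(3 / 4 - leak n G T / 4) : ℝ) : ℂ) with ha
  set b₀ : ℂ := ((√(1 / 4 - leak n G T / 4) : ℝ) : ℂ) with hb₀
  obtain ⟨e₁, hr₁, he₁⟩ := exists_reach_mid hn h hT
  -- The second stage is the mirror image of emptying the mode into the first site. Rescaling it by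
  -- ω s, the phase acquired by the mode times its parity, makes its start agree with the end of the
  -- first stage; the spectator amplitude is divided by ω s in advance.
  obtain ⟨e₂, hr₂, he₂⟩ := exists_reach_end hn h hT (a / (ω * s))
  have hr₃ := hr₂.reflect.smul (ω * s)
  have hx : (ω * s) • ((Pi.single (Fin.last (n + 1)) (a / (ω * s)) +
      (1 / 2 : ℂ) • mode n k) ∘ Fin.rev) = Pi.single 0 a + (1 / 2 * ω) • mode n k := by
    rw [Pi.add_comp, single_comp_rev, Fin.rev_last, Pi.smul_comp, mode_comp_rev hk1, smul_add,
      ← Pi.single_smul, smul_smul, smul_smul, smul_eq_mul, mul_div_cancel₀ _ (mul_ne_zero hω0 hs0)]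
    congr 2
    linear_combination (ω / 2) * hss
  have hy : (ω * s) • ((Pi.single 0 b₀ + Pi.single (Fin.last (n + 1)) (a / (ω * s)) + e₂) ∘
      Fin.rev) = Pi.single 0 a + Pi.single (Fin.last (n + 1)) (ω * s * b₀) +
        (ω * s) • (e₂ ∘ Fin.rev) := by
    rw [Pi.add_comp, Pi.add_comp, single_comp_rev, single_comp_rev, Fin.rev_last, Fin.rev_zero,
      smul_add, smul_add, ← Pi.single_smul, ← Pi.single_smul, smul_eq_mul, smul_eq_mul,
      mul_div_cancel₀ _ (mul_ne_zero hω0 hs0), add_comm (Pi.single (Fin.last (n + 1)) _)]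
  rw [hx, hy] at hr₃
  obtain ⟨l₁, hc₁, ht₁, hl₁⟩ := hr₁ (η / 2) (by linarith)
  obtain ⟨l₂, hc₂, ht₂, hl₂⟩ := hr₃ (η / 2) (by linarith)
  refine ⟨l₁ ++ l₂, a, ω * s * b₀, hc₁.append hc₂, by rw [time_append]; linarith, ?_, ?_, ?_⟩
  · rw [ha, Complex.norm_real, Real.norm_of_nonneg (Real.sqrt_nonneg _), Real.sq_sqrt (by linarith)]
    linarith
  · rw [norm_mul, norm_mul, hωn, hsn, one_mul, one_mul, hb₀, Complex.norm_real,
      Real.norm_of_nonneg (Real.sqrt_nonneg _), Real.sq_sqrt (by linarith)]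
  · have hq : ∀ e : Fin (n + 2) → ℂ, nrm e ^ 2 = leak n G T / 4 → nrm e = √(leak n G T) / 2 := by
      intro e he
      refine (sq_eq_sq₀ (nrm_nonneg _) (by positivity)).1 ?_
      rw [he, div_pow, Real.sq_sqrt hl0]
      norm_num
    set x₁ := Pi.single 0 a + (1 / 2 * ω) • mode n k
    set v := (run n l₁).mulVec (Pi.single 0 1)
    have e : (run n (l₁ ++ l₂)).mulVec (Pi.single 0 1) -
        (Pi.single 0 a + Pi.single (Fin.last (n + 1)) (ω * s * b₀)) =
        (run n l₂).mulVec (v - (x₁ + e₁)) + (run n l₂).mulVec e₁ + ((run n l₂).mulVec x₁ -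
          (Pi.single 0 a + Pi.single (Fin.last (n + 1)) (ω * s * b₀) +
            (ω * s) • (e₂ ∘ Fin.rev))) + (ω * s) • (e₂ ∘ Fin.rev) := by
      rw [run_append, ← Matrix.mulVec_mulVec, Matrix.mulVec_sub, Matrix.mulVec_add]
      abel
    rw [e]
    have n1 : nrm ((run n l₂).mulVec (v - (x₁ + e₁))) ≤ η / 2 :=
      (nrm_run_mulVec_le _ _).trans hl₁
    have n2 : nrm ((run n l₂).mulVec e₁) ≤ √(leak n G T) / 2 :=
      (nrm_run_mulVec_le _ _).trans (hq _ he₁).le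
    have n4 : nrm ((ω * s) • (e₂ ∘ Fin.rev)) = √(leak n G T) / 2 := by
      rw [nrm_smul, norm_mul, hωn, hsn, one_mul, one_mul, nrm_comp_rev, hq _ he₂]
    refine (nrm_add_le _ _).trans ?_
    rw [n4]
    have n5 := nrm_add_le ((run n l₂).mulVec (v - (x₁ + e₁)) + (run n l₂).mulVec e₁)
      ((run n l₂).mulVec x₁ - (Pi.single 0 a + Pi.single (Fin.last (n + 1)) (ω * s * b₀) +
            (ω * s) • (e₂ ∘ Fin.rev)))
    have n6 := nrm_add_le ((run n l₂).mulVec (v - (x₁ + e₁))) ((run n l₂).mulVec e₁)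
    linarith

end Transfer

/-! ### Arrival in short time, and repetition -/

section Arrival

variable {n : ℕ}

/-- On two sites the excitation is transferred by free evolution. -/
lemma exists_steps_two : ∃ l : List Step, time l ≤ 2 ∧
    nrm ((run 0 l).mulVec (Pi.single 0 1)) = 0 := by
  -- Two sites have no interior, so this case is separate. The columns are eigenvectors for ±1, and
  -- the time π/2 gives a complete transfer up to the phase −i.
  have hA : hop 0 * (!![1, 1; 1, -1] : Matrix (Fin 2) (Fin 2) ℂ) =
      (!![1, 1; 1, -1] : Matrix (Fin 2) (Fin 2) ℂ) * Matrix.diagonal ![1, -1] := by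
    ext i j
    fin_cases i <;> fin_cases j <;>
      simp [hop, Matrix.mul_apply, Fin.sum_univ_two, Matrix.diagonal_apply]
  have hpi : (Real.pi / 2 : ℝ) ≤ 2 := by linarith [Real.pi_le_four]
  have hpi0 : (0 : ℝ) ≤ Real.pi / 2 := by positivity
  refine ⟨[.evolve (NNReal.mk (Real.pi / 2) hpi0), .measure], by simpa [time, Step.time] using hpi, ?_⟩
  have hB := evol_mul_of_intertwine hA (Real.pi / 2)
  have hD : evol (Matrix.diagonal (![1, -1] : Fin 2 → ℂ)) (Real.pi / 2) =
      Matrix.diagonal ![-Complex.I, Complex.I] := by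
    rw [evol, ← Matrix.diagonal_smul, Matrix.exp_diagonal]
    congr 1
    ext i
    rw [Pi.coe_exp, ← Complex.exp_eq_exp_ℂ]
    fin_cases i
    · have : -((Real.pi / 2 : ℝ) : ℂ) * Complex.I * 1 = -Real.pi / 2 * Complex.I := by
        push_cast; ring
      simp only [Fin.zero_eta, Pi.smul_apply, Matrix.cons_val_zero, smul_eq_mul]
      rw [this, Complex.exp_neg_pi_div_two_mul_I]
    · have : -((Real.pi / 2 : ℝ) : ℂ) * Complex.I * -1 = Real.pi / 2 * Complex.I := by
        push_cast; ring
      simp only [Fin.mk_one, Pi.smul_apply, Matrix.cons_val_one, smul_eq_mul]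
      rw [Matrix.cons_val_fin_one, this, Complex.exp_pi_div_two_mul_I]
      rfl
  rw [hD] at hB
  have h0 : (Pi.single 0 1 : Fin 2 → ℂ) =
      (!![1, 1; 1, -1] : Matrix (Fin 2) (Fin 2) ℂ).mulVec ![1 / 2, 1 / 2] := by
    ext i
    fin_cases i <;> simp [Matrix.mulVec, dotProduct, Fin.sum_univ_two]
    norm_num
  have h1 : (evol (hop 0) (Real.pi / 2)).mulVec (Pi.single 0 1) = Pi.single 1 (-Complex.I) := by
    rw [h0, Matrix.mulVec_mulVec, hB, ← Matrix.mulVec_mulVec]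
    ext i
    fin_cases i <;> simp [Matrix.mulVec, dotProduct, Fin.sum_univ_two]
    ring
  have h2 : (run 0 [.evolve (NNReal.mk (Real.pi / 2) hpi0), .measure]).mulVec (Pi.single 0 1) = 0 := by
    simp only [run, Step.mat, Matrix.one_mul]
    rw [← Matrix.mulVec_mulVec, NNReal.coe_mk, h1, one_sub_lastProj]
    ext i
    rw [Matrix.mulVec_diagonal]
    fin_cases i <;> simp [Fin.last]
  rw [h2, nrm_zero]

/-- The excitation may be found at the other end with a constant probability, in a time linear in
the length of the chain. -/
lemma exists_steps_linear (n : ℕ) : ∃ l : List Step, time l ≤ 112 * ((n : ℝ) + 2) ∧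
    nrm ((run n l).mulVec (Pi.single 0 1)) ^ 2 < 1 - 1 / 32 := by
  rcases Nat.eq_zero_or_pos n with rfl | hn
  · obtain ⟨l, hl, h⟩ := exists_steps_two
    refine ⟨l, hl.trans (by norm_num), ?_⟩
    rw [h]
    norm_num
  have hq : (0 : ℝ) < 56 * ((n : ℝ) + 1) := by positivity
  have hp := isPulse_parabola hq
  have hl0 := leak_nonneg (n := n) (parabolaInt (56 * ((n : ℝ) + 1))) (56 * ((n : ℝ) + 1))
  have hl1 := leak_le hn hp (56 * ((n : ℝ) + 1))
  have hlast := hp.last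
  rw [hlast] at hl1
  obtain ⟨l, a, b, -, htl, -, hb, hl⟩ :=
    exists_transfer hn hp hq (show (0 : ℝ) < 1 / 100 by norm_num)
  refine ⟨l ++ [.measure], ?_, ?_⟩
  · rw [time_append]
    simp only [time, Step.time, List.map_cons, List.map_nil, List.sum_cons, List.sum_nil] at htl ⊢
    linarith
  set lk := leak n (parabolaInt (56 * ((n : ℝ) + 1))) (56 * ((n : ℝ) + 1))
  set v := (run n l).mulVec (Pi.single 0 1) with hv
  have hm : (run n (l ++ [.measure])).mulVec (Pi.single 0 1) = (1 - lastProj n).mulVec v := by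
    rw [run_append, ← Matrix.mulVec_mulVec]
    simp [run, Step.mat, hv]
  have hs := nrm_measure v
  have hv1 : nrm v ≤ 1 := (nrm_run_mulVec_le _ _).trans (by rw [nrm_single, norm_one])
  -- The last amplitude is at least 12/25 − 1/4 − 1/100 = 0.22, and 0.22² > 1/32.
  have hsq : √lk ≤ 1 / 4 := by
    rw [show (1 / 4 : ℝ) = √((1 / 4) ^ 2) from (Real.sqrt_sq (by norm_num)).symm]
    exact Real.sqrt_le_sqrt (by linarith)
  have hb' : 12 / 25 ≤ ‖b‖ := by
    refine (sq_le_sq₀ (by norm_num) (norm_nonneg _)).1 ?_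
    rw [hb]
    linarith
  have hlast : ‖b‖ - (√lk + 1 / 100) ≤ ‖v (Fin.last (n + 1))‖ := by
    have h1 := (norm_apply_le_nrm _ (Fin.last (n + 1))).trans hl
    have h2 : (Fin.last (n + 1) : Fin (n + 2)) ≠ 0 := by simp [Fin.ext_iff]
    rw [Pi.sub_apply, Pi.add_apply, Pi.single_eq_same, Pi.single_eq_of_ne h2, zero_add,
      norm_sub_rev] at h1
    have := norm_sub_norm_le b (v (Fin.last (n + 1)))
    linarith
  rw [hm]
  have : nrm v ^ 2 ≤ 1 := pow_le_one₀ (nrm_nonneg _) hv1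
  nlinarith [norm_nonneg (v (Fin.last (n + 1)))]

lemma one_add_log_le {x : ℝ} (hx : 1 ≤ x) : 1 + Real.log x ≤ 4 * x ^ (1 / 3 : ℝ) := by
  have h1 := Real.log_le_rpow_div (zero_le_one.trans hx) (show (0 : ℝ) < 1 / 3 by norm_num)
  have h2 := Real.one_le_rpow hx (show (0 : ℝ) ≤ 1 / 3 by norm_num)
  linarith

/-- A pulse that drives the central mode only. -/
lemma exists_selective_pulse (hn : 1 ≤ n) : ∃ T f F G, 0 < T ∧
    T ≤ 72 * ((n : ℝ) + 2) ^ (4 / 3 : ℝ) ∧ IsPulse (56 * ((n : ℝ) + 1)) T f F G ∧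
      leak n G T = 0 := by
  have hq : (0 : ℝ) < (n : ℝ) + 1 := by positivity
  have hgap : ∀ k ∈ (Finset.Icc 1 n).erase (midMode n),
      0 < 2 * |(k : ℝ) - midMode n| / ((n : ℝ) + 1) := fun k hk => by
    have := abs_sub_midMode_pos (Finset.ne_of_mem_erase hk)
    positivity
  have hΔ : ∀ k ∈ (Finset.Icc 1 n).erase (midMode n), modeE n k - modeE n (midMode n) ≠ 0 :=
    fun k hk => abs_pos.1 ((hgap k hk).trans_le (le_abs_modeE_sub hn (Finset.mem_of_mem_erase hk)))
  obtain ⟨f, F, G, hp, hz⟩ := (isPulse_parabola (L := 56 * ((n : ℝ) + 1))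
    (by positivity)).exists_orthogonal _ _ hΔ
  refine ⟨_, f, F, G, ?_, ?_, hp, ?_⟩
  · exact add_pos_of_pos_of_nonneg (by positivity) (Finset.sum_nonneg fun k _ =>
      div_nonneg Real.pi_pos.le (abs_nonneg _))
  -- Each delay is at most 2(n+1)/|k − k₀|, so together they form a harmonic sum of order N log N,
  -- absorbed into N^{4/3}.
  · have h1 : ∑ k ∈ (Finset.Icc 1 n).erase (midMode n),
        Real.pi / |modeE n k - modeE n (midMode n)| ≤
        ∑ k ∈ (Finset.Icc 1 n).erase (midMode n),
          (2 * ((n : ℝ) + 1)) * (1 / |(k : ℝ) - midMode n|) := by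
      refine Finset.sum_le_sum fun k hk => ?_
      have h0 := abs_sub_midMode_pos (Finset.ne_of_mem_erase hk)
      refine (div_le_div₀ (by norm_num) Real.pi_le_four (hgap k hk)
        (le_abs_modeE_sub hn (Finset.mem_of_mem_erase hk))).trans_eq ?_
      field_simp
      norm_num
    have h2 := sum_erase_midMode_le (n := n) (g := fun x => 1 / |x|) fun x => by positivity
    simp only [abs_abs, Nat.abs_cast] at h2
    have h3 := sum_Icc_inv_le (n := n)
    have hx : (1 : ℝ) ≤ (n : ℝ) + 1 := by linarith [(Nat.cast_nonneg n : (0 : ℝ) ≤ n)]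
    have h4 := one_add_log_le hx
    rw [← Finset.mul_sum] at h1
    have h5 : ∑ k ∈ (Finset.Icc 1 n).erase (midMode n), 1 / |(k : ℝ) - midMode n| ≤
        2 * (4 * ((n : ℝ) + 1) ^ (1 / 3 : ℝ)) :=
      h2.trans (mul_le_mul_of_nonneg_left (h3.trans h4) (by norm_num))
    have h6 : 2 * ((n : ℝ) + 1) * ∑ k ∈ (Finset.Icc 1 n).erase (midMode n),
        1 / |(k : ℝ) - midMode n| ≤ 2 * ((n : ℝ) + 1) * (2 * (4 * ((n : ℝ) + 1) ^ (1 / 3 : ℝ))) :=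
      mul_le_mul_of_nonneg_left h5 (by positivity)
    have h7 : ((n : ℝ) + 1) ^ (4 / 3 : ℝ) = ((n : ℝ) + 1) * ((n : ℝ) + 1) ^ (1 / 3 : ℝ) := by
      rw [show (4 / 3 : ℝ) = 1 + 1 / 3 by norm_num, Real.rpow_add hq, Real.rpow_one]
    have h8 := Real.one_le_rpow hx (show (0 : ℝ) ≤ 1 / 3 by norm_num)
    have h9 : ((n : ℝ) + 1) ^ (4 / 3 : ℝ) ≤ ((n : ℝ) + 2) ^ (4 / 3 : ℝ) :=
      Real.rpow_le_rpow hq.le (by linarith) (by norm_num)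
    have h10 : (n : ℝ) + 1 ≤ ((n : ℝ) + 1) ^ (4 / 3 : ℝ) := by
      rw [h7]
      exact le_mul_of_one_le_right hq.le h8
    linarith
  · exact Finset.sum_eq_zero fun k hk => by rw [hz k hk]; simp

/-- Repetition of a step that leaves the excitation in place, up to the amplitude `a`. -/
lemma nrm_run_replicate_le {m : List Step} {a : ℂ} (ha : ‖a‖ ^ 2 ≤ 3 / 4) (R : ℕ)
    (h : nrm ((run n m).mulVec (Pi.single 0 1) - Pi.single 0 a) ≤ (7 / 8) ^ R / 200) {r : ℕ}
    (hr : r ≤ R) :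
    nrm ((run n (List.replicate r m).flatten).mulVec (Pi.single 0 1)) ≤ (7 / 8) ^ r := by
  -- √(3/4) < 0.87, and 0.87 + 1/200 = 7/8: the margin takes up the error of each round.
  have ha' : ‖a‖ ≤ 0.87 := by
    refine (sq_le_sq₀ (norm_nonneg _) (by norm_num)).1 (ha.trans (by norm_num))
  induction r with
  | zero => rw [List.replicate_zero, List.flatten_nil, run, Matrix.one_mulVec, nrm_single]; simp
  | succ r ih =>
    have ih := ih (by omega)
    set A := run n (List.replicate r m).flatten with hA
    have e : (run n (List.replicate (r + 1) m).flatten).mulVec (Pi.single 0 1) =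
        A.mulVec ((run n m).mulVec (Pi.single 0 1) - Pi.single 0 a) +
          a • A.mulVec (Pi.single 0 1) := by
      rw [List.replicate_succ, List.flatten_cons, run_append, ← Matrix.mulVec_mulVec,
        ← Matrix.mulVec_smul, ← Matrix.mulVec_add, ← Pi.single_smul, smul_eq_mul, mul_one,
        sub_add_cancel]
    rw [e]
    refine (nrm_add_le _ _).trans ?_
    rw [nrm_smul]
    have h1 : nrm (A.mulVec ((run n m).mulVec (Pi.single 0 1) - Pi.single 0 a)) ≤
        (7 / 8) ^ R / 200 := (nrm_run_mulVec_le _ _).trans h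
    have h2 : (7 / 8 : ℝ) ^ R ≤ (7 / 8) ^ r :=
      pow_le_pow_of_le_one (by norm_num) (by norm_num) (by omega)
    have h3 : ‖a‖ * nrm (A.mulVec (Pi.single 0 1)) ≤ 0.87 * (7 / 8) ^ r :=
      mul_le_mul ha' ih (nrm_nonneg _) (by norm_num)
    have h4 : (0 : ℝ) < (7 / 8) ^ r := by positivity
    rw [pow_succ]
    linarith

lemma time_replicate (r : ℕ) (m : List Step) :
    time (List.replicate r m).flatten = r * time m := by
  induction r with
  | zero => simp [time]
  | succ r ih =>
    rw [List.replicate_succ, List.flatten_cons, time_append, ih]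
    push_cast
    ring

lemma log_two_le_log_one_div {ε : ℝ} (hε : 0 < ε) (hε' : ε ≤ 1 / 2) :
    Real.log 2 ≤ Real.log (1 / ε) := by
  apply Real.log_le_log (by norm_num)
  rw [le_div_iff₀ hε]
  linarith

/-- The excitation arrives with a probability close to one. -/
lemma exists_steps_certain (n : ℕ) {ε : ℝ} (hε : 0 < ε) (hε' : ε ≤ 1 / 2) : ∃ l : List Step,
    time l ≤ 1152 * ((n : ℝ) + 2) ^ (4 / 3 : ℝ) * Real.log (1 / ε) ∧
      nrm ((run n l).mulVec (Pi.single 0 1)) ^ 2 < ε := by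
  have hlog : 0.69 ≤ Real.log (1 / ε) := by
    linarith [log_two_le_log_one_div hε hε', Real.log_two_gt_d9]
  rcases Nat.eq_zero_or_pos n with rfl | hn
  · obtain ⟨l, hl, h⟩ := exists_steps_two
    refine ⟨l, hl.trans ?_, ?_⟩
    · have : (1 : ℝ) ≤ (((0 : ℕ) : ℝ) + 2) ^ (4 / 3 : ℝ) :=
        Real.one_le_rpow (by norm_num) (by norm_num)
      nlinarith
    · rw [h]
      simpa using hε
  obtain ⟨T, f, F, G, hT, hTle, hp, hz⟩ := exists_selective_pulse hn
  -- A round multiplies the bound on the squared norm by 49/64 ≤ e^{-1/5}, so more than 5 log(1/ε)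
  -- rounds are needed.
  set R : ℕ := ⌈5 * Real.log (1 / ε)⌉₊ + 1 with hR
  have hR1 : 5 * Real.log (1 / ε) < R := by
    have := Nat.le_ceil (5 * Real.log (1 / ε))
    rw [hR]
    push_cast
    linarith
  have hR2 : (R : ℝ) ≤ 8 * Real.log (1 / ε) := by
    have := Nat.ceil_lt_add_one (show 0 ≤ 5 * Real.log (1 / ε) by linarith)
    rw [hR]
    push_cast
    linarith
  obtain ⟨l, a, b, -, htl, ha, -, hl⟩ := exists_transfer hn hp hT
    (show (0 : ℝ) < (7 / 8) ^ R / 200 by positivity)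
  rw [hz, Real.sqrt_zero, zero_add] at hl
  -- Without leakage, a negative measurement leaves a multiple of the initial vector up to the
  -- tolerance, so the same attempt can be repeated.
  have hm : nrm ((run n (l ++ [.measure])).mulVec (Pi.single 0 1) - Pi.single 0 a) ≤
      (7 / 8) ^ R / 200 := by
    have e : (run n (l ++ [.measure])).mulVec (Pi.single 0 1) - Pi.single 0 a =
        (run n [.measure]).mulVec ((run n l).mulVec (Pi.single 0 1) -
          (Pi.single 0 a + Pi.single (Fin.last (n + 1)) b)) := by
      rw [run_append, ← Matrix.mulVec_mulVec, Matrix.mulVec_sub]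
      congr 1
      simp only [run, Step.mat, Matrix.one_mul]
      rw [one_sub_lastProj]
      ext i
      have h0 : (0 : Fin (n + 2)) ≠ Fin.last (n + 1) := by simp [Fin.ext_iff]
      rw [Matrix.mulVec_diagonal]
      by_cases hi : i = Fin.last (n + 1)
      · subst hi
        simp [h0.symm]
      · simp [hi]
    rw [e]
    exact (nrm_run_mulVec_le _ _).trans hl
  refine ⟨(List.replicate R (l ++ [.measure])).flatten, ?_, ?_⟩
  · have : time [Step.measure] = 0 := by simp [time, Step.time]
    rw [time_replicate, time_append, this, add_zero]
    have h1 : time l ≤ 144 * ((n : ℝ) + 2) ^ (4 / 3 : ℝ) := by linarith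
    have h2 : 0 ≤ 144 * ((n : ℝ) + 2) ^ (4 / 3 : ℝ) := by positivity
    calc (R : ℝ) * time l ≤ R * (144 * ((n : ℝ) + 2) ^ (4 / 3 : ℝ)) := by gcongr
      _ ≤ 8 * Real.log (1 / ε) * (144 * ((n : ℝ) + 2) ^ (4 / 3 : ℝ)) := by gcongr
      _ = _ := by ring
  · have h := nrm_run_replicate_le ha R hm le_rfl
    have h1 : ((7 / 8 : ℝ) ^ R) ^ 2 = (49 / 64) ^ R := by rw [← pow_mul, mul_comm, pow_mul]; norm_num
    have h2 : (49 / 64 : ℝ) ≤ Real.exp (-(1 / 5)) := by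
      have := Real.add_one_le_exp (-(1 / 5) : ℝ)
      linarith
    have h3 : (49 / 64 : ℝ) ^ R ≤ Real.exp (-(1 / 5) * R) := by
      rw [mul_comm, Real.exp_nat_mul]
      gcongr
    calc nrm _ ^ 2 ≤ ((7 / 8 : ℝ) ^ R) ^ 2 := pow_le_pow_left₀ (nrm_nonneg _) h 2
      _ ≤ Real.exp (-(1 / 5) * R) := h1.trans_le h3
      _ < Real.exp (-Real.log (1 / ε)) := Real.exp_lt_exp.2 (by linarith)
      _ = ε := by rw [one_div, Real.log_inv, neg_neg, Real.exp_log hε]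

end Arrival

/-! ### Protocols for the cycles and for gates on the `b` qubits -/

section Gates

variable {n : ℕ}

/-- The probability 1/32 does not depend on N, which is stronger than a bound decaying with N. -/
lemma exists_protocol_linear {R : Set (Finset (Fin (n + 2)))} (hR : HasPhases R) :
    ∃ P : Protocol n R, P.duration ≤ 112 * ((n : ℝ) + 2) ∧
      P.Heralds (ket 0) (ket (Fin.last (n + 1))) (swapChain 0)
        (1 / 32 * ((n : ℝ) + 2) ^ (-(1 / 3) : ℝ)) := by
  obtain ⟨l, hl, h⟩ := exists_steps_linear n
  obtain ⟨P, hP, hPh⟩ := exists_heralds_of_steps hR l h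
  refine ⟨P, hP.trans_le hl, hPh.mono ?_⟩
  have : ((n : ℝ) + 2) ^ (-(1 / 3) : ℝ) ≤ 1 :=
    Real.rpow_le_one_of_one_le_of_nonpos (by linarith [(Nat.cast_nonneg n : (0 : ℝ) ≤ n)])
      (by norm_num)
  linarith

lemma exists_protocol_certain {R : Set (Finset (Fin (n + 2)))} (hR : HasPhases R) {ε : ℝ}
    (hε : 0 < ε) (hε' : ε ≤ 1 / 2) :
    ∃ P : Protocol n R,
      P.duration ≤ 1152 * ((n : ℝ) + 2) ^ (4 / 3 : ℝ) * Real.log (1 / ε) ∧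
      P.Heralds (ket 0) (ket (Fin.last (n + 1))) (swapChain 0) (1 - ε) := by
  obtain ⟨l, hl, h⟩ := exists_steps_certain n hε hε'
  obtain ⟨P, hP, hPh⟩ := exists_heralds_of_steps hR l (p := 1 - ε) (by linarith)
  exact ⟨P, hP.trans_le hl, hPh⟩

/-- The transfer achieves the exponent 4/3. The spare factor N^{1/3} is what absorbs a logarithm of
N in `implements_site₂`. -/
lemma duration_bound_le (n : ℕ) {ε : ℝ} (hε : 0 < ε) (hε' : ε ≤ 1 / 2) :
    1152 * ((n : ℝ) + 2) ^ (4 / 3 : ℝ) * Real.log (1 / ε) ≤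
      1152 * ((n : ℝ) + 2) ^ (5 / 3 : ℝ) * Real.log (1 / ε) := by
  have h : ((n : ℝ) + 2) ^ (4 / 3 : ℝ) ≤ ((n : ℝ) + 2) ^ (5 / 3 : ℝ) :=
    Real.rpow_le_rpow_of_exponent_le (by linarith [(Nat.cast_nonneg n : (0 : ℝ) ≤ n)])
      (by norm_num)
  have := (Real.log_nonneg one_le_two).trans (log_two_le_log_one_div hε hε')
  gcongr

/-- The operator `W` on the `b` register is implemented, with full control, within the time `T`
and with a failure probability less than `ε`. -/
def Implements (W : Op n) (T ε : ℝ) : Prop :=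
  ∃ P : Protocol n (fullControl n), P.duration ≤ T ∧ P.Heralds (vac n) (vac n) W (1 - ε)

lemma Implements.mono {W : Op n} {T T' ε ε' : ℝ} (h : Implements W T ε) (hT : T ≤ T')
    (hε : ε ≤ ε') : Implements W T' ε' :=
  let ⟨P, hP, hPh⟩ := h
  ⟨P, hP.trans hT, hPh.mono (by linarith)⟩

lemma Implements.mul {W W' : Op n} {T T' ε ε' : ℝ} (h : Implements W T ε)
    (h' : Implements W' T' ε') (hε : 0 ≤ ε) (hε₁ : ε ≤ 1) (hε' : 0 ≤ ε') (hε₁' : ε' ≤ 1) :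
    Implements (W * W') (T + T') (ε + ε') := by
  obtain ⟨P, hP, hPh⟩ := h
  obtain ⟨Q, hQ, hQh⟩ := h'
  refine ⟨Q.seq P, (Protocol.duration_seq_le Q P).trans (by linarith),
    (hQh.seq hPh (by linarith) (by linarith)).mono ?_⟩
  nlinarith [mul_nonneg hε hε']

/-- The control never fails, but the success bound is strict, hence an arbitrary δ > 0. -/
lemma implements_of_isControl {B : Op n} (h : IsControl (fullControl n) 1 B) {δ : ℝ} (hδ : 0 < δ) :
    Implements B 0 δ := by
  obtain ⟨Q, hQ, hQh⟩ := h.exists_heralds (p := 1 - δ) (v := vac n) (W := 1)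
    (by rw [Matrix.one_mulVec]; exact heralds_halt _ (by linarith))
  exact ⟨Q, hQ.le, by rwa [one_mul] at hQh⟩

lemma implements_one {δ : ℝ} (hδ : 0 < δ) : Implements (1 : Op n) 0 δ :=
  ⟨.halt true, le_rfl, heralds_halt _ (by linarith)⟩

lemma Implements.pow_mul {W V : Op n} {T T' ε ε' : ℝ} (h : Implements W T ε)
    (h' : Implements V T' ε') (hε : 0 ≤ ε) (hε' : 0 ≤ ε') {m : ℕ} (hm : m * ε + ε' ≤ 1) :
    Implements (W ^ m * V) (m * T + T') (m * ε + ε') := by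
  induction m with
  | zero => simpa using h'
  | succ m ih =>
    push_cast at hm
    have hmε : 0 ≤ (m : ℝ) * ε := by positivity
    have := h.mul (ih (by linarith)) hε (by linarith) (by linarith) (by linarith)
    rw [pow_succ', mul_assoc]
    exact this.mono (by push_cast; linarith) (by push_cast; linarith)

lemma exists_protocol_reset {δ : ℝ} (hδ : 0 < δ) : ∃ P : Protocol n (fullControl n),
    P.duration = 0 ∧ P.Heralds (ket (Fin.last (n + 1))) (vac n) 1 (1 - δ) := by
  obtain ⟨Q, hQ, hQh⟩ := (isControl_site (n := n) singleton_last_mem_full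
    pauliX_mem).exists_heralds (p := 1 - δ) (u := ket (Fin.last (n + 1))) (v := vac n) (W := 1)
    (by rw [pauliX_site_mulVec_ket]; exact heralds_halt _ (by linarith))
  exact ⟨Q, hQ, by rwa [one_mul] at hQh⟩

/-- One flip creates the excitation on spin s, and another removes it after it has arrived on the
last spin, so the `a` register returns to its vacuum. -/
lemma Protocol.Heralds.implements {s : Fin (n + 2)} {W : Op n} {P : Protocol n (fullControl n)}
    {ε δ : ℝ} (h : P.Heralds (ket s) (ket (Fin.last (n + 1))) W (1 - ε))
    (hs : IsControl (fullControl n) (site s pauliX) 1) (hε : 0 ≤ ε) (hε' : ε ≤ 1) (hδ : 0 < δ)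
    (hδ' : δ ≤ 1) : Implements W P.duration (ε + δ) := by
  obtain ⟨Q, hQ, hQh⟩ := exists_protocol_reset (n := n) hδ
  obtain ⟨S, hS, hSh⟩ := hs.exists_heralds (u := vac n)
    (P := P.seq Q) (v := vac n) (W := 1 * W) (p := (1 - ε) * (1 - δ))
    (by rw [pauliX_site_mulVec_vac]; exact h.seq hQh (by linarith) (by linarith))
  refine ⟨S, ?_, ?_⟩
  · rw [hS]
    exact (Protocol.duration_seq_le _ _).trans (by rw [hQ, add_zero])
  · rw [one_mul, mul_one] at hSh
    refine hSh.mono ?_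
    nlinarith [mul_nonneg hε hδ.le]

lemma implements_swapChain {ε : ℝ} (hε : 0 < ε) (hε' : ε ≤ 1 / 2) :
    Implements (swapChain (0 : Fin (n + 2)))
      (1152 * ((n : ℝ) + 2) ^ (4 / 3 : ℝ) * Real.log (2 / ε)) ε ∧
    Implements (swapChain (1 : Fin (n + 2)))
      (1152 * ((n : ℝ) + 2) ^ (4 / 3 : ℝ) * Real.log (2 / ε)) ε := by
  obtain ⟨P, hP, hPh⟩ := exists_protocol_certain (hasPhases_fullControl (n := n))
    (half_pos hε) (by linarith)
  obtain ⟨Q, hQ, hQh⟩ := exists_heralds_second hPh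
  rw [show 1 / (ε / 2) = 2 / ε by field_simp] at hP
  constructor
  · exact (hPh.implements (isControl_site_zero_full pauliX_mem) (half_pos hε).le (by linarith)
      (half_pos hε) (by linarith)).mono hP (by linarith)
  · exact (hQh.implements (isControl_site_one_full pauliX_mem) (half_pos hε).le (by linarith)
      (half_pos hε) (by linarith)).mono (hQ.trans_le hP) (by linarith)

/-- A product of transpositions is some permutation operator; its action on the configuration
excited only at `cyc s j` identifies the permutation. Bijectivity of `cyc` comes for free. -/
lemma exists_perm_eq_cyc (s : Fin (n + 2)) :
    ∃ σ : Equiv.Perm (Fin (n + 2)), swapChain s = permOp σ ∧ ∀ j, σ j = cyc s j := by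
  have h : ∃ σ : Equiv.Perm (Fin (n + 2)), (swapChain s : Op n) = permOp σ := by
    induction s using Fin.reverseInduction with
    | last => exact ⟨1, by rw [swapChain_last, permOp_one]⟩
    | cast i ih =>
      obtain ⟨σ, hσ⟩ := ih
      exact ⟨_, by rw [swapChain_castSucc, hσ, swapOp_eq_permOp, permOp_mul]⟩
  obtain ⟨σ, hσ⟩ := h
  refine ⟨σ, hσ, fun j => ?_⟩
  have h := swapChain_mulVec_single s (Pi.single (cyc s j) 1 : Cfg n)
  rw [hσ, permOp_mulVec_single] at h
  have h2 := congrFun h ((Pi.single (cyc s j) 1 : Cfg n) ∘ σ)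
  rw [Pi.single_eq_same, Pi.single_apply] at h2
  split_ifs at h2 with h3
  · have h4 := congrFun h3 j
    simp only [Function.comp_apply, Pi.single_eq_same, Pi.single_apply] at h4
    split_ifs at h4 with h5
    · exact h5
    · exact absurd h4 (by simp)
  · exact absurd h2 one_ne_zero

lemma cyc_one_iterate_val (l : ℕ) {j : Fin (n + 2)} (hj : j ≠ 0) :
    ((cyc 1)^[l] j : ℕ) = (j - 1 + l) % (n + 1) + 1 := by
  have hj0 : (j : ℕ) ≠ 0 := fun h => hj (Fin.ext h)
  have hj1 := j.isLt
  induction l with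
  | zero =>
    rw [Function.iterate_zero, id, add_zero, Nat.mod_eq_of_lt (by omega)]
    omega
  | succ l ih =>
    rw [Function.iterate_succ_apply']
    set y := (cyc (1 : Fin (n + 2)))^[l] j
    have hlt := Nat.mod_lt ((j : ℕ) - 1 + l) (Nat.succ_pos n)
    have hmod : (j - 1 + (l + 1)) % (n + 1) = (((j : ℕ) - 1 + l) % (n + 1) + 1) % (n + 1) := by
      rw [Nat.mod_add_mod, add_assoc]
    rw [hmod, ← ih]
    have hy : (1 : Fin (n + 2)) ≤ y := by
      rw [Fin.le_def, ih, Fin.val_one]; omega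
    rw [cyc]
    split_ifs with h1 h2
    · simp only
      rw [Nat.mod_eq_of_lt (Nat.lt_of_succ_lt_succ h1.2)]
    · rw [h2]; simp
    · refine absurd (Fin.ext ?_) h2
      rw [Fin.val_last]
      have : ¬ (y : ℕ) + 1 < n + 2 := fun h => h1 ⟨hy, h⟩
      have := y.isLt
      omega

/-- A pair of qubits may be brought to the front by cycles, and back. -/
lemma exists_perm_to_front {i j : Fin (n + 2)} (hij : i ≠ j) :
    ∃ (σ : Equiv.Perm (Fin (n + 2))) (m l m' l' : ℕ), m + m' = n + 2 ∧ l + l' = n + 1 ∧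
      σ 0 = i ∧ σ 1 = j ∧ permOp σ = (swapChain 1 ^ l * swapChain 0 ^ m : Op n) ∧
      permOp σ.symm = (swapChain 0 ^ m' * swapChain 1 ^ l' : Op n) := by
  obtain ⟨m, hm, l, hl, h⟩ := exists_cycles_to_front hij
  obtain ⟨-, h0, h1⟩ := h 0
  obtain ⟨σ₀, hσ₀, hc₀⟩ := exists_perm_eq_cyc (0 : Fin (n + 2))
  obtain ⟨σ₁, hσ₁, hc₁⟩ := exists_perm_eq_cyc (1 : Fin (n + 2))
  have e₀ : ∀ k, ⇑(σ₀ ^ k) = (cyc 0)^[k] := fun k => by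
    rw [Equiv.Perm.coe_pow, show ⇑σ₀ = cyc 0 from funext hc₀]
  have e₁ : ∀ k, ⇑(σ₁ ^ k) = (cyc 1)^[k] := fun k => by
    rw [Equiv.Perm.coe_pow, show ⇑σ₁ = cyc 1 from funext hc₁]
  have p₀ : σ₀ ^ (n + 2) = 1 := by
    ext k
    rw [e₀, cyc_zero_iterate_val, Nat.add_mod_right, Nat.mod_eq_of_lt k.isLt]
    rfl
  have p₁ : σ₁ ^ (n + 1) = 1 := by
    ext k
    rw [e₁]
    by_cases hk : k = 0
    · rw [hk, cyc_one_iterate_zero]; rfl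
    · have hk0 : (k : ℕ) ≠ 0 := fun h => hk (Fin.ext h)
      rw [cyc_one_iterate_val _ hk, Nat.add_mod_right, Nat.mod_eq_of_lt (by omega),
        Equiv.Perm.one_apply]
      omega
  -- The N-th power of the first cycle and the (N−1)-th power of the second are trivial, so the
  -- inverses are the complementary powers and no backward transfer is needed.
  refine ⟨σ₀ ^ m * σ₁ ^ l, m, l, n + 2 - m, n + 1 - l, by omega, by omega, ?_, ?_, ?_, ?_⟩
  · rw [Equiv.Perm.mul_apply, e₀, e₁]; exact h0
  · rw [Equiv.Perm.mul_apply, e₀, e₁]; exact h1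
  · rw [hσ₀, hσ₁, permOp_pow, permOp_pow, permOp_mul]
  · rw [hσ₀, hσ₁, permOp_pow, permOp_pow, permOp_mul]
    congr 1
    change (σ₀ ^ m * σ₁ ^ l)⁻¹ = _
    rw [mul_inv_rev]
    congr 1
    · rw [inv_eq_iff_mul_eq_one, ← pow_add, show l + (n + 1 - l) = n + 1 by omega, p₁]
    · rw [inv_eq_iff_mul_eq_one, ← pow_add, show m + (n + 2 - m) = n + 2 by omega, p₀]

/-- The pair is cycled to the first two spins, the gate is applied there, and the cycles are
completed. The powers add up to N + (N − 1) transfers. -/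
lemma implements_site₂ {j k : Fin (n + 2)} (hjk : j ≠ k)
    {V : Matrix (Fin 2 × Fin 2) (Fin 2 × Fin 2) ℂ}
    (hV : V ∈ Matrix.unitaryGroup (Fin 2 × Fin 2) ℂ) {ε : ℝ} (hε : 0 < ε) (hε' : ε ≤ 1 / 2) :
    Implements (site₂ j k V : Op n)
      (46080 * ((n : ℝ) + 2) ^ (8 / 3 : ℝ) * Real.log (1 / ε)) ε := by
  obtain ⟨σ, m, l, m', l', hm, hl, hσ0, hσ1, hσ, hσ'⟩ := exists_perm_to_front hjk
  set N : ℝ := (n : ℝ) + 2 with hN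
  have hN2 : 2 ≤ N := by linarith [(Nat.cast_nonneg n : (0 : ℝ) ≤ n)]
  have hN0 : 0 < N := by linarith
  -- 2N − 1 transfers and two error-free steps with a nominal ε₀ each cost at most (2N + 1) ε₀ ≤ ε.
  set ε₀ : ℝ := ε / (4 * N) with hε₀
  have hε₀pos : 0 < ε₀ := by positivity
  have hεN : 4 * N * ε₀ = ε := by rw [hε₀]; field_simp
  have hε₀le : ε₀ ≤ 1 / 2 := by nlinarith
  obtain ⟨hC₀, hC₁⟩ := implements_swapChain (n := n) hε₀pos hε₀le
  set T := 1152 * N ^ (4 / 3 : ℝ) * Real.log (2 / ε₀) with hT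
  have hm1 : (m : ℝ) + m' = N := by rw [hN]; exact_mod_cast hm
  have hl1 : (l : ℝ) + l' = N - 1 := by
    have : (l : ℝ) + l' = n + 1 := by exact_mod_cast hl
    rw [this, hN]; ring
  have hmε : (0 : ℝ) ≤ m * ε₀ := by positivity
  have hmε' : (0 : ℝ) ≤ m' * ε₀ := by positivity
  have hlε : (0 : ℝ) ≤ l * ε₀ := by positivity
  have hlε' : (0 : ℝ) ≤ l' * ε₀ := by positivity
  have htot : m * ε₀ + l * ε₀ + l' * ε₀ + m' * ε₀ = (2 * N - 1) * ε₀ := by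
    rw [← add_mul, ← add_mul, ← add_mul]
    congr 1
    linarith
  have hNε : (2 * N - 1) * ε₀ + 2 * ε₀ ≤ ε := by nlinarith
  have h1 := hC₀.pow_mul (implements_one (n := n) hε₀pos) hε₀pos.le hε₀pos.le (m := m)
    (by linarith)
  have h2 := hC₁.pow_mul h1 hε₀pos.le (by linarith) (m := l) (by linarith)
  have h3 := (implements_of_isControl (B := site₂ 0 1 V) (by
    rw [← site₂_one 0 1]
    exact isControl_site₂ pair_mem (one_mem _) hV) hε₀pos).mul h2 hε₀pos.le (by linarith)
      (by linarith) (by linarith)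
  have h4 := hC₁.pow_mul h3 hε₀pos.le (by linarith) (m := l') (by linarith)
  have h5 := hC₀.pow_mul h4 hε₀pos.le (by linarith) (m := m') (by linarith)
  have e : (swapChain 0 ^ m' * (swapChain 1 ^ l' * (site₂ 0 1 V * (swapChain 1 ^ l *
      (swapChain 0 ^ m * 1)))) : Op n) = site₂ j k V := by
    rw [← hσ0, ← hσ1, ← permOp_conj_site₂, hσ, hσ']
    simp only [mul_one, mul_assoc]
  rw [e] at h5
  refine h5.mono ?_ (by linarith)
  have hlog : 0.69 ≤ Real.log (1 / ε) := by
    linarith [log_two_le_log_one_div hε hε', Real.log_two_gt_d9]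
  have hx13 : 1 ≤ N ^ (1 / 3 : ℝ) := Real.one_le_rpow (by linarith) (by norm_num)
  -- The logarithm is log 8 + log N + log(1/ε). The term log N is bounded through N^{1/3}, and
  -- constants are absorbed because log(1/ε) ≥ log 2.
  have hlog2 : Real.log (2 / ε₀) ≤ 20 * N ^ (1 / 3 : ℝ) * Real.log (1 / ε) := by
    have e1 : 2 / ε₀ = 8 * N * (1 / ε) := by rw [hε₀]; field_simp; norm_num
    rw [e1, Real.log_mul (by positivity) (by positivity), Real.log_mul (by norm_num) hN0.ne']
    have h8 : Real.log 8 ≤ 2.1 := by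
      rw [show (8 : ℝ) = 2 ^ 3 by norm_num, Real.log_pow]
      push_cast
      linarith [Real.log_two_lt_d9]
    have h9 := one_add_log_le (show 1 ≤ N by linarith)
    nlinarith [mul_nonneg (sub_nonneg.2 hx13) (sub_nonneg.2 hlog)]
  have hT0 : T ≤ 23040 * N ^ (5 / 3 : ℝ) * Real.log (1 / ε) := by
    have e2 : N ^ (5 / 3 : ℝ) = N ^ (4 / 3 : ℝ) * N ^ (1 / 3 : ℝ) := by
      rw [← Real.rpow_add hN0]; norm_num
    calc T ≤ 1152 * N ^ (4 / 3 : ℝ) * (20 * N ^ (1 / 3 : ℝ) * Real.log (1 / ε)) := by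
          rw [hT]; gcongr
      _ = _ := by rw [e2]; ring
  have hT1 : 0 ≤ T := by
    rw [hT]
    have : 0 ≤ Real.log (2 / ε₀) := Real.log_nonneg (by rw [le_div_iff₀ hε₀pos]; linarith)
    positivity
  have e3 : N ^ (8 / 3 : ℝ) = N * N ^ (5 / 3 : ℝ) := by
    rw [show (8 / 3 : ℝ) = 1 + 5 / 3 by norm_num, Real.rpow_add hN0, Real.rpow_one]
  have htot : m' * T + (l' * T + (0 + (l * T + (m * T + 0)))) = (2 * N - 1) * T := by
    have : 2 * N - 1 = m' + (l' + (l + m)) := by linarith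
    rw [this]; ring
  rw [htot, e3]
  calc (2 * N - 1) * T ≤ 2 * N * T := by nlinarith
    _ ≤ 2 * N * (23040 * N ^ (5 / 3 : ℝ) * Real.log (1 / ε)) := by gcongr
    _ = _ := by ring

lemma exists_ne_fin (j : Fin (n + 2)) : ∃ k, j ≠ k := by
  obtain ⟨k, hk⟩ := exists_ne j
  exact ⟨k, hk.symm⟩

lemma implements_site (j : Fin (n + 2)) {V : Matrix (Fin 2) (Fin 2) ℂ}
    (hV : V ∈ Matrix.unitaryGroup (Fin 2) ℂ) {ε : ℝ} (hε : 0 < ε) (hε' : ε ≤ 1 / 2) :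
    Implements (site j V : Op n)
      (46080 * ((n : ℝ) + 2) ^ (8 / 3 : ℝ) * Real.log (1 / ε)) ε := by
  obtain ⟨k, hk⟩ := exists_ne_fin j
  rw [← site₂_kronecker_one hk]
  exact implements_site₂ hk (Matrix.kronecker_mem_unitary hV (one_mem _)) hε hε'

end Gates

/-! ### Universality of two-qubit gates -/

section Universality

variable {n : ℕ}

/-- The operators that are products of two-qubit gates. -/
def gateProducts (n : ℕ) : Submonoid (Op n) :=
  Submonoid.closure {A | ∃ j k : Fin (n + 2), j ≠ k ∧
    ∃ V ∈ Matrix.unitaryGroup (Fin 2 × Fin 2) ℂ, site₂ j k V = A}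

lemma site₂_mem_gateProducts {j k : Fin (n + 2)} (hjk : j ≠ k)
    {V : Matrix (Fin 2 × Fin 2) (Fin 2 × Fin 2) ℂ}
    (hV : V ∈ Matrix.unitaryGroup (Fin 2 × Fin 2) ℂ) : site₂ j k V ∈ gateProducts n :=
  Submonoid.subset_closure ⟨j, k, hjk, V, hV, rfl⟩

lemma site_mem_gateProducts (j : Fin (n + 2)) {V : Matrix (Fin 2) (Fin 2) ℂ}
    (hV : V ∈ Matrix.unitaryGroup (Fin 2) ℂ) : site j V ∈ gateProducts n := by
  obtain ⟨k, hk⟩ := exists_ne_fin j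
  rw [← site₂_kronecker_one hk]
  exact site₂_mem_gateProducts hk (Matrix.kronecker_mem_unitary hV (one_mem _))

lemma star_site₂ (j k : Fin (n + 2)) (V : Matrix (Fin 2 × Fin 2) (Fin 2 × Fin 2) ℂ) :
    star (site₂ j k V : Op n) = site₂ j k (star V) := by
  ext x y
  simp only [Matrix.star_apply, site₂, Matrix.of_apply]
  have : (∀ l, l ≠ j → l ≠ k → y l = x l) ↔ ∀ l, l ≠ j → l ≠ k → x l = y l :=
    ⟨fun h l h1 h2 => (h l h1 h2).symm, fun h l h1 h2 => (h l h1 h2).symm⟩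
  simp only [this]
  split_ifs <;> simp

lemma star_mem_gateProducts {A : Op n} (hA : A ∈ gateProducts n) : star A ∈ gateProducts n := by
  induction hA using Submonoid.closure_induction with
  | mem A hA =>
    obtain ⟨j, k, hjk, V, hV, rfl⟩ := hA
    rw [star_site₂]
    exact site₂_mem_gateProducts hjk (Unitary.star_mem hV)
  | one => rw [star_one]; exact one_mem _
  | mul A B _ _ hA hB => rw [star_mul]; exact mul_mem hB hA

lemma site₂_mulVec (j k : Fin (n + 2)) (hjk : j ≠ k)
    (A : Matrix (Fin 2 × Fin 2) (Fin 2 × Fin 2) ℂ) (v : Reg n) (x : Cfg n) :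
    (site₂ j k A).mulVec v x = ∑ b : Fin 2 × Fin 2,
      A (x j, x k) b * v (Function.update (Function.update x j b.1) k b.2) := by
  rw [Matrix.mulVec, dotProduct]
  refine (Fintype.sum_of_injective (fun b : Fin 2 × Fin 2 =>
    Function.update (Function.update x j b.1) k b.2) ?_ _ _ ?_ ?_).symm
  · rintro ⟨a, b⟩ ⟨c, d⟩ h
    have h1 := congrFun h j
    have h2 := congrFun h k
    simp [hjk] at h1 h2
    rw [h1, h2]
  · intro y hy
    rw [site₂, Matrix.of_apply, if_neg, zero_mul]
    intro h
    refine hy ⟨(y j, y k), ?_⟩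
    ext l
    by_cases hk : l = k
    · subst hk; simp
    · by_cases hj : l = j
      · subst hj; simp [hjk]
      · simp [hk, hj, h l hj hk]
  · rintro ⟨a, b⟩
    rw [site₂, Matrix.of_apply, if_pos]
    · simp [hjk]
    · intro l hj hk
      simp [hj, hk]

lemma star_site₂_mul_self {j k : Fin (n + 2)} (hjk : j ≠ k)
    {V : Matrix (Fin 2 × Fin 2) (Fin 2 × Fin 2) ℂ}
    (hV : V ∈ Matrix.unitaryGroup (Fin 2 × Fin 2) ℂ) :
    star (site₂ j k V : Op n) * site₂ j k V = 1 := by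
  rw [star_site₂]
  refine Matrix.ext_of_mulVec_single fun y => ?_
  ext x
  rw [← Matrix.mulVec_mulVec, site₂_mulVec _ _ hjk]
  set v : Reg n := Pi.single y 1
  have h : ∀ b : Fin 2 × Fin 2, (site₂ j k V).mulVec v
      (Function.update (Function.update x j b.1) k b.2) = ∑ c : Fin 2 × Fin 2,
        V b c * v (Function.update (Function.update x j c.1) k c.2) := by
    intro b
    rw [site₂_mulVec _ _ hjk]
    refine Finset.sum_congr rfl fun c _ => ?_
    congr 2
    · simp [hjk]
    · ext l
      by_cases hk : l = k
      · subst hk; simp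
      · by_cases hj : l = j
        · subst hj; simp [hjk]
        · simp [hk, hj]
  simp_rw [h, Finset.mul_sum]
  rw [Finset.sum_comm]
  have hu := (Matrix.mem_unitaryGroup_iff').1 hV
  have h2 : ∀ c, ∑ b, star V (x j, x k) b *
      (V b c * v (Function.update (Function.update x j c.1) k c.2)) =
      (1 : Matrix (Fin 2 × Fin 2) (Fin 2 × Fin 2) ℂ) (x j, x k) c *
        v (Function.update (Function.update x j c.1) k c.2) := by
    intro c
    rw [← hu, Matrix.mul_apply, Finset.sum_mul]
    exact Finset.sum_congr rfl fun b _ => (mul_assoc _ _ _).symm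
  simp_rw [h2]
  rw [Finset.sum_eq_single (x j, x k)]
  · simp
  · intro c _ hc
    rw [Matrix.one_apply_ne hc.symm, zero_mul]
  · simp

lemma star_mul_self_of_mem_gateProducts {A : Op n} (hA : A ∈ gateProducts n) :
    star A * A = 1 := by
  induction hA using Submonoid.closure_induction with
  | mem A hA =>
    obtain ⟨j, k, hjk, V, hV, rfl⟩ := hA
    exact star_site₂_mul_self hjk hV
  | one => simp
  | mul A B _ _ hA hB =>
    rw [star_mul, mul_assoc, ← mul_assoc (star A), hA, one_mul, hB]

lemma site_mulVec (p : Fin (n + 2)) (A : Matrix (Fin 2) (Fin 2) ℂ) (v : Reg n) (x : Cfg n) :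
    (site p A).mulVec v x = ∑ b, A (x p) b * v (Function.update x p b) := by
  rw [Matrix.mulVec, dotProduct]
  refine (Fintype.sum_of_injective (fun b : Fin 2 => Function.update x p b)
    (Function.update_injective x p) _ _ ?_ ?_).symm
  · intro y hy
    rw [site, Matrix.of_apply, if_neg, zero_mul]
    intro h
    refine hy ⟨y p, ?_⟩
    ext l
    by_cases hl : l = p
    · subst hl; simp
    · simp [hl, h l hl]
  · intro b
    rw [site, Matrix.of_apply, if_pos]
    · simp
    · intro l hl
      simp [hl]

/-! Diagonal operators. -/

/-- The diagonal operator with the phases `f`. -/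
def phaseOp (f : Cfg n → ℝ) : Op n := Matrix.diagonal fun x => Complex.exp (f x * Complex.I)

/-- The phases `f` such that all multiples of `f` are obtained by products of gates. -/
def phaseSpace (n : ℕ) : Submodule ℝ (Cfg n → ℝ) where
  carrier := {f | ∀ t : ℝ, phaseOp (t • f) ∈ gateProducts n}
  add_mem' {f g} hf hg t := by
    have h : phaseOp (t • (f + g)) = phaseOp (t • f) * phaseOp (t • g) := by
      rw [phaseOp, phaseOp, phaseOp, Matrix.diagonal_mul_diagonal]
      congr 1
      ext x
      rw [← Complex.exp_add, smul_add, Pi.add_apply]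
      push_cast
      ring_nf
    rw [h]
    exact mul_mem (hf t) (hg t)
  zero_mem' t := by
    have h : phaseOp (t • (0 : Cfg n → ℝ)) = 1 := by simp [phaseOp]
    rw [h]
    exact one_mem _
  smul_mem' c f hf t := by
    rw [smul_smul]
    exact hf _

/-- The eigenvalues of `Z`. -/
def zSign (a : Fin 2) : ℝ := if a = 0 then 1 else -1

lemma zSign_add (a b : Fin 2) : zSign (a + b) = zSign a * zSign b := by
  fin_cases a <;> fin_cases b <;> simp [zSign]

lemma zSign_mul_self (a : Fin 2) : zSign a * zSign a = 1 := by
  fin_cases a <;> simp [zSign]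

/-- The action of the controlled NOT with control `j` and target `i` on the computational basis. -/
def cnotMap (j i : Fin (n + 2)) (x : Cfg n) : Cfg n := Function.update x i (x j + x i)

lemma cnotMap_cnotMap {j i : Fin (n + 2)} (hji : j ≠ i) (x : Cfg n) :
    cnotMap j i (cnotMap j i x) = x := by
  ext l
  by_cases hl : l = i
  · subst hl
    have : ∀ a b : Fin 2, a + (a + b) = b := by decide
    simp [cnotMap, hji, this]
  · simp [cnotMap, hl]

/-- The matrix of the controlled NOT. -/
def cnotMat : Matrix (Fin 2 × Fin 2) (Fin 2 × Fin 2) ℂ :=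
  Matrix.of fun a b => if a = (b.1, b.1 + b.2) then 1 else 0

lemma cnotMat_mem : cnotMat ∈ Matrix.unitaryGroup (Fin 2 × Fin 2) ℂ := by
  rw [Matrix.mem_unitaryGroup_iff']
  ext a b
  rw [Matrix.mul_apply, Finset.sum_eq_single (b.1, b.1 + b.2)]
  · obtain ⟨a1, a2⟩ := a
    obtain ⟨b1, b2⟩ := b
    fin_cases a1 <;> fin_cases a2 <;> fin_cases b1 <;> fin_cases b2 <;>
      simp [cnotMat]
  · intro c _ hc
    simp [cnotMat, hc]
  · simp

lemma site₂_cnotMat {j i : Fin (n + 2)} (hji : j ≠ i) (x y : Cfg n) :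
    site₂ j i cnotMat x y = if x = cnotMap j i y then 1 else 0 := by
  simp only [site₂, cnotMat, Matrix.of_apply, Prod.mk.injEq]
  rw [← ite_and]
  refine if_congr ⟨fun ⟨h, h1, h2⟩ => ?_, fun h => ?_⟩ rfl rfl
  · ext l
    by_cases hl : l = i
    · subst hl; simp [cnotMap, h2]
    · by_cases hj : l = j
      · subst hj; simp [cnotMap, hji, h1]
      · simp [cnotMap, hl, h l hj hl]
  · subst h
    refine ⟨fun l _ hl => ?_, ?_, ?_⟩
    · simp [cnotMap, hl]
    · simp [cnotMap, hji]
    · simp [cnotMap]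

/-- A controlled NOT permutes the computational basis, so conjugation with it permutes the entries
of a diagonal operator. -/
lemma comp_cnotMap_mem_phaseSpace {j i : Fin (n + 2)} (hji : j ≠ i) {f : Cfg n → ℝ}
    (hf : f ∈ phaseSpace n) : f ∘ cnotMap j i ∈ phaseSpace n := by
  intro t
  have h : phaseOp (t • (f ∘ cnotMap j i)) =
      star (site₂ j i cnotMat) * phaseOp (t • f) * site₂ j i cnotMat := by
    ext x y
    rw [Matrix.mul_apply, Finset.sum_eq_single (cnotMap j i y)]
    · rw [phaseOp, phaseOp, Matrix.mul_diagonal, Matrix.star_apply, site₂_cnotMat hji,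
        site₂_cnotMat hji, if_pos rfl, mul_one, Matrix.diagonal_apply]
      by_cases hxy : x = y
      · subst hxy
        simp
      · have : cnotMap j i y ≠ cnotMap j i x := fun h => hxy (by
          rw [← cnotMap_cnotMap hji x, ← h, cnotMap_cnotMap hji])
        simp [hxy, this]
    · intro z _ hz
      rw [site₂_cnotMat hji z y, if_neg hz, mul_zero]
    · simp
  rw [h]
  have hc := site₂_mem_gateProducts hji cnotMat_mem (n := n)
  exact mul_mem (mul_mem (star_mem_gateProducts hc) (hf t)) hc

/-- The parity of the qubits in `S`. -/
def parity (S : Finset (Fin (n + 2))) (x : Cfg n) : ℝ := ∏ l ∈ S, zSign (x l)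

lemma diagonal_exp_mem {g : Fin 2 → ℝ} :
    Matrix.diagonal (fun a => Complex.exp (g a * Complex.I)) ∈ Matrix.unitaryGroup (Fin 2) ℂ := by
  rw [Matrix.mem_unitaryGroup_iff', Matrix.star_eq_conjTranspose, Matrix.diagonal_conjTranspose,
    Matrix.diagonal_mul_diagonal, ← Matrix.diagonal_one]
  congr 1
  ext a
  rw [Pi.star_apply, Complex.star_def, ← Complex.exp_conj, ← Complex.exp_add]
  simp

lemma mem_phaseSpace_of_single (p : Fin (n + 2)) (g : Fin 2 → ℝ) :
    (fun x : Cfg n => g (x p)) ∈ phaseSpace n := by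
  intro t
  have h : phaseOp (t • fun x : Cfg n => g (x p)) =
      site p (Matrix.diagonal fun a => Complex.exp (((t • g) a : ℝ) * Complex.I)) := by
    ext x y
    simp only [phaseOp, site, Matrix.of_apply, Matrix.diagonal_apply, Pi.smul_apply]
    rw [← ite_and]
    refine if_congr ⟨?_, fun ⟨h, h'⟩ => ?_⟩ rfl rfl
    · rintro rfl; simp
    · ext l
      by_cases hl : l = p
      · rw [hl, h']
      · rw [h l hl]
  rw [h]
  exact site_mem_gateProducts p diagonal_exp_mem

/-- A controlled NOT from j onto some i in S replaces the sign of qubit i by the product of the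
signs of i and j, so it adjoins j to the parity of S. A single qubit is a one-qubit gate. -/
lemma parity_mem_phaseSpace (S : Finset (Fin (n + 2))) : parity S ∈ phaseSpace n := by
  induction S using Finset.induction_on with
  | empty =>
    have : (parity ∅ : Cfg n → ℝ) = fun x => (fun _ => 1 : Fin 2 → ℝ) (x 0) := by
      ext x; simp [parity]
    rw [this]
    exact mem_phaseSpace_of_single 0 fun _ => 1
  | insert j S hj ih =>
    rcases S.eq_empty_or_nonempty with rfl | ⟨i, hi⟩
    · have : (parity (insert j ∅) : Cfg n → ℝ) = fun x => zSign (x j) := by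
        ext x; simp [parity]
      rw [this]
      exact mem_phaseSpace_of_single j _
    · have hji : j ≠ i := fun h => hj (h ▸ hi)
      have : parity (insert j S) = parity S ∘ cnotMap j i := by
        ext x
        rw [Function.comp_apply, parity, parity, Finset.prod_insert hj,
          ← Finset.mul_prod_erase S _ hi, ← Finset.mul_prod_erase S _ hi, ← mul_assoc, ← zSign_add]
        congr 1
        · simp [cnotMap]
        · refine Finset.prod_congr rfl fun l hl => ?_
          simp [cnotMap, Finset.ne_of_mem_erase hl]
      rw [this]
      exact comp_cnotMap_mem_phaseSpace hji ih

/-- Parities are the characters of (ℤ/2)^N: expanding ∏ (1 + z_l(c) z_l(x)) / 2 writes the indicator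
of c as a combination of them. -/
lemma phaseSpace_eq_top : phaseSpace n = ⊤ := by
  have hsingle : ∀ c : Cfg n, (Pi.single c 1 : Cfg n → ℝ) ∈ phaseSpace n := by
    intro c
    have h : (Pi.single c 1 : Cfg n → ℝ) = ∑ S ∈ (Finset.univ : Finset (Fin (n + 2))).powerset,
        ((1 / 2) ^ (n + 2) * parity S c) • parity S := by
      ext x
      have e : (1 / 2 : ℝ) ^ (n + 2) * ∏ l, (1 + zSign (c l) * zSign (x l)) =
          (Pi.single c 1 : Cfg n → ℝ) x := by
        by_cases hx : x = c
        · subst hx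
          simp only [zSign_mul_self, Finset.prod_const, Finset.card_univ, Fintype.card_fin,
            Pi.single_eq_same]
          rw [← mul_pow]
          norm_num
        · obtain ⟨l, hl⟩ := Function.ne_iff.1 hx
          rw [Pi.single_eq_of_ne hx, Finset.prod_eq_zero (Finset.mem_univ l), mul_zero]
          have : ∀ a b : Fin 2, a ≠ b → 1 + zSign b * zSign a = 0 := by
            intro a b hab
            fin_cases a <;> fin_cases b <;> simp_all [zSign]
          exact this _ _ hl
      rw [← e, Finset.prod_one_add, Finset.mul_sum, Finset.sum_apply]
      refine Finset.sum_congr rfl fun S _ => ?_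
      rw [Pi.smul_apply, smul_eq_mul, parity, parity, mul_assoc, ← Finset.prod_mul_distrib]
    rw [h]
    exact Submodule.sum_mem _ fun S _ => Submodule.smul_mem _ _ (parity_mem_phaseSpace S)
  rw [eq_top_iff]
  intro f _
  rw [pi_eq_sum_univ' f]
  exact Submodule.sum_mem _ fun c _ => Submodule.smul_mem _ _ (hsingle c)

lemma phaseOp_mem_gateProducts (f : Cfg n → ℝ) : phaseOp f ∈ gateProducts n := by
  have h : f ∈ phaseSpace n := by rw [phaseSpace_eq_top]; trivial
  simpa using h 1

end Universality

/-! ### Every unitary is a product of two-qubit gates -/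

section Decomposition

variable {n : ℕ}

lemma exists_mulVec_eq_norm (v : Reg n) :
    ∃ A ∈ gateProducts n, A.mulVec v = fun x => (‖v x‖ : ℂ) := by
  refine ⟨_, phaseOp_mem_gateProducts fun x => -Complex.arg (v x), ?_⟩
  ext x
  rw [phaseOp, Matrix.mulVec_diagonal]
  nth_rw 2 [← Complex.norm_mul_exp_arg_mul_I (v x)]
  rw [mul_left_comm, ← Complex.exp_add]
  simp

/-- The change of basis between `Z` and `Y`. -/
def basisY : Matrix (Fin 2) (Fin 2) ℂ := (√2 : ℂ)⁻¹ • !![1, -Complex.I; 1, Complex.I]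

/-- The change of basis between `Z` and `X`. -/
def basisX : Matrix (Fin 2) (Fin 2) ℂ := (√2 : ℂ)⁻¹ • !![1, 1; 1, -1]

lemma inv_sqrt_two_mul_self : (√2 : ℂ)⁻¹ * (√2 : ℂ)⁻¹ = 1 / 2 := by
  rw [← mul_inv, ← Complex.ofReal_mul, Real.mul_self_sqrt (by norm_num)]
  norm_num

lemma basisY_mem : basisY ∈ Matrix.unitaryGroup (Fin 2) ℂ := by
  rw [Matrix.mem_unitaryGroup_iff, basisY, star_smul, Matrix.smul_mul, Matrix.mul_smul, smul_smul,
    Complex.star_def, map_inv₀, Complex.conj_ofReal, inv_sqrt_two_mul_self]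
  ext i j
  rw [Matrix.smul_apply, Matrix.mul_apply, Fin.sum_univ_two, Matrix.star_apply, Matrix.star_apply]
  fin_cases i <;> fin_cases j <;> simp <;> norm_num

lemma basisX_mem : basisX ∈ Matrix.unitaryGroup (Fin 2) ℂ := by
  rw [Matrix.mem_unitaryGroup_iff, basisX, star_smul, Matrix.smul_mul, Matrix.mul_smul, smul_smul,
    Complex.star_def, map_inv₀, Complex.conj_ofReal, inv_sqrt_two_mul_self]
  ext i j
  rw [Matrix.smul_apply, Matrix.mul_apply, Fin.sum_univ_two, Matrix.star_apply, Matrix.star_apply]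
  fin_cases i <;> fin_cases j <;> simp <;> norm_num

/-- The qubit `p` may be disentangled, keeping the qubits that are already in `|0⟩`. -/
lemma exists_mulVec_clear (p : Fin (n + 2)) (v : Reg n) : ∃ A ∈ gateProducts n,
    (∀ x, x p ≠ 0 → A.mulVec v x = 0) ∧
      ∀ x, (∀ b, v (Function.update x p b) = 0) → A.mulVec v x = 0 := by
  obtain ⟨A₁, h₁, e₁⟩ := exists_mulVec_eq_norm v
  -- On nonnegative amplitudes (a, b) this gives (a ∓ ib)/√2, of equal modulus. Once the phases are
  -- removed the two are equal, and `basisX` empties the value 1. Everything acts within pairs that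
  -- differ at p only, so pairs with zero amplitude stay zero.
  set w : Reg n := (site p basisY).mulVec fun x => (‖v x‖ : ℂ) with hw
  obtain ⟨A₂, h₂, e₂⟩ := exists_mulVec_eq_norm w
  have hwx : ∀ x : Cfg n, w x = basisY (x p) 0 * ‖v (Function.update x p 0)‖ +
      basisY (x p) 1 * ‖v (Function.update x p 1)‖ := fun x => by
    rw [hw, site_mulVec, Fin.sum_univ_two]
  have e : (site p basisX * A₂ * site p basisY * A₁).mulVec v =
      (site p basisX).mulVec fun x => (‖w x‖ : ℂ) := by
    rw [← Matrix.mulVec_mulVec, ← Matrix.mulVec_mulVec, ← Matrix.mulVec_mulVec, e₁, ← hw, e₂]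
  refine ⟨_, mul_mem (mul_mem (mul_mem (site_mem_gateProducts p basisX_mem) h₂)
    (site_mem_gateProducts p basisY_mem)) h₁, fun x hx => ?_, fun x hx => ?_⟩
  · have hx1 : x p = 1 := by
      generalize x p = a at hx
      fin_cases a
      · exact absurd rfl hx
      · rfl
    have h01 : w (Function.update x p 1) = starRingEnd ℂ (w (Function.update x p 0)) := by
      rw [hwx, hwx]
      simp [basisY]
    rw [e, site_mulVec, Fin.sum_univ_two, h01, RCLike.norm_conj, hx1]
    simp [basisX]
  · rw [e, site_mulVec, Fin.sum_univ_two, hwx, hwx]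
    simp [hx]

/-- The qubits are cleared one after the other; the second clause of `exists_mulVec_clear` protects
those already cleared. -/
lemma exists_mulVec_eq_single (v : Reg n) :
    ∃ A ∈ gateProducts n, ∃ r : ℂ, A.mulVec v = Pi.single 0 r := by
  have h : ∀ S : Finset (Fin (n + 2)), ∃ A ∈ gateProducts n,
      ∀ x : Cfg n, (∃ l ∈ S, x l ≠ 0) → A.mulVec v x = 0 := by
    intro S
    induction S using Finset.induction_on with
    | empty => exact ⟨1, one_mem _, by simp⟩
    | insert p S hp ih =>
      obtain ⟨A, hA, hAx⟩ := ih
      obtain ⟨B, hB, hB1, hB2⟩ := exists_mulVec_clear p (A.mulVec v)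
      refine ⟨B * A, mul_mem hB hA, fun x ⟨l, hl, hlx⟩ => ?_⟩
      rw [← Matrix.mulVec_mulVec]
      rcases Finset.mem_insert.1 hl with rfl | hl
      · exact hB1 x hlx
      · refine hB2 x fun b => hAx _ ⟨l, hl, ?_⟩
        have : l ≠ p := fun h => hp (h ▸ hl)
        simpa [this] using hlx
  obtain ⟨A, hA, hAx⟩ := h Finset.univ
  refine ⟨A, hA, A.mulVec v 0, ?_⟩
  ext x
  by_cases hx : x = 0
  · subst hx; simp
  · obtain ⟨l, hl⟩ := Function.ne_iff.1 hx
    rw [hAx x ⟨l, Finset.mem_univ _, hl⟩, Pi.single_eq_of_ne hx]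

lemma vecMulVec_single_zero (r : ℂ) :
    Matrix.vecMulVec (Pi.single 0 r : Reg n) (star (Pi.single 0 r)) =
      Matrix.diagonal (Pi.single 0 (r * star r)) := by
  ext x y
  rw [Matrix.vecMulVec_apply, Pi.star_apply, Matrix.diagonal_apply]
  by_cases hx : x = 0
  · subst hx
    by_cases hy : 0 = y
    · subst hy; simp
    · simp [hy, Ne.symm hy]
  · by_cases hxy : x = y
    · subst hxy; simp [hx]
    · simp [hx, hxy]

/-- Complex reflections are products of gates. -/
lemma reflection_mem_gateProducts (u : Reg n) {c : ℂ}
    (hc : ‖1 - c * (star u ⬝ᵥ u)‖ = 1) :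
    1 - c • Matrix.vecMulVec u (star u) ∈ gateProducts n := by
  -- In the frame where u points along |0…0⟩, the reflection is a phase on one basis state.
  obtain ⟨A, hA, r, hr⟩ := exists_mulVec_eq_single u
  have hAA := star_mul_self_of_mem_gateProducts hA
  have hu : u = (star A).mulVec (Pi.single 0 r) := by
    rw [← hr, Matrix.mulVec_mulVec, hAA, Matrix.one_mulVec]
  have hAA' : A * star A = 1 := mul_eq_one_comm.1 hAA
  have hnorm : star u ⬝ᵥ u = r * star r := by
    have h1 : star u ⬝ᵥ u = star (A.mulVec u) ⬝ᵥ A.mulVec u := by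
      rw [Matrix.star_mulVec, Matrix.dotProduct_mulVec, Matrix.vecMul_vecMul,
        ← Matrix.star_eq_conjTranspose, hAA, Matrix.vecMul_one]
    rw [h1, hr]
    simp [dotProduct, Pi.single_apply, mul_comm]
  have hvec : Matrix.vecMulVec u (star u) =
      star A * Matrix.diagonal (Pi.single 0 (r * star r)) * A := by
    rw [← vecMulVec_single_zero, ← hr, Matrix.mul_vecMulVec, Matrix.vecMulVec_mul,
      Matrix.mulVec_mulVec, hAA, Matrix.one_mulVec, Matrix.star_mulVec, Matrix.vecMul_vecMul,
      ← Matrix.star_eq_conjTranspose, hAA, Matrix.vecMul_one]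
  set z := 1 - c * (star u ⬝ᵥ u) with hz
  have hphase : phaseOp (Pi.single 0 (Complex.arg z)) =
      1 - c • Matrix.diagonal (Pi.single 0 (r * star r) : Reg n) := by
    rw [phaseOp, ← Matrix.diagonal_one, ← Matrix.diagonal_smul, Matrix.diagonal_sub]
    congr 1
    ext x
    by_cases hx : x = 0
    · subst hx
      have := Complex.norm_mul_exp_arg_mul_I z
      rw [hc, Complex.ofReal_one, one_mul] at this
      rw [Pi.single_eq_same, this, hz, hnorm]
      simp
    · simp [hx]
  have e : 1 - c • Matrix.vecMulVec u (star u) =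
      star A * phaseOp (Pi.single 0 (Complex.arg z)) * A := by
    rw [hphase, hvec, mul_sub, sub_mul, mul_one, hAA, Matrix.mul_smul, Matrix.smul_mul]
  rw [e]
  exact mul_mem (mul_mem (star_mem_gateProducts hA) (phaseOp_mem_gateProducts _)) hA

open scoped ComplexOrder in
lemma eq_zero_of_star_dotProduct_self {u : Reg n} (h : star u ⬝ᵥ u = 0) : u = 0 :=
  dotProduct_star_self_eq_zero.1 h

/-- Householder induction on the number of basis vectors not known to be fixed. Reflecting along u =
W e_b − e_b sends W e_b to e_b; a basis vector fixed by W is orthogonal to both, hence to u, and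
stays fixed. -/
lemma mem_gateProducts_of_fixed {W : Op n} (hW : W ∈ Matrix.unitaryGroup (Cfg n) ℂ)
    (S : Finset (Cfg n)) (hS : ∀ a ∉ S, W.mulVec (Pi.single a 1) = Pi.single a 1) :
    W ∈ gateProducts n := by
  induction S using Finset.induction_on generalizing W with
  | empty =>
    have : W = 1 := Matrix.ext_of_mulVec_single fun a => by
      rw [hS a (Finset.notMem_empty a), Matrix.one_mulVec]
    rw [this]
    exact one_mem _
  | insert b S hb ih =>
    have hWW := (Matrix.mem_unitaryGroup_iff').1 hW
    have hiso : ∀ x y : Reg n, star (W.mulVec x) ⬝ᵥ W.mulVec y = star x ⬝ᵥ y := by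
      intro x y
      rw [Matrix.star_mulVec, Matrix.dotProduct_mulVec, Matrix.vecMul_vecMul,
        ← Matrix.star_eq_conjTranspose, hWW, Matrix.vecMul_one]
    set w := W.mulVec (Pi.single b 1) with hw
    by_cases hwb : w = Pi.single b 1
    · refine ih hW fun a ha => ?_
      by_cases hab : a = b
      · rw [hab, ← hw, hwb]
      · exact hS a (by simp [hab, ha])
    set u : Reg n := w - Pi.single b 1 with hu
    set ω : ℂ := w b with hω
    have hww : star w ⬝ᵥ w = 1 := by
      rw [hw, hiso]
      simp [dotProduct, Pi.single_apply]
    have hbw : star (Pi.single b 1 : Reg n) ⬝ᵥ w = ω := by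
      rw [hω]
      simp [dotProduct, Pi.single_apply]
    have hwb' : star w ⬝ᵥ (Pi.single b 1 : Reg n) = star ω := by
      rw [hω]
      simp [dotProduct, Pi.single_apply]
    have hbb : star (Pi.single b 1 : Reg n) ⬝ᵥ (Pi.single b 1 : Reg n) = 1 := by
      simp [dotProduct, Pi.single_apply]
    have huw : star u ⬝ᵥ w = 1 - ω := by
      rw [hu, star_sub, sub_dotProduct, hww, hbw]
    have hub : star u ⬝ᵥ (Pi.single b 1 : Reg n) = star ω - 1 := by
      rw [hu, star_sub, sub_dotProduct, hwb', hbb]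
    have huu : star u ⬝ᵥ u = (1 - ω) + (1 - star ω) := by
      have : star u ⬝ᵥ u = star u ⬝ᵥ w - star u ⬝ᵥ (Pi.single b 1 : Reg n) := by
        rw [← dotProduct_sub, ← hu]
      rw [this, huw, hub]
      ring
    have hω1 : 1 - ω ≠ 0 := by
      intro h
      have h1 : star u ⬝ᵥ u = 0 := by
        have h2 : star ω = 1 := by rw [← sub_eq_zero.1 h, star_one]
        rw [huu, h, h2, sub_self, zero_add]
      exact hwb (sub_eq_zero.1 (eq_zero_of_star_dotProduct_self h1))
    -- As ⟨u, w⟩ = 1 − ω, this coefficient gives ρ w = w − u. Its eigenvalue along u is −conj(1 −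
    -- ω)/(1 − ω), of modulus one, so ρ is unitary.
    set ρ : Op n := 1 - (1 - ω)⁻¹ • Matrix.vecMulVec u (star u) with hρ
    have hρm : ρ ∈ gateProducts n := by
      refine reflection_mem_gateProducts u ?_
      have : 1 - (1 - ω)⁻¹ * (star u ⬝ᵥ u) = -(star (1 - ω) / (1 - ω)) := by
        rw [huu, star_sub, star_one]
        field_simp
        ring
      rw [this, norm_neg, norm_div, norm_star, div_self (norm_ne_zero_iff.2 hω1)]
    have hρx : ∀ x : Reg n, ρ.mulVec x = x - ((1 - ω)⁻¹ * (star u ⬝ᵥ x)) • u := by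
      intro x
      rw [hρ, Matrix.sub_mulVec, Matrix.one_mulVec, Matrix.smul_mulVec, Matrix.vecMulVec_mulVec,
        mul_smul]
      congr 2
      ext l
      simp [mul_comm]
    have hρu : star ρ * ρ = 1 := star_mul_self_of_mem_gateProducts hρm
    have hρU : ρ ∈ Matrix.unitaryGroup (Cfg n) ℂ := (Matrix.mem_unitaryGroup_iff').2 hρu
    have hprod : ρ * W ∈ gateProducts n := by
      refine ih (mul_mem hρU hW) fun a ha => ?_
      rw [← Matrix.mulVec_mulVec, hρx]
      by_cases hab : a = b
      · rw [hab, ← hw, huw, inv_mul_cancel₀ hω1, one_smul, hu, sub_sub_cancel]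
      · have hfix := hS a (by simp [hab, ha])
        have hwa : star w ⬝ᵥ (Pi.single a 1 : Reg n) = 0 := by
          rw [hw, ← hfix, hiso]
          simp [dotProduct, Pi.single_apply, hab]
        have hba : star (Pi.single b 1 : Reg n) ⬝ᵥ (Pi.single a 1 : Reg n) = 0 := by
          simp [dotProduct, Pi.single_apply, hab]
        rw [hfix, hu, star_sub, sub_dotProduct, hwa, hba, sub_zero, mul_zero, zero_smul, sub_zero]
    have : W = star ρ * (ρ * W) := by rw [← mul_assoc, hρu, one_mul]
    rw [this]
    exact mul_mem (star_mem_gateProducts hρm) hprod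

theorem mem_gateProducts {W : Op n} (hW : W ∈ Matrix.unitaryGroup (Cfg n) ℂ) :
    W ∈ gateProducts n :=
  mem_gateProducts_of_fixed hW Finset.univ fun a ha => absurd (Finset.mem_univ a) ha

theorem exists_implements {W : Op n} (hW : W ∈ Matrix.unitaryGroup (Cfg n) ℂ) {ε : ℝ}
    (hε : 0 < ε) : ∃ T, Implements W T ε := by
  have h := mem_gateProducts hW
  clear hW
  induction h using Submonoid.closure_induction generalizing ε with
  | mem A hA =>
    obtain ⟨j, k, hjk, V, hV, rfl⟩ := hA
    exact ⟨_, (implements_site₂ hjk hV (lt_min hε one_half_pos) (min_le_right _ _)).mono le_rfl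
      (min_le_left _ _)⟩
  | one => exact ⟨0, implements_one hε⟩
  | mul A B _ _ hA hB =>
    -- ε may be large here, while composition requires failure bounds of at most 1.
    have hm : 0 < min (ε / 2) 1 := lt_min (half_pos hε) one_pos
    obtain ⟨T, hT⟩ := hA hm
    obtain ⟨T', hT'⟩ := hB hm
    exact ⟨_, (hT.mul hT' hm.le (min_le_right _ _) hm.le (min_le_right _ _)).mono le_rfl
      (by linarith [min_le_left (ε / 2) 1])⟩

end Decomposition
end UQI
end

/-! ### Assembly of the theorem. -/

theorem mainTheorem1 :
    -- the number of excitations of the `a` register is conserved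
    (∀ n : ℕ, Commute (UQI.ham₁ n) (UQI.onA (UQI.totalZ n))) ∧
    -- the action of `H_1` on the states `|k⟩|ψ_k⟩`
    (∀ (n : ℕ) (ψ : Fin (n + 2) → UQI.Reg n),
      (∀ i : Fin (n + 1), ψ i.succ = (UQI.swapOp i.castSucc i.succ).mulVec (ψ i.castSucc)) →
      ∀ k : Fin (n + 2),
        (UQI.ham₁ n).mulVec (UQI.tens (UQI.ket k) (ψ k)) =
          ∑ l : Fin (n + 2), if (l : ℕ) + 1 = k ∨ (l : ℕ) = k + 1
            then UQI.tens (UQI.ket l) (ψ l) else 0) ∧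
    -- the mapping to the state-transfer chain, without and with fields on spins `1` and `N`
    (∀ (n : ℕ) (ψ : Fin (n + 2) → UQI.Reg n),
      (∀ i : Fin (n + 1), ψ i.succ = (UQI.swapOp i.castSucc i.succ).mulVec (ψ i.castSucc)) →
      ∀ α : Fin (n + 2) → ℂ,
        (∃ β : Fin (n + 2) → ℂ,
          (UQI.hamST n - (1 / 2 : ℂ) • UQI.boundaryZ n).mulVec (UQI.chainVec α) =
              UQI.chainVec β ∧
            (UQI.ham₁ n).mulVec (UQI.dressedVec ψ α) = UQI.dressedVec ψ β) ∧
        (∀ h : ℝ, ∃ β : Fin (n + 2) → ℂ,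
          (UQI.hamST n + ((h : ℂ) - 1 / 2) • UQI.boundaryZ n).mulVec (UQI.chainVec α) =
              UQI.chainVec β ∧
            (UQI.hamField n h h).mulVec (UQI.dressedVec ψ α) = UQI.dressedVec ψ β)) ∧
    -- heralded transfer from spin `s` to spin `N` applies the product of swaps, with the
    -- amplitudes of the state-transfer chain
    (∀ (n : ℕ) (s : Fin (n + 2)) (h : ℝ) (ts : List NNReal),
      List.Forall₂
        (fun K z => ∀ ψ : UQI.Reg n,
          K.mulVec (UQI.tens (UQI.ket s) ψ) =
            z • UQI.tens (UQI.ket (Fin.last (n + 1))) ((UQI.swapChain s).mulVec ψ))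
        (UQI.measureRepeat n h ts).successOps
        (UQI.arrivalAmps (UQI.hamST n + ((h : ℂ) - 1 / 2) • UQI.boundaryZ n) ts (UQI.ket s))) ∧
    -- the product of swaps is a cyclic permutation of the qubits `s, …, N`
    (∀ (n : ℕ) (s : Fin (n + 2)) (x : UQI.Cfg n),
      (UQI.swapChain s).mulVec (Pi.single x 1) =
        Pi.single (fun j => x (if h : s ≤ j ∧ (j : ℕ) < n + 1 then ⟨j + 1, by omega⟩
          else if j = Fin.last (n + 1) then s else j)) 1) ∧
    -- repetitions of the two cycles place any pair of qubits on spins `1` and `2`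
    (∀ (n : ℕ) (i j : Fin (n + 2)), i ≠ j → ∃ m < n + 2, ∃ l < n + 1, ∀ x : UQI.Cfg n,
      ∃ y : UQI.Cfg n,
        (UQI.swapChain 1 ^ l * UQI.swapChain 0 ^ m).mulVec (Pi.single x 1) = Pi.single y 1 ∧
          y 0 = x i ∧ y 1 = x j) ∧
    -- transfer in time `O(N)` with probability at least of order `N ^ (-1/3)`
    (∃ C > (0 : ℝ), ∃ c > (0 : ℝ), ∀ n : ℕ,
      (∃ P : UQI.Protocol n (UQI.endControl n), P.duration ≤ C * (n + 2) ∧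
        P.Heralds (UQI.ket 0) (UQI.ket (Fin.last (n + 1))) (UQI.swapChain 0)
          (c * ((n : ℝ) + 2) ^ (-(1 / 3) : ℝ))) ∧
      (∃ P : UQI.Protocol n (UQI.fullControl n), P.duration ≤ C * (n + 2) ∧
        P.Heralds (UQI.ket 1) (UQI.ket (Fin.last (n + 1))) (UQI.swapChain 1)
          (c * ((n : ℝ) + 2) ^ (-(1 / 3) : ℝ)))) ∧
    -- heralded transfer with failure probability below `ε` in time `O(N ^ (5/3) log (1/ε))`
    (∃ C > (0 : ℝ), ∀ (n : ℕ) (ε : ℝ), 0 < ε → ε ≤ 1 / 2 →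
      (∃ P : UQI.Protocol n (UQI.endControl n),
        P.duration ≤ C * ((n : ℝ) + 2) ^ (5 / 3 : ℝ) * Real.log (1 / ε) ∧
        P.Heralds (UQI.ket 0) (UQI.ket (Fin.last (n + 1))) (UQI.swapChain 0) (1 - ε)) ∧
      (∃ P : UQI.Protocol n (UQI.fullControl n),
        P.duration ≤ C * ((n : ℝ) + 2) ^ (5 / 3 : ℝ) * Real.log (1 / ε) ∧
        P.Heralds (UQI.ket 1) (UQI.ket (Fin.last (n + 1))) (UQI.swapChain 1) (1 - ε))) ∧
    -- one- and two-qubit gates on arbitrary qubits in time `O(N ^ (8/3) log (1/ε))`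
    (∃ C > (0 : ℝ), ∀ (n : ℕ) (ε : ℝ), 0 < ε → ε ≤ 1 / 2 →
      (∀ (j : Fin (n + 2)) (V : Matrix.unitaryGroup (Fin 2) ℂ),
        ∃ P : UQI.Protocol n (UQI.fullControl n),
          P.duration ≤ C * ((n : ℝ) + 2) ^ (8 / 3 : ℝ) * Real.log (1 / ε) ∧
          P.Heralds (UQI.vac n) (UQI.vac n) (UQI.site j (V : Matrix _ _ ℂ)) (1 - ε)) ∧
      (∀ (j k : Fin (n + 2)), j ≠ k → ∀ V : Matrix.unitaryGroup (Fin 2 × Fin 2) ℂ,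
        ∃ P : UQI.Protocol n (UQI.fullControl n),
          P.duration ≤ C * ((n : ℝ) + 2) ^ (8 / 3 : ℝ) * Real.log (1 / ε) ∧
          P.Heralds (UQI.vac n) (UQI.vac n) (UQI.site₂ j k (V : Matrix _ _ ℂ)) (1 - ε))) ∧
    -- universality: every unitary of the `b` register
    (∀ (n : ℕ) (ε : ℝ), 0 < ε → ∀ W : Matrix.unitaryGroup (UQI.Cfg n) ℂ,
      ∃ P : UQI.Protocol n (UQI.fullControl n),
        P.Heralds (UQI.vac n) (UQI.vac n) (W : Matrix _ _ ℂ) (1 - ε)) := by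
  refine ⟨UQI.commute_ham₁_totalZ, fun n ψ hψ k => ?_, fun n ψ hψ α => ⟨?_, fun h => ?_⟩,
    fun n s h ts => UQI.measureRepeat_heralds s h ts, fun n s x => ?_, fun n i j hij => ?_,
    ⟨112, by norm_num, 1 / 32, by norm_num, fun n => ⟨?_, ?_⟩⟩,
    ⟨1152, by norm_num, fun n ε hε hε' => ⟨?_, ?_⟩⟩,
    ⟨46080, by norm_num, fun n ε hε hε' => ⟨fun j V => ?_, fun j k hjk V => ?_⟩⟩,
    fun n ε hε W => ?_⟩
  · rw [UQI.ham₁_mulVec_tens hψ]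
    refine Finset.sum_congr rfl fun l _ => ?_
    simp only [UQI.hop, Matrix.of_apply]
    split_ifs <;> simp
  -- The chain without fields is the case h = 0.
  · obtain ⟨β, h1, h2⟩ := UQI.mapping_to_chain hψ α 0
    refine ⟨β, ?_, ?_⟩
    · rw [← h1, Complex.ofReal_zero, zero_sub, neg_smul, sub_eq_add_neg]
    · rw [← h2]
      simp [UQI.hamField]
  · exact UQI.mapping_to_chain hψ α h
  · rw [UQI.swapChain_mulVec_single]
    congr 1
    ext j
    simp only [UQI.cyc, Function.comp_apply,
      show (j : ℕ) + 1 < n + 2 ↔ (j : ℕ) < n + 1 from Nat.succ_lt_succ_iff]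
  · obtain ⟨m, hm, l, hl, h⟩ := UQI.exists_cycles_to_front hij
    refine ⟨m, hm, l, hl, fun x => ⟨_, (h x).1, ?_, ?_⟩⟩
    · exact congrArg x (h x).2.1
    · exact congrArg x (h x).2.2
  · exact UQI.exists_protocol_linear UQI.hasPhases_endControl
  · obtain ⟨P, hP, hPh⟩ := UQI.exists_protocol_linear (UQI.hasPhases_fullControl (n := n))
    obtain ⟨Q, hQ, hQh⟩ := UQI.exists_heralds_second hPh
    exact ⟨Q, hQ.trans_le hP, hQh⟩
  · obtain ⟨P, hP, hPh⟩ := UQI.exists_protocol_certain (UQI.hasPhases_endControl (n := n)) hε hε'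
    exact ⟨P, hP.trans (UQI.duration_bound_le n hε hε'), hPh⟩
  · obtain ⟨P, hP, hPh⟩ := UQI.exists_protocol_certain (UQI.hasPhases_fullControl (n := n)) hε hε'
    obtain ⟨Q, hQ, hQh⟩ := UQI.exists_heralds_second hPh
    exact ⟨Q, hQ.trans_le (hP.trans (UQI.duration_bound_le n hε hε')), hQh⟩
  · exact UQI.implements_site j V.2 hε hε'
  · exact UQI.implements_site₂ hjk V.2 hε hε'
  · obtain ⟨T, P, -, hP⟩ := UQI.exists_implements W.2 hε
    exact ⟨P, hP⟩
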